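/- Let $d\ge 1$, let $U\subset\mathbb{R}^d$ be a bounded open set with $C^\infty$ boundary, let $m\in(0,\infty)$, $f_1,\dots,f_n\in C_b^2(U)$ and $z=(z^1,\dots,z^n)\in C([0,\infty);\mathbb{R}^n)$. Write $r^{[a]}=|r|^{a-1}r$, $\overline\chi(s,\xi)=\mathbf 1_{\{0<\xi<s\}}-\mathbf 1_{\{s<\xi<0\}}$, $z^k_{s,t}=z^k_t-z^k_s$, and, for $0\le s\le t$, $$v_{s,t}(x)=\exp\Big(-\sum_{k=1}^n f_k(x)z^k_{s,t}\Big),\qquad \rho_{s,t}(x,\xi)=\rho_0\big(x,\xi\, v_{s,t}(x)\big)\,v_{s,t}(x)\quad\text{for }\rho_0\in C_c^\infty(U\times\mathbb{R}).$$ For $u_0\in L^2(U)$, a pathwise kinetic solution with initial data $u_0$ of $$du=\Delta(u|u|^{m-1})\,dt+\sum_{k=1}^n f_k(x)\,u\circ dz^k_t\ \text{ in }U\times(0,\infty),\qquad u=0\ \text{ on }\partial U\times(0,\infty),$$ is a function $u\in L^\infty_{\rm loc}([0,\infty);L^2(U))$ such that (i) $u^{[\frac{m+1}{2}]}\in L^2([0,T];H^1_0(U))$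 for every $T>0$; the parabolic defect measure of $u$ is then $q=\frac{4m}{(m+1)^2}\,\delta_0(\xi-u(x,t))\,|\nabla u^{[\frac{m+1}{2}]}|^2$ on $U\times\mathbb{R}\times(0,\infty)$; (ii) there is a nonnegative measure $p$ on $U\times\mathbb{R}\times(0,\infty)$, finite on $U\times\mathbb{R}\times(0,T)$ for every $T>0$ (an entropy defect measure of $u$), and a Lebesgue-null set $\mathcal N\subset(0,\infty)$ such that, for $\chi(x,\xi,t)=\overline\chi(u(x,t),\xi)$, for all $s<t$ in $[0,\infty)\setminus\mathcal N$ and all $\rho_0\in C_c^\infty(U\times\mathbb{R})$, $$\int_{\mathbb{R}}\int_U\chi\rho_{s,r}\,dx\,d\xi\,\Big|_{r=s}^{t}=\int_s^t\int_{\mathbb{R}}\int_U m|\xi|^{m-1}\chi\,\Delta\rho_{s,r}\,dx\,d\xi\,dr-\int_s^t\int_{\mathbb{R}}\int_U\partial_\xi\rho_{s,r}\,d(p+q),$$ where, on the left-hand side for $s=0$, $\chi(x,\xi,0)$ is understood as $\overline\chi(u_0(x),\xi)$. **Proposition.** Let $\delta\in(0,1]$ and $T>0$. There exists a constant $C>0$,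 depending only on $m$, $U$, $T$, $\delta$ and the fixed data $(f_k)_k$ and $z$, such that for every $u_0\in L^2(U)$, every pathwise kinetic solution $u$ with initial data $u_0$, and every entropy defect measure $p$ of $u$, with $q$ the parabolic defect measure of $u$, $$\|u\|_{L^\infty([0,T];L^{1+\delta}(U))}^{1+\delta}+\int_0^T\int_{\mathbb{R}}\int_U|\xi|^{\delta-1}\,d(p+q)\ \le\ C\Big(\|u_0\|_{L^{1+\delta}(U)}^{1+\delta}+\|u_0\|_{L^2(U)}^{2\frac{m+\delta}{m+1}}\Big),$$ where $|\xi|^{\delta-1}=+\infty$ at $\xi=0$ if $\delta<1$. -/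

import Mathlib

open MeasureTheory Set Filter Topology
open scoped ContDiff

noncomputable section

namespace PathwiseKinetic

/-- The space `ℝ^d` with the Euclidean norm. -/
abbrev Space (d : ℕ) : Type := EuclideanSpace ℝ (Fin d)

/-- A bounded open set of class `C^∞`: near each boundary point, `U` is the strict sublevel set
`{φ < 0}` of a smooth function with nonvanishing gradient. -/
structure IsSmoothBoundedOpen {d : ℕ} (U : Set (Space d)) : Prop where
  isOpen : IsOpen U
  isBounded : Bornology.IsBounded U
  smooth_boundary : ∀ x₀ ∈ frontier U, ∃ (V : Set (Space d)) (φ : Space d → ℝ),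
    IsOpen V ∧ x₀ ∈ V ∧ ContDiffOn ℝ ∞ φ V ∧ (∀ x ∈ V, fderiv ℝ φ x ≠ 0) ∧
      U ∩ V = {x | x ∈ V ∧ φ x < 0}

/-- `f ∈ C_b^2(U)`: twice continuously differentiable on the open set `U`, with `f`, `∇f` and
`∇²f` bounded on `U`. -/
def IsCb2 {d : ℕ} (U : Set (Space d)) (f : Space d → ℝ) : Prop :=
  ContDiffOn ℝ 2 f U ∧ ∀ i : ℕ, i ≤ 2 → ∃ C : ℝ, ∀ x ∈ U, ‖iteratedFDeriv ℝ i f x‖ ≤ C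

/-- The signed power `r^{[a]} = |r|^{a-1} r`. -/
def signedPow (a r : ℝ) : ℝ := |r| ^ (a - 1) * r

/-- The kinetic function `χ̄(s, ξ) = 1_{0 < ξ < s} - 1_{s < ξ < 0}`. -/
def chiBar (s ξ : ℝ) : ℝ :=
  (Ioo 0 s).indicator (fun _ => (1 : ℝ)) ξ - (Ioo s 0).indicator (fun _ => (1 : ℝ)) ξ

/-- `w ∈ H^1_0(U)` with weak gradient `g`: the pair `(w, g)` is an `L²(U)`-limit of pairs
`(φₙ, ∇φₙ)` with `φₙ ∈ C_c^∞(U)`. -/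
def IsH10Pair {d : ℕ} (U : Set (Space d)) (w : Space d → ℝ) (g : Space d → Space d) : Prop :=
  ∃ φ : ℕ → Space d → ℝ,
    (∀ n, ContDiff ℝ ∞ (φ n) ∧ HasCompactSupport (φ n) ∧ tsupport (φ n) ⊆ U) ∧
    Tendsto (fun n => eLpNorm (fun x => φ n x - w x) 2 (volume.restrict U)) atTop (𝓝 0) ∧
    Tendsto (fun n => eLpNorm (fun x => gradient (φ n) x - g x) 2 (volume.restrict U))
      atTop (𝓝 0)

/-- `w ∈ L²([0,T]; H^1_0(U))` for each `T > 0`, with spatial weak gradient `G`. The arguments of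
`w` and `G` are the time and the space variable. -/
structure IsL2H10Gradient {d : ℕ} (U : Set (Space d)) (w : ℝ → Space d → ℝ)
    (G : ℝ → Space d → Space d) : Prop where
  aestronglyMeasurable : AEStronglyMeasurable (fun y : ℝ × Space d => w y.1 y.2)
    (volume.restrict (Ioi (0 : ℝ) ×ˢ U))
  aestronglyMeasurable_grad : AEStronglyMeasurable (fun y : ℝ × Space d => G y.1 y.2)
    (volume.restrict (Ioi (0 : ℝ) ×ˢ U))
  mem_H10 : ∀ᵐ t ∂(volume.restrict (Ioi (0 : ℝ))), IsH10Pair U (w t) (G t)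
  lintegral_lt_top : ∀ T : ℝ, 0 < T →
    ∫⁻ t in Ioc 0 T, (eLpNorm (w t) 2 (volume.restrict U) ^ 2 +
      eLpNorm (G t) 2 (volume.restrict U) ^ 2) < ⊤

/-- The spatial weak gradient of a function in `L²_loc([0,∞); H^1_0(U))`; it is unique up to
sets of measure zero in `(0,∞) × U`. -/
def spatialGradient {d : ℕ} (U : Set (Space d)) (w : ℝ → Space d → ℝ) :
    ℝ → Space d → Space d :=
  Classical.epsilon (IsL2H10Gradient U w)

/-- `u ∈ L^∞_loc([0,∞); L²(U))`, with `u t x` the value at time `t` and point `x`. -/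
def IsLinftyLocL2 {d : ℕ} (U : Set (Space d)) (u : ℝ → Space d → ℝ) : Prop :=
  AEStronglyMeasurable (fun y : ℝ × Space d => u y.1 y.2)
      (volume.restrict (Ioi (0 : ℝ) ×ˢ U)) ∧
    ∀ T : ℝ, 0 < T →
      essSup (fun t => eLpNorm (u t) 2 (volume.restrict U)) (volume.restrict (Icc 0 T)) < ⊤

/-- The signed power `u^{[(m+1)/2]}`. -/
def halfPow {d : ℕ} (m : ℝ) (u : ℝ → Space d → ℝ) : ℝ → Space d → ℝ :=
  fun t x => signedPow ((m + 1) / 2) (u t x)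

/-- The parabolic defect measure
`q = 4m/(m+1)² δ₀(ξ - u(x,t)) |∇u^{[(m+1)/2]}|² dx dξ dt` on `U × ℝ × (0,∞)`, as the image
under `(t,x) ↦ (x, u(x,t), t)` of the measure `4m/(m+1)² |∇u^{[(m+1)/2]}|² dt dx`. -/
def parabolicDefect {d : ℕ} (m : ℝ) (U : Set (Space d)) (u : ℝ → Space d → ℝ) :
    Measure (Space d × ℝ × ℝ) :=
  ((volume.restrict (Ioi (0 : ℝ) ×ˢ U)).withDensity
    (fun y : ℝ × Space d => ENNReal.ofReal (4 * m / (m + 1) ^ 2) *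
      ‖spatialGradient U (halfPow m u) y.1 y.2‖ₑ ^ 2)).map
    (fun y : ℝ × Space d => (y.2, u y.1 y.2, y.1))

/-- The change of variables factor `v_{s,t}(x) = exp(-∑ₖ fₖ(x) z^k_{s,t})`, where
`z^k_{s,t} = z^k_t - z^k_s`. -/
def weight {d n : ℕ} (f : Fin n → Space d → ℝ) (z : ℝ → Fin n → ℝ) (s t : ℝ)
    (x : Space d) : ℝ :=
  Real.exp (-∑ k, f k x * (z t k - z s k))

/-- The backward characteristic `Π^{x,ξ}_{t,t-s} = ξ exp(∑ₖ fₖ(x) z^k_{t,s})`. -/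
def backwardChar {d n : ℕ} (f : Fin n → Space d → ℝ) (z : ℝ → Fin n → ℝ) (s t : ℝ)
    (x : Space d) (ξ : ℝ) : ℝ :=
  ξ * Real.exp (∑ k, f k x * (z s k - z t k))

/-- The transported test function `ρ_{s,t}(x,ξ) = ρ₀(x, Π^{x,ξ}_{t,t-s}) v_{s,t}(x)`. -/
def transported {d n : ℕ} (f : Fin n → Space d → ℝ) (z : ℝ → Fin n → ℝ)
    (ρ₀ : Space d × ℝ → ℝ) (s t : ℝ) (x : Space d) (ξ : ℝ) : ℝ :=
  ρ₀ (x, backwardChar f z s t x ξ) * weight f z s t x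

/-- The state at time `t`, which at `t = 0` is the initial datum. -/
def state {d : ℕ} (u₀ : Space d → ℝ) (u : ℝ → Space d → ℝ) (t : ℝ) : Space d → ℝ :=
  if t = 0 then u₀ else u t

/-- The pairing `∫_ℝ ∫_U χ(x,ξ,t) ρ_{s,t}(x,ξ) dx dξ`; at `t = 0` the kinetic function is that
of the initial datum. -/
def kineticPairing {d n : ℕ} (U : Set (Space d)) (f : Fin n → Space d → ℝ)
    (z : ℝ → Fin n → ℝ) (u₀ : Space d → ℝ) (u : ℝ → Space d → ℝ) (ρ₀ : Space d × ℝ → ℝ)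
    (s t : ℝ) : ℝ :=
  ∫ y in U ×ˢ (univ : Set ℝ), chiBar (state u₀ u t y.1) y.2 * transported f z ρ₀ s t y.1 y.2

/-- `p` is a nonnegative entropy defect measure for `u` on `U × ℝ × (0,∞)`: it is finite on
`U × ℝ × (0,T)` for each `T > 0`, and the kinetic equation, tested against functions transported
along the characteristics, holds between all times outside of a null set. -/
structure IsEntropyDefect {d n : ℕ} (m : ℝ) (U : Set (Space d)) (f : Fin n → Space d → ℝ)
    (z : ℝ → Fin n → ℝ) (u₀ : Space d → ℝ) (u : ℝ → Space d → ℝ)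
    (p : Measure (Space d × ℝ × ℝ)) : Prop where
  finite : ∀ T : ℝ, 0 < T → p (U ×ˢ (univ : Set ℝ) ×ˢ Ioo 0 T) < ⊤
  kinetic_equation : ∃ N : Set ℝ, N ⊆ Ioi 0 ∧ volume N = 0 ∧
    ∀ s t : ℝ, 0 ≤ s → s < t → s ∉ N → t ∉ N →
    ∀ ρ₀ : Space d × ℝ → ℝ, ContDiff ℝ ∞ ρ₀ → HasCompactSupport ρ₀ →
      tsupport ρ₀ ⊆ U ×ˢ (univ : Set ℝ) →
      kineticPairing U f z u₀ u ρ₀ s t - kineticPairing U f z u₀ u ρ₀ s s =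
        (∫ y in U ×ˢ (univ : Set ℝ) ×ˢ Ioc s t,
          m * |y.2.1| ^ (m - 1) * chiBar (u y.2.2 y.1) y.2.1 *
            Laplacian.laplacian (fun x => transported f z ρ₀ s y.2.2 x y.2.1) y.1) -
        ∫ y in U ×ˢ (univ : Set ℝ) ×ˢ Ioc s t,
          deriv (fun ξ => transported f z ρ₀ s y.2.2 y.1 ξ) y.2.1
            ∂(p + parabolicDefect m U u)

/-- `u` is a pathwise kinetic solution of
`du = Δ(u|u|^{m-1}) dt + ∑ₖ fₖ(x) u ∘ dz^k` in `U × (0,∞)`, with `u = 0` on `∂U × (0,∞)` and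
initial datum `u₀`. -/
structure IsPathwiseKineticSolution {d n : ℕ} (m : ℝ) (U : Set (Space d))
    (f : Fin n → Space d → ℝ) (z : ℝ → Fin n → ℝ) (u₀ : Space d → ℝ)
    (u : ℝ → Space d → ℝ) : Prop where
  linftyLocL2 : IsLinftyLocL2 U u
  halfPow_mem : ∃ G, IsL2H10Gradient U (halfPow m u) G
  exists_entropyDefect : ∃ p, IsEntropyDefect m U f z u₀ u p

end PathwiseKinetic

end

open PathwiseKinetic

/-!
# Entropy estimate for pathwise kinetic solutions

The kinetic equation is tested with `ρ₀(x, ξ) = φ(x) ψ(ξ)`, where `φ` is a cutoff of `U` and `ψ`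
regularizes the signed power `ξ^{[δ]}`. The left-hand side then produces the `L^{1+δ}` norms of the
solution, and the term with `∂_ξ ρ` produces the singular moment of order `δ - 1` of the defect
measures.

*Test functions.* The profile is `ψ(ξ) = b(ξ / R) ξ (ξ² + η²)^{(δ-1)/2}`, with `b` a bump function.
The quantities `ψ`, `ξ ψ'` and `ξ² ψ''` are all bounded by the regularized power itself
(`exists_bound_profile`), and `ψ` enters a transported test function only through
`ψ(ξ e^{-g}) e^{-g}`, with the exponent `g(x) = ∑ₖ fₖ(x) z^k_{s,t}`. Hence the Laplacian of a
transported test function is of order `τ |ξ|^δ`, with `τ` the oscillation of `z`, plus a term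
supported where `φ` varies (`exists_bound_laplacian_transported`). As the moments of `χ̄(u, ·)` are
powers of `u`, the diffusion term is of order `τ ∫∫ |u|^{m+δ}`, up to the boundary error.

*Boundary error.* Where `φ` varies, in the layer of width `ε`, the Laplacian is of order
`ε⁻² η^{δ-1} |ξ|`, and the resulting error is `ε⁻² η^{δ-1} ∫∫_{layer} |u|^{m+1}`. Near a smooth
boundary a shift along the normal by `3ε` moves the layer out of `U`; integration of the gradient
along the shift gives `∫_{layer ε} |w|² ≤ C ε² ∫_{layer 4ε} |∇w|²` for `w` in `H¹₀(U)`
(`IsSmoothBoundedOpen.exists_layer_poincare`). For `w = u^{[(m+1)/2]}` this bounds the error by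
`η^{δ-1}` times the energy of `∇w` in a shrinking layer, which tends to zero as `ε → 0` with `η`
fixed. Fatou's lemma, for `η → 0` and `R → ∞`, then gives `exists_entropy_estimate`:
`‖u_t‖^{1+δ} + ∫ |ξ|^{δ-1} d(p+q) ≤ B (‖u_s‖^{1+δ} + τ ∫∫ |u|^{m+δ})`.

*Closing the estimate.* For `δ = 1` the second term on the left is the mass of `p + q`, and the mass
of `q` controls `∫∫ |u|^{m+1}` by the Poincaré inequality. So on a time interval where the
oscillation of `z` is small the last term is absorbed (`exists_short_time_energy_estimate`).
The length of such intervals depends only on the modulus of continuity of `z`, and iteration gives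
`∫∫ |u|^{m+1} ≤ C ‖u₀‖²` on `[0, T+1]` (`exists_energy_estimate`). Finally the entropy estimate is
used once more, for the given `δ` and from the time zero, where now `τ` is only bounded, and
`∫∫ |u|^{m+δ}` is estimated by Hölder's inequality; this is the source of the exponent
`2(m+δ)/(m+1)`.
-/

namespace PathwiseKinetic

/-! ### The Poincaré inequality and its version in a boundary layer -/

lemma enorm_fderiv_eq_enorm_gradient {d : ℕ} (φ : Space d → ℝ) (x : Space d) :
    ‖fderiv ℝ φ x‖ₑ = ‖gradient φ x‖ₑ := by
  rw [gradient, enorm_eq_iff_norm_eq, LinearIsometryEquiv.norm_map]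

/-- The square of the increment of a `C¹` function along a segment is at most the mean square of
its gradient along that segment, times the square of the length. -/
lemma enorm_sub_sq_le_lintegral_gradient {d : ℕ} {φ : Space d → ℝ} (hφ : ContDiff ℝ 1 φ)
    (x e : Space d) :
    ‖φ (x + e) - φ x‖ₑ ^ 2 ≤
      ‖e‖ₑ ^ 2 * ∫⁻ t in Icc (0 : ℝ) 1, ‖gradient φ (x + t • e)‖ₑ ^ 2 := by
  have hd : ∀ t : ℝ, HasDerivAt (fun t : ℝ => φ (x + t • e)) (fderiv ℝ φ (x + t • e) e) t := by
    intro t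
    have h1 : HasFDerivAt φ (fderiv ℝ φ (x + t • e)) (x + t • e) :=
      (hφ.differentiable one_ne_zero _).hasFDerivAt
    have h2 : HasDerivAt (fun t : ℝ => x + t • e) e t := by
      simpa using ((hasDerivAt_id t).smul_const e).const_add x
    exact h1.comp_hasDerivAt t h2
  have hcont : Continuous fun t : ℝ => fderiv ℝ φ (x + t • e) := by
    have := hφ.continuous_fderiv one_ne_zero
    fun_prop
  have hcont' : Continuous fun t : ℝ => fderiv ℝ φ (x + t • e) e := by fun_prop
  have hftc := intervalIntegral.integral_eq_sub_of_hasDerivAt (fun t _ => hd t)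
    (hcont'.intervalIntegrable 0 1)
  have heq : φ (x + e) - φ x = ∫ t in Icc (0 : ℝ) 1, fderiv ℝ φ (x + t • e) e := by
    rw [integral_Icc_eq_integral_Ioc, ← intervalIntegral.integral_of_le zero_le_one, hftc]
    simp
  have h1 : ‖φ (x + e) - φ x‖ₑ ≤ ‖e‖ₑ * ∫⁻ t in Icc (0 : ℝ) 1, ‖gradient φ (x + t • e)‖ₑ := by
    rw [heq, ← lintegral_const_mul' _ _ enorm_ne_top]
    refine (enorm_integral_le_lintegral_enorm _).trans (lintegral_mono fun t => ?_)
    rw [← enorm_fderiv_eq_enorm_gradient, mul_comm]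
    exact ContinuousLinearMap.le_opENorm _ _
  have hmeas : AEMeasurable (fun t : ℝ => ‖gradient φ (x + t • e)‖ₑ)
      (volume.restrict (Icc (0 : ℝ) 1)) := by
    simp_rw [← enorm_fderiv_eq_enorm_gradient]
    exact hcont.enorm.aemeasurable
  have h2 : (∫⁻ t in Icc (0 : ℝ) 1, ‖gradient φ (x + t • e)‖ₑ) ^ 2 ≤
      ∫⁻ t in Icc (0 : ℝ) 1, ‖gradient φ (x + t • e)‖ₑ ^ 2 := by
    have := ENNReal.lintegral_mul_le_Lp_mul_Lq (volume.restrict (Icc (0 : ℝ) 1))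
      Real.HolderConjugate.two_two hmeas (aemeasurable_const (b := (1 : ENNReal)))
    simp only [Pi.mul_apply, mul_one, ENNReal.one_rpow, lintegral_const,
      Measure.restrict_apply_univ, Real.volume_Icc, sub_zero, ENNReal.ofReal_one] at this
    calc _ ≤ ((∫⁻ t in Icc (0 : ℝ) 1, ‖gradient φ (x + t • e)‖ₑ ^ (2 : ℝ)) ^ (1 / 2 : ℝ)) ^ 2 := by
          gcongr
      _ = _ := by
        rw [← ENNReal.rpow_natCast, ← ENNReal.rpow_mul]
        norm_num
  calc _ ≤ (‖e‖ₑ * ∫⁻ t in Icc (0 : ℝ) 1, ‖gradient φ (x + t • e)‖ₑ) ^ 2 := by gcongr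
    _ ≤ _ := by rw [mul_pow]; gcongr

/-- A Poincaré inequality by translation: if the shift by `e` moves every point of `A` out of `U`,
then a test function on `U` is controlled on `A` by its gradient on any set `B` that contains the
parts in `U` of the segments from `x ∈ A` to `x + e`. -/
lemma lintegral_sq_le_of_translate {d : ℕ} {U A B : Set (Space d)} {φ : Space d → ℝ}
    (hφ : ContDiff ℝ 1 φ) (hsupp : tsupport φ ⊆ U) (hAm : MeasurableSet A) (hBm : MeasurableSet B)
    (e : Space d) (hA : ∀ x ∈ A, x + e ∉ U)
    (hB : ∀ x ∈ A, ∀ t ∈ Icc (0 : ℝ) 1, x + t • e ∈ U → x + t • e ∈ B) :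
    ∫⁻ x in A, ‖φ x‖ₑ ^ 2 ≤ ‖e‖ₑ ^ 2 * ∫⁻ x in B, ‖gradient φ x‖ₑ ^ 2 := by
  have hgm : Measurable fun x => ‖gradient φ x‖ₑ ^ 2 := by
    simp_rw [← enorm_fderiv_eq_enorm_gradient]
    exact ((hφ.continuous_fderiv one_ne_zero).enorm.measurable).pow_const 2
  have hF : Measurable (B.indicator fun x => ‖gradient φ x‖ₑ ^ 2) := hgm.indicator hBm
  have hpt : ∀ x ∈ A, ‖φ x‖ₑ ^ 2 ≤ ‖e‖ₑ ^ 2 *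
      ∫⁻ t in Icc (0 : ℝ) 1, B.indicator (fun x => ‖gradient φ x‖ₑ ^ 2) (x + t • e) := by
    intro x hx
    have h0 : φ (x + e) = 0 := image_eq_zero_of_notMem_tsupport fun h => hA x hx (hsupp h)
    have h := enorm_sub_sq_le_lintegral_gradient hφ x e
    rw [h0, zero_sub, enorm_neg] at h
    refine h.trans ?_
    gcongr 1
    refine setLIntegral_mono' measurableSet_Icc fun t ht => ?_
    by_cases hU : x + t • e ∈ U
    · rw [indicator_of_mem (hB x hx t ht hU)]
    · have : gradient φ (x + t • e) = 0 := by
        have hs : x + t • e ∉ tsupport (fderiv ℝ φ) :=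
          fun h => hU (hsupp (tsupport_fderiv_subset ℝ h))
        rw [gradient, image_eq_zero_of_notMem_tsupport hs, map_zero]
      simp [this]
  calc ∫⁻ x in A, ‖φ x‖ₑ ^ 2
      ≤ ∫⁻ x in A, ‖e‖ₑ ^ 2 *
        ∫⁻ t in Icc (0 : ℝ) 1, B.indicator (fun x => ‖gradient φ x‖ₑ ^ 2) (x + t • e) :=
        setLIntegral_mono' hAm hpt
    _ ≤ ∫⁻ x, ‖e‖ₑ ^ 2 *
        ∫⁻ t in Icc (0 : ℝ) 1, B.indicator (fun x => ‖gradient φ x‖ₑ ^ 2) (x + t • e) :=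
        setLIntegral_le_lintegral _ _
    _ = ‖e‖ₑ ^ 2 * ∫⁻ t in Icc (0 : ℝ) 1,
        ∫⁻ x, B.indicator (fun x => ‖gradient φ x‖ₑ ^ 2) (x + t • e) := by
        rw [lintegral_const_mul' _ _ (by finiteness), lintegral_lintegral_swap]
        exact (hF.comp (by fun_prop : Measurable fun p : Space d × ℝ => p.1 + p.2 • e)).aemeasurable
    _ = ‖e‖ₑ ^ 2 * ∫⁻ x in B, ‖gradient φ x‖ₑ ^ 2 := by
        simp [lintegral_add_right_eq_self (μ := (volume : Measure (Space d))),
          lintegral_indicator hBm]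

lemma lintegral_enorm_sq_eq {α E : Type*} [MeasurableSpace α] [NormedAddCommGroup E]
    (μ : Measure α) (f : α → E) : ∫⁻ x, ‖f x‖ₑ ^ 2 ∂μ = eLpNorm f 2 μ ^ 2 := by
  rw [eLpNorm_eq_lintegral_rpow_enorm_toReal (by norm_num) (by norm_num), ← ENNReal.rpow_natCast,
    ← ENNReal.rpow_mul]
  simp

/-- The translation Poincaré inequality for functions of class `H¹₀`. -/
lemma IsH10Pair.lintegral_sq_le {d : ℕ} {U A B : Set (Space d)} {w : Space d → ℝ}
    {g : Space d → Space d} (h : IsH10Pair U w g)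
    (hw : AEStronglyMeasurable w (volume.restrict U))
    (hg : AEStronglyMeasurable g (volume.restrict U))
    (hAU : A ⊆ U) (hBU : B ⊆ U) (hAm : MeasurableSet A) (hBm : MeasurableSet B)
    (e : Space d) (hA : ∀ x ∈ A, x + e ∉ U)
    (hB : ∀ x ∈ A, ∀ t ∈ Icc (0 : ℝ) 1, x + t • e ∈ U → x + t • e ∈ B) :
    ∫⁻ x in A, ‖w x‖ₑ ^ 2 ≤ ‖e‖ₑ ^ 2 * ∫⁻ x in B, ‖g x‖ₑ ^ 2 := by
  obtain ⟨φ, hφ, hφw, hφg⟩ := h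
  rw [lintegral_enorm_sq_eq, lintegral_enorm_sq_eq, ← mul_pow]
  gcongr
  have hAr : volume.restrict A ≤ volume.restrict U := Measure.restrict_mono hAU le_rfl
  have hBr : volume.restrict B ≤ volume.restrict U := Measure.restrict_mono hBU le_rfl
  have hgr : ∀ n, Continuous (gradient (φ n)) := fun n =>
    (InnerProductSpace.toDual ℝ (Space d)).symm.continuous.comp
      ((hφ n).1.continuous_fderiv (by simp))
  have key : ∀ n, eLpNorm w 2 (volume.restrict A) ≤
      eLpNorm (fun x => φ n x - w x) 2 (volume.restrict U) + ‖e‖ₑ *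
        (eLpNorm (fun x => gradient (φ n) x - g x) 2 (volume.restrict U) +
          eLpNorm g 2 (volume.restrict B)) := by
    intro n
    have h1 : eLpNorm (φ n) 2 (volume.restrict A) ≤
        ‖e‖ₑ * eLpNorm (gradient (φ n)) 2 (volume.restrict B) := by
      have := lintegral_sq_le_of_translate ((hφ n).1.of_le (by simp)) (hφ n).2.2 hAm hBm e hA hB
      rw [lintegral_enorm_sq_eq, lintegral_enorm_sq_eq, ← mul_pow] at this
      exact (ENNReal.pow_le_pow_left_iff two_ne_zero).1 this
    have h2 : eLpNorm (gradient (φ n)) 2 (volume.restrict B) ≤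
        eLpNorm (fun x => gradient (φ n) x - g x) 2 (volume.restrict U) +
          eLpNorm g 2 (volume.restrict B) := by
      have := eLpNorm_add_le (p := 2) (((hgr n).aestronglyMeasurable.sub hg).mono_measure hBr)
        (hg.mono_measure hBr) (by norm_num)
      simp only [sub_add_cancel] at this
      refine this.trans ?_
      gcongr
      exact eLpNorm_mono_measure _ hBr
    have h3 : eLpNorm w 2 (volume.restrict A) ≤
        eLpNorm (fun x => φ n x - w x) 2 (volume.restrict U) +
          eLpNorm (φ n) 2 (volume.restrict A) := by
      have hφm := (hφ n).1.continuous.aestronglyMeasurable (μ := volume.restrict A)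
      have := eLpNorm_add_le (p := 2)
        (((hw.mono_measure hAr).sub hφm)) hφm (by norm_num)
      simp only [sub_add_cancel] at this
      refine this.trans ?_
      gcongr
      rw [eLpNorm_sub_comm]
      exact eLpNorm_mono_measure _ hAr
    exact h3.trans (by gcongr; exact h1.trans (by gcongr))
  have hlim := hφw.add (ENNReal.Tendsto.const_mul (hφg.add_const
    (eLpNorm g 2 (volume.restrict B))) (Or.inr (enorm_ne_top (x := e))))
  rw [zero_add, zero_add] at hlim
  exact ge_of_tendsto' hlim key

/-- The part of `U` at distance less than `ε` from the complement of `U`. -/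
def boundaryLayer {d : ℕ} (U : Set (Space d)) (ε : ℝ) : Set (Space d) :=
  {x | x ∈ U ∧ Metric.infDist x Uᶜ < ε}

lemma boundaryLayer_subset {d : ℕ} (U : Set (Space d)) (ε : ℝ) : boundaryLayer U ε ⊆ U :=
  fun _ hx => hx.1

lemma measurableSet_boundaryLayer {d : ℕ} {U : Set (Space d)} (hU : IsOpen U) (ε : ℝ) :
    MeasurableSet (boundaryLayer U ε) :=
  hU.measurableSet.inter
    (measurableSet_lt (Metric.continuous_infDist_pt _).measurable measurable_const)

/-- Near each point of the space, the boundary layer of width `ε` of an open set with smooth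
boundary leaves the set under the shift by `ε • e`. At a boundary point `e` is three times the unit
normal: if `a ≠ 0` is the derivative of the defining function there, then this function is at least
`-9/8 * ‖a‖ * ε` on the layer, and it increases by at least `21/8 * ‖a‖ * ε` along the shift. At an
interior point the layer is empty nearby. -/
lemma IsSmoothBoundedOpen.exists_shift {d : ℕ} {U : Set (Space d)} (hU : IsSmoothBoundedOpen U)
    (hne : Uᶜ.Nonempty) (x₀ : Space d) (hx₀ : x₀ ∈ closure U) :
    ∃ r > 0, ∃ e : Space d, ‖e‖ ≤ 3 ∧ ∀ ε ∈ Ioo 0 r, ∀ x ∈ boundaryLayer U ε,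
      x ∈ Metric.ball x₀ r → x + ε • e ∉ U := by
  by_cases hx : x₀ ∈ U
  · obtain ⟨r, hr, hrU⟩ := Metric.isOpen_iff.1 hU.isOpen x₀ hx
    refine ⟨r / 2, by positivity, 0, by simp, fun ε hε x hxl hxb => ?_⟩
    exfalso
    obtain ⟨y, hy, hxy⟩ := (Metric.infDist_lt_iff hne).1 hxl.2
    refine hy (hrU ?_)
    have h1 := dist_triangle y x x₀
    rw [dist_comm y x] at h1
    have h2 := hε.2
    rw [Metric.mem_ball] at hxb ⊢
    linarith
  · obtain ⟨V, φ, hV, hxV, hφ, hdφ, hUV⟩ := hU.smooth_boundary x₀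
      ⟨hx₀, fun h => hx (interior_subset h)⟩
    set a := fderiv ℝ φ x₀ with ha
    have ha0 : 0 < ‖a‖ := norm_pos_iff.2 (hdφ x₀ hxV)
    have hstr : HasStrictFDerivAt φ a x₀ :=
      (hφ.contDiffAt (hV.mem_nhds hxV)).hasStrictFDerivAt (by simp)
    have hev := hstr.isLittleO.def (c := ‖a‖ / 8) (by positivity)
    obtain ⟨r₁, hr₁, hball⟩ := Metric.eventually_nhds_iff_ball.1 hev
    obtain ⟨r₂, hr₂, hrV⟩ := Metric.isOpen_iff.1 hV x₀ hxV
    set g : Space d := (InnerProductSpace.toDual ℝ (Space d)).symm a with hg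
    have hgn : ‖g‖ = ‖a‖ := by rw [hg, LinearIsometryEquiv.norm_map]
    have hag : a g = ‖a‖ ^ 2 := by
      rw [← hgn, ← real_inner_self_eq_norm_sq, hg, InnerProductSpace.toDual_symm_apply]
    set r := min r₁ r₂ / 5 with hr
    have hr0 : 0 < r := by positivity
    have hrr₁ : 5 * r ≤ r₁ := by rw [hr]; linarith [min_le_left r₁ r₂]
    have hrr₂ : 5 * r ≤ r₂ := by rw [hr]; linarith [min_le_right r₁ r₂]
    refine ⟨r, hr0, (3 / ‖a‖) • g, ?_, ?_⟩
    · rw [norm_smul, hgn, Real.norm_of_nonneg (by positivity)]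
      field_simp
      exact le_rfl
    intro ε hε x hxl hxb hmem
    have hε0 := hε.1
    obtain ⟨y, hy, hxy⟩ := (Metric.infDist_lt_iff hne).1 hxl.2
    rw [Metric.mem_ball] at hxb
    have hyb : dist y x₀ < 2 * r := by
      have := dist_triangle y x x₀
      rw [dist_comm y x] at this
      linarith [hε.2]
    set w := x + ε • (3 / ‖a‖) • g with hw
    have hwx : ‖w - x‖ = 3 * ε := by
      rw [hw, add_sub_cancel_left, norm_smul, norm_smul, hgn, Real.norm_of_nonneg hε0.le,
        Real.norm_of_nonneg (by positivity)]
      field_simp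
    have hwb : dist w x₀ < 4 * r := by
      have := dist_triangle w x x₀
      rw [dist_eq_norm w x, hwx] at this
      linarith [hε.2]
    have hin : ∀ p, dist p x₀ < 5 * r → p ∈ V := fun p hp =>
      hrV (Metric.mem_ball.2 (by linarith))
    have hφy : 0 ≤ φ y := by
      by_contra hneg
      have : y ∈ U ∩ V := by
        rw [hUV]; exact ⟨hin y (by linarith), not_le.1 hneg⟩
      exact hy this.1
    have hφw : φ w < 0 := by
      have : w ∈ U ∩ V := ⟨hmem, hin w (by linarith)⟩
      rw [hUV] at this
      exact this.2
    have e1 := hball (y, x) (by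
      rw [Metric.mem_ball, Prod.dist_eq]; exact max_lt (by linarith) (by linarith))
    have e2 := hball (w, x) (by
      rw [Metric.mem_ball, Prod.dist_eq]; exact max_lt (by linarith) (by linarith))
    simp only at e1 e2
    rw [hwx] at e2
    rw [← dist_eq_norm y x, dist_comm y x] at e1
    have e3 : a (w - x) = 3 * ε * ‖a‖ := by
      rw [hw, add_sub_cancel_left, map_smul, map_smul, hag, smul_eq_mul, smul_eq_mul]
      field_simp
    have e4 : |a (y - x)| ≤ ‖a‖ * dist x y := by
      rw [dist_comm, dist_eq_norm]; exact a.le_opNorm _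
    rw [Real.norm_eq_abs, abs_le] at e1 e2
    rw [abs_le] at e4
    have e5 : ‖a‖ * dist x y ≤ ‖a‖ * ε := by gcongr
    have e6 : 0 < ‖a‖ * ε := by positivity
    rw [e3] at e2
    nlinarith [e1.1, e1.2, e2.1, e2.2, e4.1, e4.2]

/-- The layer inequality `∫_{layer ε} |w|² ≤ C ε² ∫_{layer 4ε} |∇w|²` for `w` of class `H¹₀`, a
substitute for Hardy's inequality. -/
lemma IsSmoothBoundedOpen.exists_layer_poincare {d : ℕ} {U : Set (Space d)}
    (hU : IsSmoothBoundedOpen U) (hne : Uᶜ.Nonempty) :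
    ∃ (C : ℕ) (ε₀ : ℝ), 0 < ε₀ ∧ ∀ ε ∈ Ioo 0 ε₀, ∀ (w : Space d → ℝ) (g : Space d → Space d),
      IsH10Pair U w g → AEStronglyMeasurable w (volume.restrict U) →
      AEStronglyMeasurable g (volume.restrict U) →
      ∫⁻ x in boundaryLayer U ε, ‖w x‖ₑ ^ 2 ≤
        C * ENNReal.ofReal (ε ^ 2) * ∫⁻ x in boundaryLayer U (4 * ε), ‖g x‖ₑ ^ 2 := by
  have hcpt : IsCompact (closure U) := hU.isBounded.isCompact_closure
  choose! r hr e he hshift using hU.exists_shift hne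
  obtain ⟨t, htU, hcov⟩ := hcpt.elim_nhds_subcover (fun x => Metric.ball x (r x))
    (fun x hx => Metric.ball_mem_nhds x (hr x hx))
  obtain ⟨ε₀, hε₀, hmin⟩ : ∃ ε₀ > 0, ∀ x ∈ t, ε₀ ≤ r x := by
    rcases t.eq_empty_or_nonempty with h | h
    · exact ⟨1, one_pos, by simp [h]⟩
    · exact ⟨t.inf' h r, (Finset.lt_inf'_iff h).2 fun x hx => hr x (htU x hx),
        fun x hx => Finset.inf'_le _ hx⟩
  refine ⟨9 * t.card, ε₀, hε₀, fun ε hε w g hwg hw hg => ?_⟩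
  have hε0 := hε.1
  have hsub : boundaryLayer U ε ⊆ ⋃ x ∈ t, boundaryLayer U ε ∩ Metric.ball x (r x) := by
    intro y hy
    have := hcov (subset_closure hy.1)
    simp only [mem_iUnion] at this ⊢
    obtain ⟨x, hx, hyx⟩ := this
    exact ⟨x, hx, hy, hyx⟩
  have hball : ∀ x ∈ t, ∫⁻ y in boundaryLayer U ε ∩ Metric.ball x (r x), ‖w y‖ₑ ^ 2 ≤
      9 * ENNReal.ofReal (ε ^ 2) * ∫⁻ x in boundaryLayer U (4 * ε), ‖g x‖ₑ ^ 2 := by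
    intro x hx
    have hen : ‖ε • e x‖ ≤ 3 * ε := by
      rw [norm_smul, Real.norm_of_nonneg hε0.le]; nlinarith [he x (htU x hx)]
    have hsh : ∀ y ∈ boundaryLayer U ε ∩ Metric.ball x (r x), y + ε • e x ∉ U := fun y hy =>
      hshift x (htU x hx) ε ⟨hε0, hε.2.trans_le (hmin x hx)⟩ y hy.1 hy.2
    have := hwg.lintegral_sq_le hw hg (A := boundaryLayer U ε ∩ Metric.ball x (r x))
      (B := boundaryLayer U (4 * ε)) (fun y hy => hy.1.1) (boundaryLayer_subset U _)
      ((measurableSet_boundaryLayer hU.isOpen ε).inter measurableSet_ball)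
      (measurableSet_boundaryLayer hU.isOpen _) (ε • e x) hsh ?_
    · refine this.trans ?_
      gcongr
      calc ‖ε • e x‖ₑ ^ 2 ≤ ENNReal.ofReal (3 * ε) ^ 2 := by
            gcongr
            rw [← ofReal_norm]
            exact ENNReal.ofReal_le_ofReal hen
        _ = 9 * ENNReal.ofReal (ε ^ 2) := by
            rw [← ENNReal.ofReal_pow (by positivity), mul_pow, ENNReal.ofReal_mul (by positivity)]
            norm_num
    · intro y hy s hs hyU
      refine ⟨hyU, ?_⟩
      refine (Metric.infDist_le_dist_of_mem (hsh y hy)).trans_lt ?_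
      rw [dist_add_left, dist_eq_norm,
        show s • ε • e x - ε • e x = (s - 1) • ε • e x by rw [sub_smul, one_smul], norm_smul,
        Real.norm_eq_abs]
      have : |s - 1| ≤ 1 := abs_le.2 ⟨by linarith [hs.1], by linarith [hs.2]⟩
      nlinarith [norm_nonneg (ε • e x)]
  calc ∫⁻ x in boundaryLayer U ε, ‖w x‖ₑ ^ 2
      ≤ ∫⁻ x in ⋃ x ∈ t, boundaryLayer U ε ∩ Metric.ball x (r x), ‖w x‖ₑ ^ 2 :=
        lintegral_mono_set hsub
    _ ≤ ∑ x ∈ t, ∫⁻ y in boundaryLayer U ε ∩ Metric.ball x (r x), ‖w y‖ₑ ^ 2 := by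
        classical
        rw [← Finset.sum_coe_sort t
            (fun x => ∫⁻ y in boundaryLayer U ε ∩ Metric.ball x (r x), ‖w y‖ₑ ^ 2),
          ← tsum_fintype (L := .unconditional _), ← iUnion_subtype (fun x => x ∈ t)
            (fun x => boundaryLayer U ε ∩ Metric.ball (x : Space d) (r x))]
        exact lintegral_iUnion_le _ _
    _ ≤ ∑ x ∈ t, 9 * ENNReal.ofReal (ε ^ 2) * ∫⁻ x in boundaryLayer U (4 * ε), ‖g x‖ₑ ^ 2 :=
        Finset.sum_le_sum hball
    _ = _ := by
        rw [Finset.sum_const, nsmul_eq_mul]; push_cast; ring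

/-- The Poincaré inequality on a bounded open set: a shift by the diameter of a ball
containing it moves every point out. -/
lemma exists_poincare {d : ℕ} (hd : 1 ≤ d) {U : Set (Space d)} (hU : IsOpen U)
    (hb : Bornology.IsBounded U) :
    ∃ C : NNReal, ∀ (w : Space d → ℝ) (g : Space d → Space d),
      IsH10Pair U w g → AEStronglyMeasurable w (volume.restrict U) →
      AEStronglyMeasurable g (volume.restrict U) →
      ∫⁻ x in U, ‖w x‖ₑ ^ 2 ≤ C * ∫⁻ x in U, ‖g x‖ₑ ^ 2 := by
  obtain ⟨R, hR⟩ := hb.subset_ball 0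
  have : Nonempty (Fin d) := ⟨⟨0, hd⟩⟩
  obtain ⟨e, he⟩ := exists_norm_eq (Space d) (abs_nonneg (2 * R))
  refine ⟨‖e‖₊ ^ 2, fun w g hwg hw hg => ?_⟩
  have := hwg.lintegral_sq_le hw hg subset_rfl subset_rfl hU.measurableSet hU.measurableSet e
    (fun x hx hxe => ?_) (fun x hx t ht h => h)
  · simpa [enorm_eq_nnnorm] using this
  · have h1 := mem_ball_zero_iff.1 (hR hx)
    have h2 := mem_ball_zero_iff.1 (hR hxe)
    have h3 : ‖e‖ ≤ ‖x + e‖ + ‖x‖ := by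
      simpa using norm_sub_le (x + e) x
    rw [he] at h3
    linarith [le_abs_self (2 * R)]

/-! ### Smooth cutoff functions in the domain -/

section Mollification

open scoped Convolution

variable {F H G : Type*} [NormedAddCommGroup F] [NormedSpace ℝ F] [NormedAddCommGroup H]
  [NormedSpace ℝ H] [NormedAddCommGroup G] [InnerProductSpace ℝ G] [FiniteDimensional ℝ G]
  [MeasurableSpace G] [BorelSpace G] (L : ℝ →L[ℝ] F →L[ℝ] H)

/-- A convolution with a fixed kernel is bounded uniformly over all functions bounded by one. -/
lemma exists_norm_convolution_le {g : G → F} (hg : Continuous g) (hcg : HasCompactSupport g) :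
    ∃ C : ℝ, 0 ≤ C ∧ ∀ f : G → ℝ, (∀ x, ‖f x‖ ≤ 1) → ∀ x, ‖(f ⋆[L, volume] g) x‖ ≤ C := by
  refine ⟨‖L‖ * ∫ y, ‖g y‖, by positivity, fun f hf x => ?_⟩
  have hint : Integrable g := hg.integrable_of_hasCompactSupport hcg
  have h1 : Integrable fun t => ‖L‖ * ‖g (x - t)‖ :=
    (hint.norm.comp_sub_left x).const_mul _
  rw [convolution_def]
  refine (norm_integral_le_of_norm_le h1 (ae_of_all _ fun t => ?_)).trans_eq ?_
  · refine (L.le_opNorm₂ _ _).trans ?_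
    gcongr
    exact mul_le_of_le_one_right (norm_nonneg L) (hf t)
  · rw [integral_const_mul, integral_sub_left_eq_self (fun y => ‖g y‖) volume x]

lemma exists_norm_fderiv_convolution_le {g : G → F} (hg : ContDiff ℝ 1 g)
    (hcg : HasCompactSupport g) :
    ∃ C : ℝ, 0 ≤ C ∧ ∀ f : G → ℝ, LocallyIntegrable f → (∀ x, ‖f x‖ ≤ 1) →
      ∀ x, ‖fderiv ℝ (f ⋆[L, volume] g) x‖ ≤ C := by
  obtain ⟨C, hC, h⟩ := exists_norm_convolution_le (L.precompR G)
    (hg.continuous_fderiv one_ne_zero) (hcg.fderiv ℝ)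
  refine ⟨C, hC, fun f hf hf1 x => ?_⟩
  rw [(hcg.hasFDerivAt_convolution_right L hf hg x).fderiv]
  exact h f hf1 x

lemma exists_norm_fderiv_fderiv_convolution_le {g : G → F} (hg : ContDiff ℝ 2 g)
    (hcg : HasCompactSupport g) :
    ∃ C : ℝ, 0 ≤ C ∧ ∀ f : G → ℝ, LocallyIntegrable f → (∀ x, ‖f x‖ ≤ 1) →
      ∀ x, ‖fderiv ℝ (fderiv ℝ (f ⋆[L, volume] g)) x‖ ≤ C := by
  obtain ⟨C, hC, h⟩ := exists_norm_fderiv_convolution_le (L.precompR G)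
    (hg.fderiv_right (m := 1) (by norm_num)) (hcg.fderiv ℝ)
  refine ⟨C, hC, fun f hf hf1 x => ?_⟩
  have : fderiv ℝ (f ⋆[L, volume] g) = f ⋆[L.precompR G, volume] fderiv ℝ g :=
    funext fun x =>
      (hcg.hasFDerivAt_convolution_right L hf (hg.of_le (by norm_num)) x).fderiv
  rw [this]
  exact h f hf hf1 x

end Mollification

open scoped Convolution in
/-- Mollified indicators at unit scale: the bounds on the derivatives do not depend on the set. -/
lemma exists_mollified_indicator (G : Type*) [NormedAddCommGroup G] [InnerProductSpace ℝ G]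
    [FiniteDimensional ℝ G] [MeasurableSpace G] [BorelSpace G] :
    ∃ C : ℝ, 0 ≤ C ∧ ∀ K : Set G, MeasurableSet K → ∃ Φ : G → ℝ,
      ContDiff ℝ ∞ Φ ∧ (∀ x, Φ x ∈ Icc (0 : ℝ) 1) ∧ (∀ x, Metric.ball x 1 ⊆ K → Φ x = 1) ∧
      (∀ x, Disjoint (Metric.ball x 1) K → Φ x = 0) ∧
      ∀ i ≤ 2, ∀ x, ‖iteratedFDeriv ℝ i Φ x‖ ≤ C := by
  let b : ContDiffBump (0 : G) := ⟨1 / 2, 1, by norm_num, by norm_num⟩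
  set η : G → ℝ := b.normed volume with hη
  have hηs : ContDiff ℝ ∞ η := b.contDiff_normed
  have hηc : HasCompactSupport η := b.hasCompactSupport_normed
  have hηi : Integrable η := hηs.continuous.integrable_of_hasCompactSupport hηc
  let L := ContinuousLinearMap.lsmul ℝ ℝ (E := ℝ)
  obtain ⟨C₁, hC₁, hd1⟩ := exists_norm_fderiv_convolution_le L (hηs.of_le (by simp)) hηc
  obtain ⟨C₂, hC₂, hd2⟩ := exists_norm_fderiv_fderiv_convolution_le L
    (contDiff_infty.1 hηs 2) hηc
  refine ⟨1 + C₁ + C₂, by positivity, fun K hK => ?_⟩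
  set f : G → ℝ := K.indicator 1 with hf
  have hfl : LocallyIntegrable f volume :=
    (locallyIntegrable_const (1 : ℝ)).indicator hK
  have hf1 : ∀ x, ‖f x‖ ≤ 1 := by
    intro x
    by_cases hx : x ∈ K <;> simp [f, hx]
  have hval : ∀ x, (f ⋆[L, volume] η) x = ∫ t, f (x - t) * η t := fun x => by
    rw [convolution_eq_swap]; rfl
  have hη1 : ∫ t, η t = 1 := b.integral_normed
  have hη0 : ∀ t, 0 ≤ η t := fun t => b.nonneg_normed t
  have hf0 : ∀ t, 0 ≤ f t := fun t => indicator_nonneg (fun _ _ => zero_le_one) t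
  have hmem : ∀ x, (f ⋆[L, volume] η) x ∈ Icc (0 : ℝ) 1 := by
    intro x
    rw [hval]
    refine ⟨integral_nonneg fun t => mul_nonneg (hf0 _) (hη0 t), ?_⟩
    rw [← hη1]
    refine integral_mono_of_nonneg (ae_of_all _ fun t => mul_nonneg (hf0 _) (hη0 t)) hηi
      (ae_of_all _ fun t => ?_)
    exact mul_le_of_le_one_left (hη0 t) ((le_abs_self _).trans (hf1 _))
  have hsup : ∀ t, η t ≠ 0 → t ∈ Metric.ball (0 : G) 1 := by
    intro t ht
    have : t ∈ Function.support η := ht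
    rwa [hη, b.support_normed_eq] at this
  have hball : ∀ x t : G, t ∈ Metric.ball (0 : G) 1 → x - t ∈ Metric.ball x 1 := by
    intro x t ht
    rw [mem_ball_zero_iff] at ht
    rw [Metric.mem_ball, dist_eq_norm]
    simpa using ht
  refine ⟨f ⋆[L, volume] η, hηc.contDiff_convolution_right L hfl hηs, hmem, ?_, ?_, ?_⟩
  · intro x hx
    rw [hval, ← hη1]
    refine integral_congr_ae (ae_of_all _ fun t => ?_)
    by_cases ht : η t = 0
    · simp [ht]
    · have : x - t ∈ K := hx (hball x t (hsup t ht))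
      simp [f, this]
  · intro x hx
    rw [hval]
    refine integral_eq_zero_of_ae (ae_of_all _ fun t => ?_)
    by_cases ht : η t = 0
    · simp [ht]
    · have : x - t ∉ K := fun h => Set.disjoint_left.1 hx (hball x t (hsup t ht)) h
      simp [f, this]
  · intro i hi x
    interval_cases i
    · rw [norm_iteratedFDeriv_zero, Real.norm_of_nonneg (hmem x).1]
      linarith [(hmem x).2]
    · rw [norm_iteratedFDeriv_one]
      linarith [hd1 f hfl hf1 x]
    · rw [← norm_iteratedFDeriv_fderiv, norm_iteratedFDeriv_one]
      linarith [hd2 f hfl hf1 x]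

/-- Cutoff functions of `U` that differ from `1` only in the boundary layer of width `ε`, with
derivatives up to order two of size `ε⁻²`. -/
lemma exists_cutoff {d : ℕ} {U : Set (Space d)} (hb : Bornology.IsBounded U) :
    ∃ C : ℝ, 0 ≤ C ∧ ∀ ε ∈ Ioc (0 : ℝ) 1, ∃ φ : Space d → ℝ, ContDiff ℝ ∞ φ ∧
      HasCompactSupport φ ∧ tsupport φ ⊆ U ∧ (∀ x, φ x ∈ Icc (0 : ℝ) 1) ∧
      (∀ x, ε ≤ Metric.infDist x Uᶜ → φ x = 1) ∧
      (∀ i, i ≠ 0 → ∀ x, ε ≤ Metric.infDist x Uᶜ → iteratedFDeriv ℝ i φ x = 0) ∧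
      ∀ i ≤ 2, ∀ x, ‖iteratedFDeriv ℝ i φ x‖ ≤ C / ε ^ 2 := by
  obtain ⟨C, hC, hmol⟩ := exists_mollified_indicator (Space d)
  refine ⟨C * 16, by positivity, fun ε hε => ?_⟩
  -- The indicator of the points at distance at least `2 * c` from the complement, mollified at
  -- scale `c`, equals one at distance `3 * c` and vanishes at distance less than `c`.
  set c := ε / 4 with hc
  have hc0 : 0 < c := by have := hε.1; positivity
  have hε4 : ε = 4 * c := by rw [hc]; ring
  have hcont : Continuous fun y : Space d => Metric.infDist y Uᶜ := Metric.continuous_infDist_pt _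
  set K : Set (Space d) := {y | 2 * c ≤ Metric.infDist (c • y) Uᶜ} with hK
  have hKm : MeasurableSet K :=
    measurableSet_le measurable_const (hcont.comp (continuous_const_smul c)).measurable
  obtain ⟨Φ, hΦ, hΦ01, hΦ1, hΦ0, hΦd⟩ := hmol K hKm
  have hdist : ∀ x y : Space d, y ∈ Metric.ball (c⁻¹ • x) 1 → dist x (c • y) < c := by
    intro x y hy
    have : x = c • c⁻¹ • x := by rw [smul_smul, mul_inv_cancel₀ hc0.ne', one_smul]
    rw [this, dist_smul₀, Real.norm_of_nonneg hc0.le, dist_comm]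
    rw [Metric.mem_ball] at hy
    nlinarith
  have hone : ∀ x, 3 * c ≤ Metric.infDist x Uᶜ → Φ (c⁻¹ • x) = 1 := by
    intro x hx
    refine hΦ1 _ fun y hy => ?_
    have h1 := hdist x y hy
    have h2 := Metric.infDist_le_infDist_add_dist (s := Uᶜ) (x := x) (y := c • y)
    change 2 * c ≤ _
    linarith
  have hsupp : ∀ x, Φ (c⁻¹ • x) ≠ 0 → c ≤ Metric.infDist x Uᶜ := by
    intro x hx
    have : ¬ Disjoint (Metric.ball (c⁻¹ • x) 1) K := fun h => hx (hΦ0 _ h)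
    obtain ⟨y, hy, hyK⟩ := Set.not_disjoint_iff.1 this
    have h1 := hdist x y hy
    have h2 := Metric.infDist_le_infDist_add_dist (s := Uᶜ) (x := c • y) (y := x)
    rw [dist_comm] at h2
    have h3 : 2 * c ≤ Metric.infDist (c • y) Uᶜ := hyK
    linarith
  have hts : tsupport (fun x => Φ (c⁻¹ • x)) ⊆ {x | c ≤ Metric.infDist x Uᶜ} :=
    closure_minimal (fun x hx => hsupp x hx) (isClosed_le continuous_const hcont)
  have htU : {x | c ≤ Metric.infDist x Uᶜ} ⊆ U := by
    intro x hx
    by_contra h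
    have : Metric.infDist x Uᶜ = 0 := Metric.infDist_zero_of_mem h
    rw [Set.mem_ofPred_eq, this] at hx
    linarith
  have hsm : ContDiff ℝ ∞ fun x => Φ (c⁻¹ • x) := hΦ.comp (contDiff_const_smul c⁻¹)
  refine ⟨fun x => Φ (c⁻¹ • x), hsm, ?_, hts.trans htU, fun x => hΦ01 _,
    fun x hx => hone x (by linarith), ?_, ?_⟩
  · exact Metric.isCompact_of_isClosed_isBounded (isClosed_tsupport _)
      (hb.subset (hts.trans htU))
  · intro i hi x hx
    have hev : (fun x => Φ (c⁻¹ • x)) =ᶠ[𝓝 x] fun _ => (1 : ℝ) := by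
      have : ∀ᶠ y in 𝓝 x, 3 * c < Metric.infDist y Uᶜ :=
        hcont.continuousAt.eventually (lt_mem_nhds (by linarith))
      filter_upwards [this] with y hy using hone y hy.le
    rw [(Filter.EventuallyEq.iteratedFDeriv ℝ hev i).eq_of_nhds, iteratedFDeriv_const_of_ne hi]
    rfl
  · intro i hi x
    have hci : ContDiff ℝ i Φ := hΦ.of_le (by exact_mod_cast le_top)
    rw [iteratedFDeriv_comp_const_smul c⁻¹ hci, norm_smul, norm_pow,
      Real.norm_of_nonneg (by positivity)]
    have h1 : c⁻¹ ^ i ≤ c⁻¹ ^ 2 :=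
      pow_le_pow_right₀ ((one_le_inv₀ hc0).2 (by linarith [hε.2])) hi
    calc c⁻¹ ^ i * _ ≤ c⁻¹ ^ 2 * C := by gcongr; exact hΦd i hi _
      _ = C * 16 / ε ^ 2 := by rw [hε4]; field_simp; ring

/-! ### Truncated regularizations of signed powers -/

/-- A smooth bump on the line, equal to `1` on `[-1, 1]` and supported in `[-2, 2]`. -/
noncomputable def lineBump : ContDiffBump (0 : ℝ) := ⟨1, 2, by norm_num, by norm_num⟩

/-- The regularized power `ξ (ξ² + η²)^{(δ-1)/2}`, a smooth substitute for `ξ^{[δ]}`. -/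
noncomputable def regPow (δ η ξ : ℝ) : ℝ := ξ * (ξ ^ 2 + η ^ 2) ^ ((δ - 1) / 2)

/-- The velocity profile of the test functions: the regularized power, cut off at `|ξ| ∼ R`. -/
noncomputable def profile (δ η R ξ : ℝ) : ℝ := lineBump (ξ / R) * regPow δ η ξ

lemma contDiff_regPow (δ : ℝ) {η : ℝ} (hη : 0 < η) : ContDiff ℝ ∞ (regPow δ η) := by
  unfold regPow
  refine contDiff_id.mul (ContDiff.rpow_const_of_ne (by fun_prop) fun x => ?_)
  positivity

lemma contDiff_profile (δ : ℝ) {η : ℝ} (hη : 0 < η) (R : ℝ) : ContDiff ℝ ∞ (profile δ η R) := by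
  unfold profile
  exact (lineBump.contDiff.comp (contDiff_id.div_const R)).mul (contDiff_regPow δ hη)

lemma hasCompactSupport_profile (δ η : ℝ) {R : ℝ} (hR : 0 < R) :
    HasCompactSupport (profile δ η R) := by
  refine HasCompactSupport.of_support_subset_isCompact (isCompact_Icc (a := -(2 * R)) (b := 2 * R))
    fun ξ hξ => ?_
  have h1 : lineBump (ξ / R) ≠ 0 := left_ne_zero_of_mul hξ
  have h2 : ξ / R ∈ Metric.ball (0 : ℝ) 2 := by
    have : ξ / R ∈ Function.support lineBump := h1
    rwa [lineBump.support_eq] at this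
  rw [mem_ball_zero_iff, Real.norm_eq_abs, abs_div, abs_of_pos hR, div_lt_iff₀ hR] at h2
  exact abs_le.1 h2.le

lemma hasDerivAt_regPow (δ : ℝ) {η : ℝ} (hη : 0 < η) (ξ : ℝ) :
    HasDerivAt (regPow δ η) ((ξ ^ 2 + η ^ 2) ^ ((δ - 1) / 2) *
      (1 + (δ - 1) * (ξ ^ 2 / (ξ ^ 2 + η ^ 2)))) ξ := by
  have hQ : 0 < ξ ^ 2 + η ^ 2 := by positivity
  have h1 : HasDerivAt (fun ξ : ℝ => ξ ^ 2 + η ^ 2) (2 * ξ) ξ := by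
    simpa using (hasDerivAt_pow 2 ξ).add_const (η ^ 2)
  have h2 := (hasDerivAt_id ξ).mul (h1.rpow_const (p := (δ - 1) / 2) (Or.inl hQ.ne'))
  refine h2.congr_deriv ?_
  rw [Real.rpow_sub_one hQ.ne']
  simp only [id]
  field_simp

lemma hasDerivAt_deriv_regPow (δ : ℝ) {η : ℝ} (hη : 0 < η) (ξ : ℝ) :
    HasDerivAt (deriv (regPow δ η)) ((ξ ^ 2 + η ^ 2) ^ ((δ - 1) / 2) *
      ((δ - 1) * (ξ / (ξ ^ 2 + η ^ 2)) * (3 + (δ - 3) * (ξ ^ 2 / (ξ ^ 2 + η ^ 2))))) ξ := by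
  have hQ : 0 < ξ ^ 2 + η ^ 2 := by positivity
  have h1 : HasDerivAt (fun ξ : ℝ => ξ ^ 2 + η ^ 2) (2 * ξ) ξ := by
    simpa using (hasDerivAt_pow 2 ξ).add_const (η ^ 2)
  have h0 : deriv (regPow δ η) = fun ξ => (ξ ^ 2 + η ^ 2) ^ ((δ - 1) / 2) *
      (1 + (δ - 1) * (ξ ^ 2 / (ξ ^ 2 + η ^ 2))) :=
    funext fun ξ => (hasDerivAt_regPow δ hη ξ).deriv
  rw [h0]
  have h2 : HasDerivAt (fun ξ : ℝ => ξ ^ 2) (2 * ξ) ξ := by simpa using hasDerivAt_pow 2 ξ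
  have h3 := (h1.rpow_const (p := (δ - 1) / 2) (Or.inl hQ.ne')).mul
    (((h2.div h1 hQ.ne').const_mul (δ - 1)).const_add 1)
  refine h3.congr_deriv ?_
  rw [Real.rpow_sub_one hQ.ne', Pi.div_apply]
  field_simp
  ring

lemma abs_regPow (δ η ξ : ℝ) :
    |regPow δ η ξ| = |ξ| * (ξ ^ 2 + η ^ 2) ^ ((δ - 1) / 2) := by
  rw [regPow, abs_mul, abs_of_nonneg (Real.rpow_nonneg (by positivity) _)]

lemma abs_regPow_le_rpow {δ : ℝ} (hδ : δ ∈ Ioc (0 : ℝ) 1) (η ξ : ℝ) :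
    |regPow δ η ξ| ≤ |ξ| ^ δ := by
  rw [abs_regPow]
  rcases eq_or_ne ξ 0 with rfl | hξ
  · simp [Real.rpow_nonneg]
  have hξ0 : 0 < |ξ| := abs_pos.2 hξ
  calc |ξ| * (ξ ^ 2 + η ^ 2) ^ ((δ - 1) / 2) ≤ |ξ| * (|ξ| ^ 2) ^ ((δ - 1) / 2) := by
        refine mul_le_mul_of_nonneg_left (Real.rpow_le_rpow_of_nonpos (by positivity) ?_
          (by linarith [hδ.2])) hξ0.le
        rw [sq_abs]; nlinarith [sq_nonneg η]
    _ = |ξ| ^ δ := by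
        rw [← Real.rpow_natCast, ← Real.rpow_mul hξ0.le]
        nth_rewrite 1 [← Real.rpow_one |ξ|]
        rw [← Real.rpow_add hξ0]
        congr 1; push_cast; ring

/-- The bound that is linear in `ξ`, at the price of a negative power of `η`. -/
lemma abs_regPow_le_mul {δ : ℝ} (hδ : δ ∈ Ioc (0 : ℝ) 1) {η : ℝ} (hη : 0 < η) (ξ : ℝ) :
    |regPow δ η ξ| ≤ η ^ (δ - 1) * |ξ| := by
  rw [abs_regPow, mul_comm]
  gcongr
  calc (ξ ^ 2 + η ^ 2) ^ ((δ - 1) / 2) ≤ (η ^ 2) ^ ((δ - 1) / 2) := by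
        refine Real.rpow_le_rpow_of_nonpos (by positivity) ?_ (by linarith [hδ.2])
        nlinarith [sq_nonneg ξ]
    _ = η ^ (δ - 1) := by
        rw [← Real.rpow_natCast, ← Real.rpow_mul hη.le]
        congr 1; push_cast; ring

lemma exists_bound_lineBump : ∃ K : ℝ, 1 ≤ K ∧ ∀ x, |lineBump x| ≤ K ∧
    |x * deriv lineBump x| ≤ K ∧ |x ^ 2 * deriv (deriv lineBump) x| ≤ K := by
  have h0 : ContDiff ℝ ∞ lineBump := lineBump.contDiff
  have h1 : ContDiff ℝ ∞ (deriv lineBump) := (contDiff_infty_iff_deriv.1 h0).2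
  have h2 : ContDiff ℝ ∞ (deriv (deriv lineBump)) := (contDiff_infty_iff_deriv.1 h1).2
  have c0 : HasCompactSupport lineBump := lineBump.hasCompactSupport
  obtain ⟨K₁, hK₁⟩ := (c0.deriv.mul_left (f := fun x : ℝ => x)).exists_bound_of_continuous
    (continuous_id.mul h1.continuous)
  obtain ⟨K₂, hK₂⟩ := (c0.deriv.deriv.mul_left (f := fun x : ℝ => x ^ 2)).exists_bound_of_continuous
    ((continuous_pow 2).mul h2.continuous)
  refine ⟨max 1 (max K₁ K₂), le_max_left _ _, fun x => ⟨?_, ?_, ?_⟩⟩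
  · rw [abs_of_nonneg lineBump.nonneg]
    exact lineBump.le_one.trans (le_max_left _ _)
  · exact (hK₁ x).trans ((le_max_left _ _).trans (le_max_right _ _))
  · exact (hK₂ x).trans ((le_max_right _ _).trans (le_max_right _ _))

lemma hasDerivAt_lineBump_div (R ξ : ℝ) :
    HasDerivAt (fun ξ => lineBump (ξ / R)) (deriv lineBump (ξ / R) / R) ξ := by
  have h0 : ContDiff ℝ ∞ lineBump := lineBump.contDiff
  have := ((h0.differentiable (by simp)) (ξ / R)).hasDerivAt.comp ξ ((hasDerivAt_id ξ).div_const R)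
  exact this.congr_deriv (by simp [div_eq_mul_inv])

lemma hasDerivAt_deriv_lineBump_div (R ξ : ℝ) :
    HasDerivAt (fun ξ => deriv lineBump (ξ / R) / R)
      (deriv (deriv lineBump) (ξ / R) / R ^ 2) ξ := by
  have h0 : ContDiff ℝ ∞ lineBump := lineBump.contDiff
  have h1 : ContDiff ℝ ∞ (deriv lineBump) := (contDiff_infty_iff_deriv.1 h0).2
  have := (((h1.differentiable (by simp)) (ξ / R)).hasDerivAt.comp ξ
    ((hasDerivAt_id ξ).div_const R)).div_const R
  refine this.congr_deriv ?_
  rw [pow_two]; simp [div_eq_mul_inv]; ring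

/-- Scale-invariant bounds on the profile, uniform in both regularization parameters. The last one
is the coercivity of its derivative, up to an error at `R ≤ |ξ|`. -/
lemma exists_bound_profile : ∃ K : ℝ, 1 ≤ K ∧ ∀ δ ∈ Ioc (0 : ℝ) 1, ∀ η > 0, ∀ R ≥ 1, ∀ ξ : ℝ,
    |profile δ η R ξ| ≤ K * |regPow δ η ξ| ∧
    |ξ * deriv (profile δ η R) ξ| ≤ K * |regPow δ η ξ| ∧
    |ξ ^ 2 * deriv (deriv (profile δ η R)) ξ| ≤ K * |regPow δ η ξ| ∧
    δ * (lineBump (ξ / R) * (ξ ^ 2 + η ^ 2) ^ ((δ - 1) / 2)) -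
      {ξ : ℝ | R ≤ |ξ|}.indicator (fun _ => K) ξ ≤ deriv (profile δ η R) ξ := by
  obtain ⟨K, hK1, hK⟩ := exists_bound_lineBump
  have hK0 : 0 ≤ K := by linarith
  refine ⟨11 * K, by linarith, fun δ hδ η hη R hR ξ => ?_⟩
  have hR0 : 0 < R := by linarith
  have hQ : 0 < ξ ^ 2 + η ^ 2 := by positivity
  have hd1 : ∀ ξ, HasDerivAt (profile δ η R) (deriv lineBump (ξ / R) / R * regPow δ η ξ +
      lineBump (ξ / R) * deriv (regPow δ η) ξ) ξ := fun ξ => by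
    have := (hasDerivAt_lineBump_div R ξ).mul (hasDerivAt_regPow δ hη ξ)
    rwa [← (hasDerivAt_regPow δ hη ξ).deriv] at this
  have hd1' : deriv (profile δ η R) = fun ξ => deriv lineBump (ξ / R) / R * regPow δ η ξ +
      lineBump (ξ / R) * deriv (regPow δ η) ξ := funext fun ξ => (hd1 ξ).deriv
  have hd2 := ((hasDerivAt_deriv_lineBump_div R ξ).mul (hasDerivAt_regPow δ hη ξ)).add
    ((hasDerivAt_lineBump_div R ξ).mul (hasDerivAt_deriv_regPow δ hη ξ))
  have hd2' := (hd2.congr_of_eventuallyEq (f₁ := deriv (profile δ η R))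
    (Eventually.of_forall fun x => by rw [hd1']; rfl)).deriv
  rw [hd2', (hd1 ξ).deriv, (hasDerivAt_regPow δ hη ξ).deriv]
  obtain ⟨k0, k1, k2⟩ := hK (ξ / R)
  set X := (ξ ^ 2 + η ^ 2) ^ ((δ - 1) / 2) with hX
  have hX0 : 0 ≤ X := Real.rpow_nonneg hQ.le _
  set θ := ξ ^ 2 / (ξ ^ 2 + η ^ 2) with hθ
  have hθ0 : 0 ≤ θ := by positivity
  have hθ1 : θ ≤ 1 := (div_le_one hQ).2 (by nlinarith [sq_nonneg η])
  have hP0 : 0 ≤ |regPow δ η ξ| := abs_nonneg _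
  have hPX : |regPow δ η ξ| = |ξ| * X := abs_regPow δ η ξ
  obtain ⟨hδ0, hδ1⟩ := hδ
  have q1 : |ξ * (X * (1 + (δ - 1) * θ))| ≤ 1 * |regPow δ η ξ| := by
    rw [hPX, abs_mul, abs_mul, abs_of_nonneg hX0]
    have : |1 + (δ - 1) * θ| ≤ 1 := abs_le.2 ⟨by nlinarith, by nlinarith⟩
    nlinarith [mul_nonneg (abs_nonneg ξ) hX0]
  have q2 : |ξ ^ 2 * (X * ((δ - 1) * (ξ / (ξ ^ 2 + η ^ 2)) * (3 + (δ - 3) * θ)))| ≤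
      6 * |regPow δ η ξ| := by
    have e : ξ ^ 2 * (X * ((δ - 1) * (ξ / (ξ ^ 2 + η ^ 2)) * (3 + (δ - 3) * θ))) =
        ξ * X * (θ * ((δ - 1) * (3 + (δ - 3) * θ))) := by rw [hθ]; ring
    rw [e, hPX, abs_mul, abs_mul ξ X, abs_of_nonneg hX0]
    have h1 : |3 + (δ - 3) * θ| ≤ 6 := abs_le.2 ⟨by nlinarith, by nlinarith⟩
    have h2 : |δ - 1| ≤ 1 := abs_le.2 ⟨by linarith, by linarith⟩
    have : |θ * ((δ - 1) * (3 + (δ - 3) * θ))| ≤ 6 := by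
      rw [abs_mul, abs_mul, abs_of_nonneg hθ0]
      calc θ * (|δ - 1| * |3 + (δ - 3) * θ|) ≤ 1 * (1 * 6) := by gcongr
        _ = 6 := by norm_num
    rw [mul_comm]
    gcongr
  refine ⟨?_, ?_, ?_, ?_⟩
  · rw [profile, abs_mul]
    gcongr
    linarith
  · have e : ξ * (deriv lineBump (ξ / R) / R * regPow δ η ξ +
        lineBump (ξ / R) * (X * (1 + (δ - 1) * θ))) =
        (ξ / R * deriv lineBump (ξ / R)) * regPow δ η ξ +
          lineBump (ξ / R) * (ξ * (X * (1 + (δ - 1) * θ))) := by ring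
    rw [e]
    refine (abs_add_le _ _).trans ?_
    rw [abs_mul, abs_mul (lineBump (ξ / R))]
    calc _ ≤ K * |regPow δ η ξ| + K * (1 * |regPow δ η ξ|) := by gcongr
      _ ≤ _ := by linarith [mul_nonneg hK0 hP0]
  · set Y := X * ((δ - 1) * (ξ / (ξ ^ 2 + η ^ 2)) * (3 + (δ - 3) * θ)) with hY
    set Z := X * (1 + (δ - 1) * θ) with hZ
    have e : ξ ^ 2 * (deriv (deriv lineBump) (ξ / R) / R ^ 2 * regPow δ η ξ +
        deriv lineBump (ξ / R) / R * Z + (deriv lineBump (ξ / R) / R * Z + lineBump (ξ / R) * Y)) =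
        ((ξ / R) ^ 2 * deriv (deriv lineBump) (ξ / R)) * regPow δ η ξ +
          2 * ((ξ / R * deriv lineBump (ξ / R)) * (ξ * Z)) + lineBump (ξ / R) * (ξ ^ 2 * Y) := by
      ring
    rw [e]
    refine (abs_add_three _ _ _).trans ?_
    rw [abs_mul, abs_mul 2, abs_mul _ (ξ * Z), abs_mul (lineBump (ξ / R)), abs_two]
    calc _ ≤ K * |regPow δ η ξ| + 2 * (K * (1 * |regPow δ η ξ|)) + K * (6 * |regPow δ η ξ|) := by
          gcongr
      _ ≤ _ := by linarith [mul_nonneg hK0 hP0]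
  · have hb0 : 0 ≤ lineBump (ξ / R) := lineBump.nonneg
    have hmain : δ * (lineBump (ξ / R) * X) ≤ lineBump (ξ / R) * (X * (1 + (δ - 1) * θ)) := by
      have : δ ≤ 1 + (δ - 1) * θ := by nlinarith
      calc δ * (lineBump (ξ / R) * X) = lineBump (ξ / R) * (X * δ) := by ring
        _ ≤ _ := by gcongr
    have htail : -({ξ : ℝ | R ≤ |ξ|}.indicator (fun _ => 11 * K) ξ) ≤
        deriv lineBump (ξ / R) / R * regPow δ η ξ := by
      by_cases hξ : R ≤ |ξ|
      · rw [indicator_of_mem (show ξ ∈ {ξ : ℝ | R ≤ |ξ|} from hξ)]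
        have hX1 : X ≤ 1 := by
          refine Real.rpow_le_one_of_one_le_of_nonpos ?_ (by linarith)
          have : 1 ≤ |ξ| ^ 2 := one_le_pow₀ (hR.le.trans hξ)
          rw [sq_abs] at this
          linarith [sq_nonneg η]
        have e : deriv lineBump (ξ / R) / R * regPow δ η ξ =
            (ξ / R * deriv lineBump (ξ / R)) * X := by rw [regPow]; ring
        rw [e]
        have : |(ξ / R * deriv lineBump (ξ / R)) * X| ≤ K * 1 := by
          rw [abs_mul, abs_of_nonneg hX0]; gcongr
        linarith [(abs_le.1 this).1]
      · rw [indicator_of_notMem (show ξ ∉ {ξ : ℝ | R ≤ |ξ|} from hξ)]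
        have hlt : |ξ / R| < 1 := by
          rw [abs_div, abs_of_pos hR0, div_lt_one hR0]; exact not_le.1 hξ
        have hev : (lineBump : ℝ → ℝ) =ᶠ[𝓝 (ξ / R)] fun _ => 1 := by
          have := lineBump.eventuallyEq_one_of_mem_ball (x := ξ / R)
            (by rw [mem_ball_zero_iff]; exact hlt)
          exact this
        rw [hev.deriv_eq]
        simp
    linarith

/-! ### Transported test functions -/

/-- The exponent of the characteristics, so that `v_{s,t} = exp (-charExponent)`. -/
noncomputable def charExponent {d n : ℕ} (f : Fin n → Space d → ℝ) (z : ℝ → Fin n → ℝ) (s t : ℝ)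
    (x : Space d) : ℝ := ∑ k, f k x * (z t k - z s k)

/-- The tensor product test function `φ(x) ψ(ξ)` with `ψ` the regularized profile. -/
noncomputable def tensorTest {d : ℕ} (φ : Space d → ℝ) (δ η R : ℝ) (y : Space d × ℝ) : ℝ :=
  φ y.1 * profile δ η R y.2

/-- The velocity part of a transported test function as a function of the characteristic
exponent. -/
noncomputable def expProfile (δ η R ξ a : ℝ) : ℝ :=
  profile δ η R (ξ * Real.exp (-a)) * Real.exp (-a)

lemma backwardChar_eq {d n : ℕ} (f : Fin n → Space d → ℝ) (z : ℝ → Fin n → ℝ) (s t : ℝ)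
    (x : Space d) (ξ : ℝ) :
    backwardChar f z s t x ξ = ξ * Real.exp (-charExponent f z s t x) := by
  rw [backwardChar, charExponent, ← Finset.sum_neg_distrib]
  congr 3
  ext k; ring

lemma transported_tensorTest {d n : ℕ} (f : Fin n → Space d → ℝ) (z : ℝ → Fin n → ℝ)
    (φ : Space d → ℝ) (δ η R s t : ℝ) (x : Space d) (ξ : ℝ) :
    transported f z (tensorTest φ δ η R) s t x ξ =
      φ x * expProfile δ η R ξ (charExponent f z s t x) := by
  rw [transported, tensorTest, backwardChar_eq, weight, expProfile, mul_assoc]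
  rfl

lemma contDiff_tensorTest {d : ℕ} {φ : Space d → ℝ} (hφ : ContDiff ℝ ∞ φ) (δ : ℝ) {η : ℝ}
    (hη : 0 < η) (R : ℝ) : ContDiff ℝ ∞ (tensorTest φ δ η R) :=
  (hφ.comp contDiff_fst).mul ((contDiff_profile δ hη R).comp contDiff_snd)

lemma tsupport_tensorTest_subset {d : ℕ} (φ : Space d → ℝ) (δ η R : ℝ) :
    tsupport (tensorTest φ δ η R) ⊆ tsupport φ ×ˢ tsupport (profile δ η R) := by
  refine closure_minimal (fun y hy => ?_) ((isClosed_tsupport _).prod (isClosed_tsupport _))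
  exact ⟨subset_tsupport _ (left_ne_zero_of_mul hy), subset_tsupport _ (right_ne_zero_of_mul hy)⟩

lemma hasCompactSupport_tensorTest {d : ℕ} {φ : Space d → ℝ} (hφ : HasCompactSupport φ)
    (δ η : ℝ) {R : ℝ} (hR : 0 < R) : HasCompactSupport (tensorTest φ δ η R) :=
  (hφ.isCompact.prod (hasCompactSupport_profile δ η hR)).of_isClosed_subset (isClosed_tsupport _)
    (tsupport_tensorTest_subset φ δ η R)

lemma contDiff_expProfile (δ : ℝ) {η : ℝ} (hη : 0 < η) (R ξ : ℝ) :
    ContDiff ℝ ∞ (expProfile δ η R ξ) := by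
  unfold expProfile
  exact ((contDiff_profile δ hη R).comp
    (contDiff_const.mul (Real.contDiff_exp.comp contDiff_neg))).mul
      (Real.contDiff_exp.comp contDiff_neg)

/-- The derivatives of a transported profile in the characteristic exponent only involve the
scale-invariant quantities `ψ`, `ξψ'` and `ξ²ψ''`. -/
lemma exists_bound_expProfile (A : ℝ) :
    ∃ K : ℝ, 0 ≤ K ∧ ∀ δ ∈ Ioc (0 : ℝ) 1, ∀ η > 0, ∀ R ≥ 1, ∀ ξ a : ℝ, |a| ≤ A → ∀ i ≤ 2,
      ‖iteratedFDeriv ℝ i (expProfile δ η R ξ) a‖ ≤ K * |ξ| ^ δ ∧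
      ‖iteratedFDeriv ℝ i (expProfile δ η R ξ) a‖ ≤ K * (η ^ (δ - 1) * |ξ|) := by
  obtain ⟨K, hK1, hK⟩ := exists_bound_profile
  have hK0 : 0 ≤ K := by linarith
  refine ⟨5 * K * Real.exp (2 * A), by positivity, fun δ hδ η hη R hR ξ a ha i hi => ?_⟩
  set ψ := profile δ η R with hψ
  have hs0 : ContDiff ℝ ∞ ψ := contDiff_profile δ hη R
  have hs1 : ContDiff ℝ ∞ (deriv ψ) := (contDiff_infty_iff_deriv.1 hs0).2
  have he : ∀ a : ℝ, HasDerivAt (fun a => Real.exp (-a)) (-Real.exp (-a)) a := fun a => by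
    simpa using (hasDerivAt_neg a).exp
  have hζ : ∀ a : ℝ, HasDerivAt (fun a => ξ * Real.exp (-a)) (-(ξ * Real.exp (-a))) a := fun a =>
    ((he a).const_mul ξ).congr_deriv (by ring)
  have hc0 : ∀ a : ℝ, HasDerivAt (fun a => ψ (ξ * Real.exp (-a)))
      (deriv ψ (ξ * Real.exp (-a)) * -(ξ * Real.exp (-a))) a := fun a =>
    ((hs0.differentiable (by simp)) _).hasDerivAt.comp a (hζ a)
  have hc1 : ∀ a : ℝ, HasDerivAt (fun a => deriv ψ (ξ * Real.exp (-a)))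
      (deriv (deriv ψ) (ξ * Real.exp (-a)) * -(ξ * Real.exp (-a))) a := fun a =>
    ((hs1.differentiable (by simp)) _).hasDerivAt.comp a (hζ a)
  have d1 : deriv (expProfile δ η R ξ) = fun a =>
      -((ξ * Real.exp (-a)) * deriv ψ (ξ * Real.exp (-a)) + ψ (ξ * Real.exp (-a))) *
        Real.exp (-a) := by
    funext a
    exact (((hc0 a).mul (he a)).congr_deriv (by ring)).deriv
  have d2 : deriv (deriv (expProfile δ η R ξ)) a =
      ((ξ * Real.exp (-a)) ^ 2 * deriv (deriv ψ) (ξ * Real.exp (-a)) +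
        3 * ((ξ * Real.exp (-a)) * deriv ψ (ξ * Real.exp (-a))) + ψ (ξ * Real.exp (-a))) *
        Real.exp (-a) := by
    rw [d1]
    exact (((((hζ a).mul (hc1 a)).add (hc0 a)).neg.mul (he a)).congr_deriv (by
      simp only [Pi.neg_apply, Pi.add_apply, Pi.mul_apply]; ring)).deriv
  set ζ := ξ * Real.exp (-a) with hζd
  obtain ⟨k0, k1, k2, -⟩ := hK δ hδ η hη R hR ζ
  have hP := abs_nonneg (regPow δ η ζ)
  have hKP := mul_nonneg hK0 hP
  have hexp : Real.exp (-a) ≤ Real.exp A := Real.exp_le_exp.2 (by linarith [(abs_le.1 ha).1])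
  have hA : 0 ≤ A := (abs_nonneg a).trans ha
  have hexp1 : 1 ≤ Real.exp A := Real.one_le_exp hA
  have main : ‖iteratedFDeriv ℝ i (expProfile δ η R ξ) a‖ ≤
      5 * (K * |regPow δ η ζ|) * Real.exp A := by
    rw [norm_iteratedFDeriv_eq_norm_iteratedDeriv, Real.norm_eq_abs]
    interval_cases i
    · rw [iteratedDeriv_zero, expProfile, abs_mul, Real.abs_exp]
      gcongr
      linarith
    · rw [iteratedDeriv_one, d1, abs_mul, Real.abs_exp, abs_neg]
      gcongr
      exact (abs_add_le _ _).trans (by linarith)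
    · rw [iteratedDeriv_succ, iteratedDeriv_one, d2, abs_mul, Real.abs_exp]
      gcongr
      refine (abs_add_three _ _ _).trans ?_
      rw [abs_mul 3, Nat.abs_ofNat]
      linarith
  have hζabs : |ζ| ≤ Real.exp A * |ξ| := by
    rw [hζd, abs_mul, Real.abs_exp, mul_comm]
    gcongr
  have hexp2 : Real.exp (2 * A) = Real.exp A * Real.exp A := by rw [two_mul, Real.exp_add]
  have b1 : |regPow δ η ζ| ≤ Real.exp A * |ξ| ^ δ := by
    calc |regPow δ η ζ| ≤ |ζ| ^ δ := abs_regPow_le_rpow hδ η ζ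
      _ ≤ (Real.exp A * |ξ|) ^ δ := Real.rpow_le_rpow (abs_nonneg _) hζabs hδ.1.le
      _ = Real.exp A ^ δ * |ξ| ^ δ := Real.mul_rpow (by positivity) (abs_nonneg _)
      _ ≤ Real.exp A * |ξ| ^ δ := by
        gcongr
        calc Real.exp A ^ δ ≤ Real.exp A ^ (1 : ℝ) :=
              Real.rpow_le_rpow_of_exponent_le hexp1 hδ.2
          _ = _ := Real.rpow_one _
  have b2 : |regPow δ η ζ| ≤ Real.exp A * (η ^ (δ - 1) * |ξ|) := by
    calc |regPow δ η ζ| ≤ η ^ (δ - 1) * |ζ| := abs_regPow_le_mul hδ hη ζ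
      _ ≤ η ^ (δ - 1) * (Real.exp A * |ξ|) := by gcongr
      _ = _ := by ring
  constructor
  · refine main.trans ?_
    calc _ ≤ 5 * (K * (Real.exp A * |ξ| ^ δ)) * Real.exp A := by gcongr
      _ = _ := by rw [hexp2]; ring
  · refine main.trans ?_
    calc _ ≤ 5 * (K * (Real.exp A * (η ^ (δ - 1) * |ξ|))) * Real.exp A := by gcongr
      _ = _ := by rw [hexp2]; ring

lemma contDiffOn_charExponent {d n : ℕ} {U : Set (Space d)} {f : Fin n → Space d → ℝ}
    (hf : ∀ k, IsCb2 U (f k)) (z : ℝ → Fin n → ℝ) (s t : ℝ) :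
    ContDiffOn ℝ 2 (charExponent f z s t) U := by
  unfold charExponent
  exact ContDiffOn.sum fun k _ => (hf k).1.mul contDiffOn_const

/-- The characteristic exponent and its derivatives are controlled by the oscillation of `z`. -/
lemma exists_bound_charExponent {d n : ℕ} {U : Set (Space d)} (hU : IsOpen U)
    {f : Fin n → Space d → ℝ} (hf : ∀ k, IsCb2 U (f k)) :
    ∃ Λ : ℝ, 0 ≤ Λ ∧ ∀ (z : ℝ → Fin n → ℝ) (s t τ : ℝ), (∀ k, |z t k - z s k| ≤ τ) →
      ∀ x ∈ U, ∀ i ≤ 2, ‖iteratedFDeriv ℝ i (charExponent f z s t) x‖ ≤ Λ * τ := by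
  choose! C hC using fun k => (hf k).2
  refine ⟨∑ k, ∑ i ∈ Finset.range 3, |C k i|, by positivity, fun z s t τ hτ x hx i hi => ?_⟩
  have hcd : ∀ k, ContDiffAt ℝ i (f k) x := fun k =>
    (((hf k).1.contDiffAt (hU.mem_nhds hx)).of_le (by exact_mod_cast hi))
  have h1 : charExponent f z s t = fun x => ∑ k, (z t k - z s k) • f k x := by
    funext x; simp [charExponent, mul_comm]
  rw [h1, iteratedFDeriv_fun_sum_apply fun k _ => (hcd k).const_smul _]
  refine (norm_sum_le _ _).trans ?_
  rw [Finset.sum_mul]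
  refine Finset.sum_le_sum fun k _ => ?_
  rw [iteratedFDeriv_const_smul_apply' (hcd k), norm_smul, mul_comm, Real.norm_eq_abs]
  have h2 : ‖iteratedFDeriv ℝ i (f k) x‖ ≤ ∑ i ∈ Finset.range 3, |C k i| :=
    (hC k i hi x hx).trans ((le_abs_self _).trans
      (Finset.single_le_sum (f := fun i => |C k i|) (fun _ _ => abs_nonneg _)
        (Finset.mem_range.2 (by omega))))
  gcongr
  exact hτ k

lemma abs_laplacian_le {d : ℕ} (F : Space d → ℝ) (x : Space d) :
    |Laplacian.laplacian F x| ≤ d * ‖iteratedFDeriv ℝ 2 F x‖ := by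
  rw [InnerProductSpace.laplacian_eq_iteratedFDeriv_orthonormalBasis F
    (EuclideanSpace.basisFun (Fin d) ℝ)]
  refine (Finset.abs_sum_le_sum_abs _ _).trans ?_
  refine (Finset.sum_le_sum (g := fun _ => ‖iteratedFDeriv ℝ 2 F x‖) fun i _ => ?_).trans ?_
  · refine ((iteratedFDeriv ℝ 2 F x).le_opNorm _).trans ?_
    simp
  · simp

/-- The Laplacian of a transported test function: where the cutoff is constant it is of the order
of the oscillation of `z`, and elsewhere it vanishes linearly at `ξ = 0`. In the derivatives of the
composition of the profile with the exponent `g`, each derivative of `g` is at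
most a multiple of `τ`. -/
lemma exists_bound_laplacian_transported {d n : ℕ} {U : Set (Space d)} (hU : IsOpen U)
    {f : Fin n → Space d → ℝ} (hf : ∀ k, IsCb2 U (f k)) {W : ℝ} (hW : 0 ≤ W) :
    ∃ B : ℝ, 0 ≤ B ∧ ∀ δ ∈ Ioc (0 : ℝ) 1, ∀ η > 0, ∀ R ≥ 1, ∀ φ : Space d → ℝ, ContDiff ℝ ∞ φ →
      ∀ (z : ℝ → Fin n → ℝ) (s t τ : ℝ), τ ≤ W → (∀ k, |z t k - z s k| ≤ τ) → 0 ≤ τ →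
      ∀ x ∈ U, |φ x| ≤ 1 → ∀ ξ : ℝ,
        |Laplacian.laplacian (fun x => transported f z (tensorTest φ δ η R) s t x ξ) x| ≤
          B * (τ * |ξ| ^ δ) + B * ((‖iteratedFDeriv ℝ 1 φ x‖ + ‖iteratedFDeriv ℝ 2 φ x‖) *
            (η ^ (δ - 1) * |ξ|)) := by
  obtain ⟨Λ, hΛ, hg⟩ := exists_bound_charExponent hU hf
  obtain ⟨K, hK, hH⟩ := exists_bound_expProfile (Λ * W)
  set M := Λ * (1 + Λ * W) with hM
  have hM0 : 0 ≤ M := by positivity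
  refine ⟨d * (2 * K * M) + d * (2 * (K * √(M * W)) + K), by positivity,
    fun δ hδ η hη R hR φ hφ z s t τ hτW hτ hτ0 x hx hφx ξ => ?_⟩
  set g := charExponent f z s t with hgd
  set H := expProfile δ η R ξ with hHd
  have hgs : ContDiffOn ℝ 2 g U := contDiffOn_charExponent hf z s t
  have hHs : ContDiff ℝ 2 H := contDiff_infty.1 (contDiff_expProfile δ hη R ξ) 2
  have hφs : ContDiff ℝ 2 φ := contDiff_infty.1 hφ 2
  have hUd : UniqueDiffOn ℝ U := hU.uniqueDiffOn
  have hfun : (fun x => transported f z (tensorTest φ δ η R) s t x ξ) =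
      fun x => φ x * (H ∘ g) x := funext fun x => transported_tensorTest f z φ δ η R s t x ξ
  have hcomp : ContDiffOn ℝ 2 (H ∘ g) U := hHs.comp_contDiffOn hgs
  have hga : |g x| ≤ Λ * W := by
    have := hg z s t τ hτ x hx 0 (by norm_num)
    rw [norm_iteratedFDeriv_zero] at this
    exact this.trans (by gcongr)
  -- The scale of the derivatives of the exponent: `D ^ 2` is of order `τ`.
  set D := √(M * τ) with hD
  have hD2 : D ^ 2 = M * τ := Real.sq_sqrt (by positivity)
  have hΛτ : Λ * τ ≤ M * τ := by
    gcongr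
    rw [hM]; nlinarith [mul_nonneg hΛ (mul_nonneg hΛ hW)]
  have hgD : ∀ i, 1 ≤ i → i ≤ 2 → ‖iteratedFDerivWithin ℝ i g U x‖ ≤ D ^ i := by
    intro i h1 h2
    rw [iteratedFDerivWithin_of_isOpen i hU hx]
    have hb := hg z s t τ hτ x hx i h2
    interval_cases i
    · rw [pow_one]
      refine hb.trans (Real.le_sqrt_of_sq_le ?_)
      calc (Λ * τ) ^ 2 = Λ * (Λ * τ) * τ := by ring
        _ ≤ Λ * (1 + Λ * W) * τ := by
          gcongr
          nlinarith [mul_le_mul_of_nonneg_left hτW hΛ]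
    · rw [hD2]; exact hb.trans hΛτ
  have hcb : ∀ C : ℝ, (∀ i ≤ 2, ‖iteratedFDeriv ℝ i H (g x)‖ ≤ C) → ∀ j ≤ 2,
      ‖iteratedFDeriv ℝ j (H ∘ g) x‖ ≤ j.factorial * C * D ^ j := by
    intro C hC j hj
    rw [← iteratedFDerivWithin_of_isOpen j hU hx]
    refine norm_iteratedFDerivWithin_comp_le hHs.contDiffOn hgs
      (by exact_mod_cast hj) uniqueDiffOn_univ hUd (mapsTo_univ _ _) hx (fun i hi => ?_)
      (fun i h1 h2 => hgD i h1 (h2.trans hj))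
    rw [iteratedFDerivWithin_univ]
    exact hC i (hi.trans hj)
  have c2 := hcb _ (fun i hi => (hH δ hδ η hη R hR ξ (g x) hga i hi).1) 2 le_rfl
  have c1 := hcb _ (fun i hi => (hH δ hδ η hη R hR ξ (g x) hga i hi).2) 1 (by norm_num)
  have c0 := hcb _ (fun i hi => (hH δ hδ η hη R hR ξ (g x) hga i hi).2) 0 (by norm_num)
  simp only [Nat.factorial, Nat.cast_one, one_mul, pow_zero, mul_one, pow_one, Nat.succ_eq_add_one,
    Nat.reduceAdd, Nat.cast_ofNat] at c0 c1 c2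
  rw [hD2] at c2
  have hDW : D ≤ √(M * W) := Real.sqrt_le_sqrt (by gcongr)
  have hmul := norm_iteratedFDerivWithin_mul_le (n := 2) hφs.contDiffOn hcomp hUd hx (by norm_num)
  rw [iteratedFDerivWithin_of_isOpen 2 hU hx] at hmul
  simp only [Finset.sum_range_succ, Finset.sum_range_zero, zero_add,
    iteratedFDerivWithin_of_isOpen _ hU hx] at hmul
  simp only [Nat.reduceSub, Nat.sub_zero, Nat.choose_zero_right, Nat.choose_one_right,
    Nat.choose_self, Nat.cast_one, Nat.cast_ofNat, one_mul] at hmul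
  rw [hfun]
  refine (abs_laplacian_le _ x).trans ?_
  set N1 := ‖iteratedFDeriv ℝ 1 φ x‖ with hN1
  set N2 := ‖iteratedFDeriv ℝ 2 φ x‖ with hN2
  have hN1' : 0 ≤ N1 := norm_nonneg _
  have hN2' : 0 ≤ N2 := norm_nonneg _
  have hX : 0 ≤ η ^ (δ - 1) * |ξ| := by positivity
  have hY : 0 ≤ |ξ| ^ δ := by positivity
  have hbound : ‖iteratedFDeriv ℝ 2 (fun x => φ x * (H ∘ g) x) x‖ ≤
      2 * K * M * (τ * |ξ| ^ δ) +
        (2 * (K * √(M * W)) + K) * ((N1 + N2) * (η ^ (δ - 1) * |ξ|)) := by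
    refine hmul.trans ?_
    have t0 : |φ x| * ‖iteratedFDeriv ℝ 2 (H ∘ g) x‖ ≤ 1 * (2 * (K * |ξ| ^ δ) * (M * τ)) := by
      gcongr
    have t1 : 2 * N1 * ‖iteratedFDeriv ℝ 1 (H ∘ g) x‖ ≤
        2 * N1 * (K * (η ^ (δ - 1) * |ξ|) * √(M * W)) := by
      gcongr
      exact c1.trans (by gcongr)
    have t2 : N2 * ‖iteratedFDeriv ℝ 0 (H ∘ g) x‖ ≤ N2 * (K * (η ^ (δ - 1) * |ξ|)) := by
      gcongr
    have q1 : 0 ≤ N1 * (K * (η ^ (δ - 1) * |ξ|)) := by positivity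
    have q2 : 0 ≤ 2 * N2 * (K * (η ^ (δ - 1) * |ξ|) * √(M * W)) := by positivity
    simp only [norm_iteratedFDeriv_zero, Real.norm_eq_abs, Function.comp] at t0 t1 t2 ⊢
    linarith
  calc (d : ℝ) * _ ≤ d * (2 * K * M * (τ * |ξ| ^ δ) +
        (2 * (K * √(M * W)) + K) * ((N1 + N2) * (η ^ (δ - 1) * |ξ|))) := by gcongr
    _ = d * (2 * K * M) * (τ * |ξ| ^ δ) + d * (2 * (K * √(M * W)) + K) *
        ((N1 + N2) * (η ^ (δ - 1) * |ξ|)) := by ring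
    _ ≤ _ := by
        gcongr
        · exact le_add_of_nonneg_right (by positivity)
        · exact le_add_of_nonneg_left (by positivity)

/-! ### Moments of the kinetic function -/

lemma measurable_chiBar : Measurable fun y : ℝ × ℝ => chiBar y.1 y.2 := by
  have h1 : MeasurableSet {y : ℝ × ℝ | 0 < y.2 ∧ y.2 < y.1} :=
    (measurableSet_lt measurable_const measurable_snd).inter
      (measurableSet_lt measurable_snd measurable_fst)
  have h2 : MeasurableSet {y : ℝ × ℝ | y.1 < y.2 ∧ y.2 < 0} :=
    (measurableSet_lt measurable_fst measurable_snd).inter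
      (measurableSet_lt measurable_snd measurable_const)
  exact ((measurable_const (a := (1 : ℝ))).indicator h1).sub
    ((measurable_const (a := (1 : ℝ))).indicator h2)

lemma chiBar_of_pos {s ξ : ℝ} (hξ : 0 < ξ) :
    chiBar s ξ = (Ioo 0 s).indicator (fun _ => (1 : ℝ)) ξ := by
  rw [chiBar, indicator_of_notMem (s := Ioo s 0) (fun h => absurd h.2 hξ.not_gt), sub_zero]

lemma chiBar_neg_neg (s ξ : ℝ) : chiBar (-s) (-ξ) = -chiBar s ξ := by
  simp only [chiBar, indicator, mem_Ioo, neg_pos, neg_lt_neg_iff, neg_lt_zero, neg_sub]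
  congr 2
  · rw [and_comm]
  · rw [and_comm]

lemma chiBar_zero_right (s : ℝ) : chiBar s 0 = 0 := by simp [chiBar]

lemma chiBar_mul_self_nonneg (s ξ : ℝ) : 0 ≤ chiBar s ξ * ξ := by
  rcases lt_trichotomy ξ 0 with h | rfl | h
  · rw [← neg_mul_neg, ← chiBar_neg_neg, chiBar_of_pos (neg_pos.2 h)]
    exact mul_nonneg (indicator_nonneg (fun _ _ => zero_le_one) _) (by linarith)
  · simp
  · rw [chiBar_of_pos h]
    exact mul_nonneg (indicator_nonneg (fun _ _ => zero_le_one) _) h.le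

lemma expProfile_eq_mul (δ η R ξ a : ℝ) : ∃ c, 0 ≤ c ∧ expProfile δ η R ξ a = c * ξ := by
  refine ⟨lineBump (ξ * Real.exp (-a) / R) * ((ξ * Real.exp (-a)) ^ 2 + η ^ 2) ^ ((δ - 1) / 2) *
    (Real.exp (-a) * Real.exp (-a)), ?_, ?_⟩
  · have h1 : 0 ≤ lineBump (ξ * Real.exp (-a) / R) := lineBump.nonneg
    positivity
  · rw [expProfile, profile, regPow]; ring

/-- The kinetic function and the transported profile have the same sign. -/
lemma chiBar_mul_expProfile (δ η R s ξ a : ℝ) :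
    chiBar s ξ * expProfile δ η R ξ a = |chiBar s ξ| * |expProfile δ η R ξ a| := by
  obtain ⟨c, hc, h⟩ := expProfile_eq_mul δ η R ξ a
  rw [← abs_mul, abs_of_nonneg]
  rw [h, mul_left_comm]
  exact mul_nonneg hc (chiBar_mul_self_nonneg s ξ)

lemma lintegral_rpow_mul_abs_chiBar_of_nonneg {a : ℝ} (ha : -1 < a) {s : ℝ} (hs : 0 ≤ s) :
    ∫⁻ ξ, ENNReal.ofReal (|ξ| ^ a * |chiBar s ξ|) = ENNReal.ofReal (s ^ (a + 1) / (a + 1)) := by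
  have h1 : (fun ξ => ENNReal.ofReal (|ξ| ^ a * |chiBar s ξ|)) =
      (Ioo 0 s).indicator fun ξ => ENNReal.ofReal (ξ ^ a) := by
    funext ξ
    by_cases h : ξ ∈ Ioo 0 s
    · rw [indicator_of_mem h, chiBar_of_pos h.1, indicator_of_mem h, abs_one, mul_one,
        abs_of_pos h.1]
    · have : chiBar s ξ = 0 := by
        rw [chiBar, indicator_of_notMem h, indicator_of_notMem, sub_zero]
        exact fun h' => absurd (h'.1.trans h'.2) hs.not_gt
      rw [indicator_of_notMem h, this]
      simp
  have hint : IntegrableOn (fun ξ : ℝ => ξ ^ a) (Ioc 0 s) :=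
    (intervalIntegrable_iff_integrableOn_Ioc_of_le hs).1
      (intervalIntegral.intervalIntegrable_rpow' ha)
  rw [h1, lintegral_indicator measurableSet_Ioo, setLIntegral_congr Ioo_ae_eq_Ioc,
    ← ofReal_integral_eq_lintegral_ofReal hint]
  · rw [← intervalIntegral.integral_of_le hs, integral_rpow (Or.inl ha),
      Real.zero_rpow (by linarith), sub_zero]
  · filter_upwards [ae_restrict_mem measurableSet_Ioc] with ξ hξ
    exact Real.rpow_nonneg hξ.1.le _

/-- The moments of the kinetic function of a number are its powers. -/
lemma lintegral_rpow_mul_abs_chiBar {a : ℝ} (ha : -1 < a) (s : ℝ) :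
    ∫⁻ ξ, ENNReal.ofReal (|ξ| ^ a * |chiBar s ξ|) = ENNReal.ofReal (|s| ^ (a + 1) / (a + 1)) := by
  rcases le_total 0 s with hs | hs
  · rw [lintegral_rpow_mul_abs_chiBar_of_nonneg ha hs, abs_of_nonneg hs]
  · rw [abs_of_nonpos hs, ← lintegral_rpow_mul_abs_chiBar_of_nonneg ha (neg_nonneg.2 hs),
      ← (Measure.measurePreserving_neg (volume : Measure ℝ)).lintegral_comp_emb
        (MeasurableEquiv.neg ℝ).measurableEmbedding]
    refine lintegral_congr fun ξ => ?_
    rw [← neg_neg s, chiBar_neg_neg]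
    simp

lemma ofReal_abs_rpow {b : ℝ} (hb : 0 ≤ b) (s : ℝ) : ENNReal.ofReal (|s| ^ b) = ‖s‖ₑ ^ b := by
  rw [← ENNReal.ofReal_rpow_of_nonneg (abs_nonneg s) hb, ← Real.norm_eq_abs, ofReal_norm]

/-- The reordering of variables `(x, ξ, t) ↦ ((t, x), ξ)`. -/
def reorder (d : ℕ) : Space d × ℝ × ℝ ≃ᵐ (ℝ × Space d) × ℝ :=
  MeasurableEquiv.prodComm.trans (MeasurableEquiv.prodAssoc.trans MeasurableEquiv.prodComm)

lemma reorder_apply {d : ℕ} (y : Space d × ℝ × ℝ) : reorder d y = ((y.2.2, y.1), y.2.1) := rfl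

lemma measurePreserving_reorder (d : ℕ) : MeasurePreserving (reorder d) volume volume :=
  (Measure.measurePreserving_swap (μ := (volume : Measure ℝ))
      (ν := (volume : Measure (ℝ × Space d)))).comp
    (volume_preserving_prodAssoc.comp (Measure.measurePreserving_swap
      (μ := (volume : Measure (Space d))) (ν := (volume : Measure (ℝ × ℝ)))))

lemma reorder_preimage {d : ℕ} (S : Set (Space d)) (I : Set ℝ) :
    reorder d ⁻¹' ((I ×ˢ S) ×ˢ univ) = S ×ˢ univ ×ˢ I := by
  ext y
  simp only [mem_preimage, reorder_apply, mem_prod, mem_univ, and_true, true_and]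
  exact and_comm

lemma setLIntegral_reorder {d : ℕ} (S : Set (Space d)) (I : Set ℝ)
    (F : (ℝ × Space d) × ℝ → ENNReal) :
    ∫⁻ y in S ×ˢ (univ : Set ℝ) ×ˢ I, F ((y.2.2, y.1), y.2.1) =
      ∫⁻ y in (I ×ˢ S) ×ˢ (univ : Set ℝ), F y := by
  rw [← reorder_preimage, ← (measurePreserving_reorder d).setLIntegral_comp_preimage_emb
    (reorder d).measurableEmbedding]
  rfl

/-- A velocity moment of the kinetic function of `w` is a moment of `w`. -/
lemma lintegral_moment_prod {α : Type*} [MeasurableSpace α] {μ : Measure α} [SFinite μ] {w : α → ℝ}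
    (hw : AEStronglyMeasurable w μ) {a : ℝ} (ha : -1 < a) :
    ∫⁻ y, ENNReal.ofReal (|y.2| ^ a * |chiBar (w y.1) y.2|) ∂(μ.prod volume) =
      ENNReal.ofReal (1 / (a + 1)) * ∫⁻ x, ‖w x‖ₑ ^ (a + 1) ∂μ := by
  have hm : AEMeasurable (fun y : α × ℝ => ENNReal.ofReal (|y.2| ^ a * |chiBar (w y.1) y.2|))
      (μ.prod volume) := by
    have h1 : AEMeasurable (fun y : α × ℝ => (w y.1, y.2)) (μ.prod volume) :=
      (hw.aemeasurable.comp_fst).prodMk measurable_snd.aemeasurable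
    have h2 := measurable_chiBar.comp_aemeasurable h1
    refine AEMeasurable.ennreal_ofReal (AEMeasurable.mul ?_ h2.abs)
    exact (measurable_snd.abs.pow_const a).aemeasurable
  rw [lintegral_prod _ hm, ← lintegral_const_mul' _ _ ENNReal.ofReal_ne_top]
  refine lintegral_congr fun x => ?_
  simp only
  rw [lintegral_rpow_mul_abs_chiBar ha, ← ofReal_abs_rpow (by linarith), ← ENNReal.ofReal_mul
    (by have : 0 < a + 1 := by linarith
        positivity)]
  congr 1; ring

lemma lintegral_moment_space {d : ℕ} {U : Set (Space d)} {w : Space d → ℝ}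
    (hw : AEStronglyMeasurable w (volume.restrict U)) {a : ℝ} (ha : -1 < a) :
    ∫⁻ y in U ×ˢ (univ : Set ℝ), ENNReal.ofReal (|y.2| ^ a * |chiBar (w y.1) y.2|) =
      ENNReal.ofReal (1 / (a + 1)) * ∫⁻ x in U, ‖w x‖ₑ ^ (a + 1) := by
  rw [← lintegral_moment_prod hw ha, Measure.volume_eq_prod, ← Measure.prod_restrict,
    Measure.restrict_univ]

lemma lintegral_moment_spacetime {d : ℕ} {S : Set (Space d)} {I : Set ℝ} {u : ℝ → Space d → ℝ}
    (hu : AEStronglyMeasurable (fun y : ℝ × Space d => u y.1 y.2) (volume.restrict (I ×ˢ S)))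
    {a : ℝ} (ha : -1 < a) :
    ∫⁻ y in S ×ˢ (univ : Set ℝ) ×ˢ I, ENNReal.ofReal (|y.2.1| ^ a * |chiBar (u y.2.2 y.1) y.2.1|) =
      ENNReal.ofReal (1 / (a + 1)) * ∫⁻ y in I ×ˢ S, ‖u y.1 y.2‖ₑ ^ (a + 1) := by
  rw [← lintegral_moment_prod hu ha]
  refine (setLIntegral_reorder S I
    (fun y => ENNReal.ofReal (|y.2| ^ a * |chiBar (u y.1.1 y.1.2) y.2|))).trans ?_
  rw [Measure.volume_eq_prod, ← Measure.prod_restrict, Measure.restrict_univ]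

/-! ### Bounds for the terms of the kinetic equation -/

lemma continuous_expProfile (δ : ℝ) {η : ℝ} (hη : 0 < η) (R : ℝ) :
    Continuous fun p : ℝ × ℝ => expProfile δ η R p.1 p.2 := by
  have := (contDiff_profile δ hη R).continuous
  unfold expProfile
  fun_prop

/-- The pairing of the kinetic function with a transported test function is nonnegative, so that it
is an integral of nonnegative functions, and it is controlled by the `L^{1+δ}` norm. -/
lemma pairing_eq_lintegral {d : ℕ} {U : Set (Space d)} (hU : MeasurableSet U)
    {w g φ : Space d → ℝ} (hw : AEStronglyMeasurable w (volume.restrict U))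
    (hg : ContinuousOn g U) (hφ : Continuous φ) (hφ01 : ∀ x, φ x ∈ Icc (0 : ℝ) 1)
    {δ η R K : ℝ} (hδ : 0 < δ) (hη : 0 < η) (hK0 : 0 ≤ K)
    (hK : ∀ x ∈ U, ∀ ξ, |expProfile δ η R ξ (g x)| ≤ K * |ξ| ^ δ)
    (hfin : ∫⁻ x in U, ‖w x‖ₑ ^ (δ + 1) ≠ ⊤) :
    AEMeasurable (fun y : Space d × ℝ =>
      ENNReal.ofReal (φ y.1 * (|chiBar (w y.1) y.2| * |expProfile δ η R y.2 (g y.1)|)))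
      (volume.restrict (U ×ˢ univ)) ∧
    0 ≤ (∫ y in U ×ˢ (univ : Set ℝ),
      chiBar (w y.1) y.2 * (φ y.1 * expProfile δ η R y.2 (g y.1))) ∧
    ENNReal.ofReal (∫ y in U ×ˢ (univ : Set ℝ),
      chiBar (w y.1) y.2 * (φ y.1 * expProfile δ η R y.2 (g y.1))) =
      ∫⁻ y in U ×ˢ (univ : Set ℝ),
        ENNReal.ofReal (φ y.1 * (|chiBar (w y.1) y.2| * |expProfile δ η R y.2 (g y.1)|)) ∧
    ∫⁻ y in U ×ˢ (univ : Set ℝ),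
        ENNReal.ofReal (φ y.1 * (|chiBar (w y.1) y.2| * |expProfile δ η R y.2 (g y.1)|)) ≤
      ENNReal.ofReal K * ∫⁻ x in U, ‖w x‖ₑ ^ (δ + 1) := by
  have hUm : MeasurableSet (U ×ˢ (univ : Set ℝ)) := hU.prod MeasurableSet.univ
  have hμ : (volume.restrict (U ×ˢ (univ : Set ℝ)) : Measure (Space d × ℝ)) =
      (volume.restrict U).prod volume := by
    rw [Measure.volume_eq_prod, ← Measure.prod_restrict, Measure.restrict_univ]
  have hchi : AEMeasurable (fun y : Space d × ℝ => chiBar (w y.1) y.2)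
      (volume.restrict (U ×ˢ univ)) := by
    rw [hμ]
    exact measurable_chiBar.comp_aemeasurable
      ((hw.aemeasurable.comp_fst).prodMk measurable_snd.aemeasurable)
  have hH : AEMeasurable (fun y : Space d × ℝ => expProfile δ η R y.2 (g y.1))
      (volume.restrict (U ×ˢ univ)) := by
    have h1 : ContinuousOn (fun y : Space d × ℝ => (y.2, g y.1)) (U ×ˢ univ) :=
      continuousOn_snd.prodMk (hg.comp continuousOn_fst fun y hy => hy.1)
    have h2 := (continuous_expProfile δ hη R).comp_continuousOn h1
    simp only [Function.comp_def] at h2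
    exact h2.aemeasurable hUm
  have hφm : AEMeasurable (fun y : Space d × ℝ => φ y.1) (volume.restrict (U ×ˢ univ)) :=
    (hφ.comp continuous_fst).aemeasurable
  have hrw : ∀ y : Space d × ℝ, chiBar (w y.1) y.2 * (φ y.1 * expProfile δ η R y.2 (g y.1)) =
      φ y.1 * (|chiBar (w y.1) y.2| * |expProfile δ η R y.2 (g y.1)|) := fun y => by
    rw [← chiBar_mul_expProfile]; ring
  have hm : AEMeasurable (fun y : Space d × ℝ =>
      φ y.1 * (|chiBar (w y.1) y.2| * |expProfile δ η R y.2 (g y.1)|))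
      (volume.restrict (U ×ˢ univ)) := hφm.mul (hchi.abs.mul hH.abs)
  have hnn : ∀ y : Space d × ℝ,
      0 ≤ φ y.1 * (|chiBar (w y.1) y.2| * |expProfile δ η R y.2 (g y.1)|) := fun y =>
    mul_nonneg (hφ01 _).1 (by positivity)
  have hle : ∫⁻ y in U ×ˢ (univ : Set ℝ),
        ENNReal.ofReal (φ y.1 * (|chiBar (w y.1) y.2| * |expProfile δ η R y.2 (g y.1)|)) ≤
      ENNReal.ofReal K * ∫⁻ x in U, ‖w x‖ₑ ^ (δ + 1) := by
    calc _ ≤ ∫⁻ y in U ×ˢ (univ : Set ℝ),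
          ENNReal.ofReal K * ENNReal.ofReal (|y.2| ^ δ * |chiBar (w y.1) y.2|) := by
          refine setLIntegral_mono' hUm fun y hy => ?_
          rw [← ENNReal.ofReal_mul hK0]
          refine ENNReal.ofReal_le_ofReal ?_
          calc _ ≤ 1 * (|chiBar (w y.1) y.2| * (K * |y.2| ^ δ)) := by
                gcongr
                · exact (hφ01 _).2
                · exact hK _ hy.1 _
            _ = _ := by ring
      _ = ENNReal.ofReal K * (ENNReal.ofReal (1 / (δ + 1)) * ∫⁻ x in U, ‖w x‖ₑ ^ (δ + 1)) := by
          rw [lintegral_const_mul' _ _ ENNReal.ofReal_ne_top,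
            lintegral_moment_space hw (by linarith)]
      _ ≤ ENNReal.ofReal K * (1 * ∫⁻ x in U, ‖w x‖ₑ ^ (δ + 1)) := by
          gcongr
          refine ENNReal.ofReal_le_one.2 ?_
          rw [div_le_one (by linarith)]; linarith
      _ = _ := by rw [one_mul]
  have hint : Integrable (fun y : Space d × ℝ =>
      φ y.1 * (|chiBar (w y.1) y.2| * |expProfile δ η R y.2 (g y.1)|))
      (volume.restrict (U ×ˢ univ)) := by
    refine ⟨hm.aestronglyMeasurable, ?_⟩
    rw [hasFiniteIntegral_iff_ofReal (ae_of_all _ hnn)]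
    exact hle.trans_lt (ENNReal.mul_lt_top ENNReal.ofReal_lt_top hfin.lt_top)
  simp_rw [hrw]
  exact ⟨hm.ennreal_ofReal, integral_nonneg hnn,
    ofReal_integral_eq_lintegral_ofReal hint (ae_of_all _ hnn), hle⟩

lemma aemeasurable_moment_spacetime {d : ℕ} {S : Set (Space d)} {I : Set ℝ} {u : ℝ → Space d → ℝ}
    (hu : AEStronglyMeasurable (fun y : ℝ × Space d => u y.1 y.2) (volume.restrict (I ×ˢ S)))
    (a : ℝ) : AEMeasurable (fun y : Space d × ℝ × ℝ =>
      ENNReal.ofReal (|y.2.1| ^ a * |chiBar (u y.2.2 y.1) y.2.1|))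
      (volume.restrict (S ×ˢ univ ×ˢ I)) := by
  have h1 : AEMeasurable (fun y : (ℝ × Space d) × ℝ =>
      ENNReal.ofReal (|y.2| ^ a * |chiBar (u y.1.1 y.1.2) y.2|))
      (volume.restrict ((I ×ˢ S) ×ˢ univ)) := by
    rw [Measure.volume_eq_prod, ← Measure.prod_restrict, Measure.restrict_univ]
    refine AEMeasurable.ennreal_ofReal (AEMeasurable.mul ?_ ?_)
    · exact (measurable_snd.abs.pow_const a).aemeasurable
    · exact (measurable_chiBar.comp_aemeasurable
        ((hu.aemeasurable.comp_fst).prodMk measurable_snd.aemeasurable)).abs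
  have h2 := (measurePreserving_reorder d).restrict_preimage_emb (reorder d).measurableEmbedding
    ((I ×ˢ S) ×ˢ univ)
  rw [reorder_preimage] at h2
  have h3 := h1.comp_quasiMeasurePreserving h2.quasiMeasurePreserving
  simp only [Function.comp_def, reorder_apply] at h3
  exact h3

/-- The diffusion term of the kinetic equation, when the Laplacian of the test function is at most
`a |ξ|^δ`, plus `b |ξ|` on the set `S`. -/
lemma enorm_diffusion_le {d : ℕ} {U S : Set (Space d)} {I : Set ℝ} (hU : MeasurableSet U)
    (hI : MeasurableSet I) (hS : MeasurableSet S) (hSU : S ⊆ U) {u : ℝ → Space d → ℝ}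
    (hu : AEStronglyMeasurable (fun y : ℝ × Space d => u y.1 y.2) (volume.restrict (I ×ˢ U)))
    {m δ a b : ℝ} (hm : 0 < m) (hδ : 0 < δ) (ha : 0 ≤ a) (hb : 0 ≤ b)
    {L : Space d × ℝ × ℝ → ℝ}
    (hL : ∀ y ∈ U ×ˢ (univ : Set ℝ) ×ˢ I,
      |L y| ≤ a * |y.2.1| ^ δ + S.indicator (fun _ => b) y.1 * |y.2.1|) :
    ‖∫ y in U ×ˢ (univ : Set ℝ) ×ˢ I,
        m * |y.2.1| ^ (m - 1) * chiBar (u y.2.2 y.1) y.2.1 * L y‖ₑ ≤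
      ENNReal.ofReal a * (∫⁻ y in I ×ˢ U, ‖u y.1 y.2‖ₑ ^ (m + δ)) +
        ENNReal.ofReal b * ∫⁻ y in I ×ˢ S, ‖u y.1 y.2‖ₑ ^ (m + 1) := by
  have hE : MeasurableSet (U ×ˢ (univ : Set ℝ) ×ˢ I) := hU.prod (MeasurableSet.univ.prod hI)
  have hES : MeasurableSet (S ×ˢ (univ : Set ℝ) ×ˢ I) := hS.prod (MeasurableSet.univ.prod hI)
  have huS : AEStronglyMeasurable (fun y : ℝ × Space d => u y.1 y.2) (volume.restrict (I ×ˢ S)) :=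
    hu.mono_measure (Measure.restrict_mono (prod_mono_right hSU) le_rfl)
  have hpt : ∀ y ∈ U ×ˢ (univ : Set ℝ) ×ˢ I,
      ‖m * |y.2.1| ^ (m - 1) * chiBar (u y.2.2 y.1) y.2.1 * L y‖ₑ ≤
        ENNReal.ofReal (m * a) *
            ENNReal.ofReal (|y.2.1| ^ (m + δ - 1) * |chiBar (u y.2.2 y.1) y.2.1|) +
          (S ×ˢ (univ : Set ℝ) ×ˢ I).indicator (fun y => ENNReal.ofReal (m * b) *
            ENNReal.ofReal (|y.2.1| ^ m * |chiBar (u y.2.2 y.1) y.2.1|)) y := by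
    intro y hy
    have hind : (S ×ˢ (univ : Set ℝ) ×ˢ I).indicator (fun y => ENNReal.ofReal (m * b) *
            ENNReal.ofReal (|y.2.1| ^ m * |chiBar (u y.2.2 y.1) y.2.1|)) y =
        ENNReal.ofReal (m * S.indicator (fun _ => b) y.1 *
          (|y.2.1| ^ m * |chiBar (u y.2.2 y.1) y.2.1|)) := by
      by_cases h : y.1 ∈ S
      · rw [indicator_of_mem (show y ∈ S ×ˢ (univ : Set ℝ) ×ˢ I from ⟨h, hy.2⟩),
          indicator_of_mem h, ENNReal.ofReal_mul (p := m * b) (by positivity)]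
      · rw [indicator_of_notMem (fun h' => h h'.1), indicator_of_notMem h]
        simp
    have hSb : 0 ≤ S.indicator (fun _ => b) y.1 := indicator_nonneg (fun _ _ => hb) _
    rw [hind, ← ENNReal.ofReal_mul (by positivity), ← ENNReal.ofReal_add (by positivity)
      (by positivity), ← ofReal_norm]
    refine ENNReal.ofReal_le_ofReal ?_
    rw [Real.norm_eq_abs, abs_mul, abs_mul, abs_mul, abs_of_pos hm,
      abs_of_nonneg (Real.rpow_nonneg (abs_nonneg _) _)]
    rcases eq_or_ne y.2.1 0 with h0 | h0
    · rw [h0, chiBar_zero_right]; simp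
    · have hξ : 0 < |y.2.1| := abs_pos.2 h0
      have e1 : |y.2.1| ^ (m + δ - 1) = |y.2.1| ^ (m - 1) * |y.2.1| ^ δ := by
        rw [← Real.rpow_add hξ]; congr 1; ring
      have e2 : |y.2.1| ^ m = |y.2.1| ^ (m - 1) * |y.2.1| := by
        nth_rewrite 3 [← Real.rpow_one |y.2.1|]
        rw [← Real.rpow_add hξ]; congr 1; ring
      rw [e1, e2]
      calc _ ≤ m * |y.2.1| ^ (m - 1) * |chiBar (u y.2.2 y.1) y.2.1| *
            (a * |y.2.1| ^ δ + S.indicator (fun _ => b) y.1 * |y.2.1|) := by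
            gcongr
            exact hL y hy
        _ = _ := by ring
  calc _ ≤ ∫⁻ y in U ×ˢ (univ : Set ℝ) ×ˢ I,
        ‖m * |y.2.1| ^ (m - 1) * chiBar (u y.2.2 y.1) y.2.1 * L y‖ₑ :=
        enorm_integral_le_lintegral_enorm _
    _ ≤ _ := setLIntegral_mono' hE hpt
    _ = ENNReal.ofReal (m * a) * (ENNReal.ofReal (1 / (m + δ - 1 + 1)) *
          ∫⁻ y in I ×ˢ U, ‖u y.1 y.2‖ₑ ^ (m + δ - 1 + 1)) +
        ENNReal.ofReal (m * b) * (ENNReal.ofReal (1 / (m + 1)) *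
          ∫⁻ y in I ×ˢ S, ‖u y.1 y.2‖ₑ ^ (m + 1)) := by
        rw [lintegral_add_left' ((aemeasurable_moment_spacetime hu _).const_mul _),
          setLIntegral_indicator hES, inter_eq_left.2 (prod_mono_left hSU),
          lintegral_const_mul' _ _ ENNReal.ofReal_ne_top,
          lintegral_const_mul' _ _ ENNReal.ofReal_ne_top,
          lintegral_moment_spacetime hu (by linarith),
          lintegral_moment_spacetime huS (by linarith)]
    _ ≤ _ := by
        rw [sub_add_cancel, ← mul_assoc, ← mul_assoc, ← ENNReal.ofReal_mul (by positivity),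
          ← ENNReal.ofReal_mul (by positivity)]
        have e1 : m * a * (1 / (m + δ)) ≤ a := by
          rw [mul_one_div, div_le_iff₀ (by positivity)]; nlinarith
        have e2 : m * b * (1 / (m + 1)) ≤ b := by
          rw [mul_one_div, div_le_iff₀ (by positivity)]; nlinarith
        exact add_le_add (mul_le_mul_left (ENNReal.ofReal_le_ofReal e1) _)
          (mul_le_mul_left (ENNReal.ofReal_le_ofReal e2) _)

lemma hasDerivAt_expProfile_velocity (δ : ℝ) {η : ℝ} (hη : 0 < η) (R a ξ : ℝ) :
    HasDerivAt (fun ξ => expProfile δ η R ξ a)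
      (deriv (profile δ η R) (ξ * Real.exp (-a)) * Real.exp (-a) * Real.exp (-a)) ξ := by
  have h1 : HasDerivAt (fun ξ => ξ * Real.exp (-a)) (Real.exp (-a)) ξ := by
    simpa using (hasDerivAt_id ξ).mul_const (Real.exp (-a))
  exact ((((contDiff_profile δ hη R).differentiable (by simp)) _).hasDerivAt.comp ξ h1).mul_const _

/-- The regularization of the singular density `|ξ exp (-a)|^{δ-1}`, cut off at large velocities. Up
to a constant it bounds the `ξ`-derivative of the transported profile from below at `|ξ| ≲ R`. -/
noncomputable def defectDensity (δ η R ξ a : ℝ) : ℝ :=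
  lineBump (ξ * Real.exp (-a) / R) * ((ξ * Real.exp (-a)) ^ 2 + η ^ 2) ^ ((δ - 1) / 2)

lemma continuous_defectDensity (δ : ℝ) {η : ℝ} (hη : 0 < η) (R : ℝ) :
    Continuous fun p : ℝ × ℝ => defectDensity δ η R p.1 p.2 := by
  unfold defectDensity
  have h1 : Continuous lineBump := lineBump.continuous
  refine Continuous.mul (by fun_prop) (Continuous.rpow_const (by fun_prop) fun p => Or.inl ?_)
  positivity

lemma defectDensity_nonneg (δ η R ξ a : ℝ) : 0 ≤ defectDensity δ η R ξ a :=
  mul_nonneg lineBump.nonneg (Real.rpow_nonneg (by positivity) _)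

lemma defectDensity_le {δ : ℝ} (hδ : δ ≤ 1) {η : ℝ} (hη : 0 < η) (R ξ a : ℝ) :
    defectDensity δ η R ξ a ≤ (η ^ 2) ^ ((δ - 1) / 2) := by
  have h1 : ((ξ * Real.exp (-a)) ^ 2 + η ^ 2) ^ ((δ - 1) / 2) ≤ (η ^ 2) ^ ((δ - 1) / 2) :=
    Real.rpow_le_rpow_of_nonpos (by positivity) (by nlinarith [sq_nonneg (ξ * Real.exp (-a))])
      (by linarith)
  calc _ ≤ 1 * ((ξ * Real.exp (-a)) ^ 2 + η ^ 2) ^ ((δ - 1) / 2) := by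
        unfold defectDensity
        gcongr
        exact lineBump.le_one
    _ ≤ _ := by rw [one_mul]; exact h1

/-- The defect term of the kinetic equation is bounded below, up to the mass of the defect measure
at large velocities. -/
lemma exists_defect_bound (A : ℝ) :
    ∃ K : ℝ, 0 ≤ K ∧ ∀ {d : ℕ} {U : Set (Space d)} {I : Set ℝ} (_ : MeasurableSet U)
      (_ : MeasurableSet I) {g : ℝ → Space d → ℝ}
      (_ : ContinuousOn (fun y : Space d × ℝ × ℝ => g y.2.2 y.1) (U ×ˢ univ ×ˢ I))
      (_ : ∀ x ∈ U, ∀ r ∈ I, |g r x| ≤ A) {φ : Space d → ℝ} (_ : Continuous φ)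
      (_ : ∀ x, φ x ∈ Icc (0 : ℝ) 1) {δ η R : ℝ} (_ : δ ∈ Ioc (0 : ℝ) 1) (_ : 0 < η) (_ : 1 ≤ R)
      {ν : Measure (Space d × ℝ × ℝ)} (_ : ν (U ×ˢ univ ×ˢ I) ≠ ⊤),
      AEMeasurable (fun y : Space d × ℝ × ℝ =>
        ENNReal.ofReal (φ y.1 * defectDensity δ η R y.2.1 (g y.2.2 y.1)))
        (ν.restrict (U ×ˢ univ ×ˢ I)) ∧
      ∃ J : ℝ, 0 ≤ J ∧ ENNReal.ofReal J = ∫⁻ y in U ×ˢ univ ×ˢ I,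
          ENNReal.ofReal (φ y.1 * defectDensity δ η R y.2.1 (g y.2.2 y.1)) ∂ν ∧
        δ * Real.exp (-(2 * A)) * J ≤ (∫ y in U ×ˢ univ ×ˢ I,
          deriv (fun ξ => φ y.1 * expProfile δ η R ξ (g y.2.2 y.1)) y.2.1 ∂ν) +
          K * ν.real (U ×ˢ univ ×ˢ I ∩ {y | R * Real.exp (-A) ≤ |y.2.1|}) := by
  obtain ⟨K, hK1, hK⟩ := exists_bound_profile
  have hK0 : 0 ≤ K := by linarith
  refine ⟨K * Real.exp (2 * A), by positivity, ?_⟩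
  intro d U I hU hI g hg hgA φ hφ hφ01 δ η R hδ hη hR ν hν
  have hE : MeasurableSet (U ×ˢ (univ : Set ℝ) ×ˢ I) := hU.prod (MeasurableSet.univ.prod hI)
  set E : Set (Space d × ℝ × ℝ) := U ×ˢ (univ : Set ℝ) ×ˢ I with hEd
  have hT : MeasurableSet {y : Space d × ℝ × ℝ | R * Real.exp (-A) ≤ |y.2.1|} :=
    measurableSet_le measurable_const (by fun_prop)
  set T : Set (Space d × ℝ × ℝ) := {y | R * Real.exp (-A) ≤ |y.2.1|} with hTd
  have hfin : IsFiniteMeasure (ν.restrict E) :=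
    ⟨by rw [Measure.restrict_apply_univ]; exact hν.lt_top⟩
  have hs1 : ContDiff ℝ ∞ (deriv (profile δ η R)) :=
    (contDiff_infty_iff_deriv.1 (contDiff_profile δ hη R)).2
  have hφc : ContinuousOn (fun y : Space d × ℝ × ℝ => φ y.1) E :=
    (hφ.comp continuous_fst).continuousOn
  have hξg : ContinuousOn (fun y : Space d × ℝ × ℝ => (y.2.1, g y.2.2 y.1)) E :=
    ContinuousOn.prodMk (by fun_prop) hg
  have hPc : ContinuousOn (fun y : Space d × ℝ × ℝ =>
      φ y.1 * defectDensity δ η R y.2.1 (g y.2.2 y.1)) E := by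
    have h2 := (continuous_defectDensity δ hη R).comp_continuousOn hξg
    simp only [Function.comp_def] at h2
    exact hφc.mul h2
  have hPm := hPc.aestronglyMeasurable (μ := ν) hE
  have hP0 : ∀ y : Space d × ℝ × ℝ, 0 ≤ φ y.1 * defectDensity δ η R y.2.1 (g y.2.2 y.1) := fun y =>
    mul_nonneg (hφ01 _).1 (defectDensity_nonneg _ _ _ _ _)
  have hPint : Integrable (fun y : Space d × ℝ × ℝ =>
      φ y.1 * defectDensity δ η R y.2.1 (g y.2.2 y.1)) (ν.restrict E) := by
    refine Integrable.of_bound hPm ((η ^ 2) ^ ((δ - 1) / 2)) (ae_of_all _ fun y => ?_)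
    rw [Real.norm_of_nonneg (hP0 y)]
    calc _ ≤ 1 * (η ^ 2) ^ ((δ - 1) / 2) := by
          gcongr
          · exact defectDensity_nonneg _ _ _ _ _
          · exact (hφ01 _).2
          · exact defectDensity_le hδ.2 hη _ _ _
      _ = _ := one_mul _
  have hder : ∀ y : Space d × ℝ × ℝ,
      deriv (fun ξ => φ y.1 * expProfile δ η R ξ (g y.2.2 y.1)) y.2.1 =
        φ y.1 * (deriv (profile δ η R) (y.2.1 * Real.exp (-g y.2.2 y.1)) *
          Real.exp (-g y.2.2 y.1) * Real.exp (-g y.2.2 y.1)) := fun y =>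
    ((hasDerivAt_expProfile_velocity δ hη R _ _).const_mul _).deriv
  have hexpA : ∀ y ∈ E, Real.exp (-A) ≤ Real.exp (-g y.2.2 y.1) ∧
      Real.exp (-g y.2.2 y.1) ≤ Real.exp A := by
    intro y hy
    have := abs_le.1 (hgA y.1 hy.1 y.2.2 hy.2.2)
    exact ⟨Real.exp_le_exp.2 (by linarith), Real.exp_le_exp.2 (by linarith)⟩
  have hexp2 : Real.exp (2 * A) = Real.exp A * Real.exp A := by rw [two_mul, Real.exp_add]
  have hexp2' : Real.exp (-(2 * A)) = Real.exp (-A) * Real.exp (-A) := by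
    rw [← Real.exp_add]; congr 1; ring
  have hDc : ContinuousOn (fun y : Space d × ℝ × ℝ =>
      deriv (fun ξ => φ y.1 * expProfile δ η R ξ (g y.2.2 y.1)) y.2.1) E := by
    simp_rw [hder]
    have h1 : Continuous fun p : ℝ × ℝ => deriv (profile δ η R) (p.1 * Real.exp (-p.2)) *
        Real.exp (-p.2) * Real.exp (-p.2) := by
      have := hs1.continuous
      fun_prop
    have h2 := h1.comp_continuousOn hξg
    simp only [Function.comp_def] at h2
    exact hφc.mul h2
  obtain ⟨M, hM⟩ := (hasCompactSupport_profile δ η (by linarith : 0 < R)).deriv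
    |>.exists_bound_of_continuous hs1.continuous
  have hDint : Integrable (fun y : Space d × ℝ × ℝ =>
      deriv (fun ξ => φ y.1 * expProfile δ η R ξ (g y.2.2 y.1)) y.2.1) (ν.restrict E) := by
    refine Integrable.of_bound (hDc.aestronglyMeasurable hE) (M * Real.exp A * Real.exp A) ?_
    filter_upwards [ae_restrict_mem hE] with y hy
    have hM0 : 0 ≤ M := (norm_nonneg _).trans (hM 0)
    rw [hder, norm_mul, norm_mul, norm_mul, Real.norm_of_nonneg (Real.exp_nonneg _),
      Real.norm_of_nonneg (hφ01 _).1]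
    calc _ ≤ 1 * (M * Real.exp A * Real.exp A) := by
          gcongr
          · exact (hφ01 _).2
          · exact hM _
          · exact (neg_le_abs _).trans (hgA y.1 hy.1 y.2.2 hy.2.2)
          · exact (neg_le_abs _).trans (hgA y.1 hy.1 y.2.2 hy.2.2)
      _ = _ := one_mul _
  have hTint : Integrable (T.indicator fun _ => K * Real.exp (2 * A)) (ν.restrict E) :=
    (integrable_const _).indicator hT
  have hpt : ∀ y ∈ E, δ * Real.exp (-(2 * A)) * (φ y.1 * defectDensity δ η R y.2.1 (g y.2.2 y.1)) ≤
      deriv (fun ξ => φ y.1 * expProfile δ η R ξ (g y.2.2 y.1)) y.2.1 +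
        T.indicator (fun _ => K * Real.exp (2 * A)) y := by
    intro y hy
    obtain ⟨hl, hu⟩ := hexpA y hy
    rw [hder]
    set v := Real.exp (-g y.2.2 y.1) with hv
    have hv0 : 0 < v := Real.exp_pos _
    have h1 := (hK δ hδ η hη R hR (y.2.1 * v)).2.2.2
    have hDD : lineBump (y.2.1 * v / R) * ((y.2.1 * v) ^ 2 + η ^ 2) ^ ((δ - 1) / 2) =
        defectDensity δ η R y.2.1 (g y.2.2 y.1) := rfl
    rw [hDD] at h1
    have hD0 := defectDensity_nonneg δ η R y.2.1 (g y.2.2 y.1)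
    have hφ0 := (hφ01 y.1).1
    have hδ0 := hδ.1.le
    have h2 : φ y.1 * v * v * {ξ : ℝ | R ≤ |ξ|}.indicator (fun _ => K) (y.2.1 * v) ≤
        T.indicator (fun _ => K * Real.exp (2 * A)) y := by
      by_cases h : R ≤ |y.2.1 * v|
      · have hyT : y ∈ T := by
          change R * Real.exp (-A) ≤ |y.2.1|
          rw [abs_mul, abs_of_pos hv0] at h
          calc R * Real.exp (-A) ≤ |y.2.1| * v * Real.exp (-A) := by gcongr
            _ ≤ |y.2.1| * Real.exp A * Real.exp (-A) := by gcongr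
            _ = |y.2.1| := by rw [mul_assoc, ← Real.exp_add]; simp
        rw [indicator_of_mem hyT,
          indicator_of_mem (show y.2.1 * v ∈ {ξ : ℝ | R ≤ |ξ|} from h), hexp2]
        calc φ y.1 * v * v * K ≤ 1 * Real.exp A * Real.exp A * K := by
              gcongr
              exact (hφ01 _).2
          _ = _ := by ring
      · rw [indicator_of_notMem (show y.2.1 * v ∉ {ξ : ℝ | R ≤ |ξ|} from h), mul_zero]
        exact indicator_nonneg (fun _ _ => by positivity) _
    have h3 : φ y.1 * v * v * (δ * defectDensity δ η R y.2.1 (g y.2.2 y.1)) ≤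
        φ y.1 * v * v * (deriv (profile δ η R) (y.2.1 * v) +
          {ξ : ℝ | R ≤ |ξ|}.indicator (fun _ => K) (y.2.1 * v)) := by
      gcongr
      linarith
    have h4 : δ * Real.exp (-(2 * A)) * (φ y.1 * defectDensity δ η R y.2.1 (g y.2.2 y.1)) ≤
        φ y.1 * v * v * (δ * defectDensity δ η R y.2.1 (g y.2.2 y.1)) := by
      rw [hexp2']
      calc _ ≤ δ * (v * v) * (φ y.1 * defectDensity δ η R y.2.1 (g y.2.2 y.1)) := by gcongr
        _ = _ := by ring
    linarith
  refine ⟨hPm.aemeasurable.ennreal_ofReal,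
    ∫ y in E, φ y.1 * defectDensity δ η R y.2.1 (g y.2.2 y.1) ∂ν,
    integral_nonneg hP0, ofReal_integral_eq_lintegral_ofReal hPint (ae_of_all _ hP0), ?_⟩
  have hsum := setIntegral_mono_on (hPint.const_mul (δ * Real.exp (-(2 * A))))
    (hDint.add hTint) hE hpt
  rw [integral_const_mul, integral_add' hDint hTint, integral_indicator hT, setIntegral_const,
    smul_eq_mul, measureReal_restrict_apply hT] at hsum
  rw [inter_comm E T, mul_comm (K * _)]
  exact hsum

/-! ### The entropy inequality for regularized test functions -/

lemma continuousOn_charExponent {d n : ℕ} {U : Set (Space d)} {f : Fin n → Space d → ℝ}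
    (hf : ∀ k, IsCb2 U (f k)) {z : ℝ → Fin n → ℝ} (hz : ContinuousOn z (Ici 0)) {s t : ℝ}
    (hs : 0 ≤ s) :
    ContinuousOn (fun y : Space d × ℝ × ℝ => charExponent f z s y.2.2 y.1)
      (U ×ˢ univ ×ˢ Ioc s t) := by
  unfold charExponent
  refine continuousOn_finsetSum _ fun k _ => ContinuousOn.mul ?_ (ContinuousOn.sub ?_ ?_)
  · exact (hf k).1.continuousOn.comp continuousOn_fst fun y hy => hy.1
  · have h1 : ContinuousOn (fun r => z r k) (Ici 0) :=
      (continuous_apply k).comp_continuousOn hz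
    exact h1.comp (t := Ici 0) (f := fun y : Space d × ℝ × ℝ => y.2.2) (by fun_prop)
      fun y hy => hs.trans hy.2.2.1.le
  · exact continuousOn_const

/-- The kinetic equation between the times `s < t` for all test functions, with the sum `ν` of the
entropy and the parabolic defect measure. -/
def KineticEquation {d n : ℕ} (m : ℝ) (U : Set (Space d)) (f : Fin n → Space d → ℝ)
    (z : ℝ → Fin n → ℝ) (u₀ : Space d → ℝ) (u : ℝ → Space d → ℝ)
    (ν : Measure (Space d × ℝ × ℝ)) (s t : ℝ) : Prop :=
  ∀ ρ₀ : Space d × ℝ → ℝ, ContDiff ℝ ∞ ρ₀ → HasCompactSupport ρ₀ →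
    tsupport ρ₀ ⊆ U ×ˢ (univ : Set ℝ) →
    kineticPairing U f z u₀ u ρ₀ s t - kineticPairing U f z u₀ u ρ₀ s s =
      (∫ y in U ×ˢ (univ : Set ℝ) ×ˢ Ioc s t,
        m * |y.2.1| ^ (m - 1) * chiBar (u y.2.2 y.1) y.2.1 *
          Laplacian.laplacian (fun x => transported f z ρ₀ s y.2.2 x y.2.1) y.1) -
      ∫ y in U ×ˢ (univ : Set ℝ) ×ˢ Ioc s t,
        deriv (fun ξ => transported f z ρ₀ s y.2.2 y.1 ξ) y.2.1 ∂ν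

/-- The kinetic equation tested with a regularized tensor product: the regularized energy at time
`t` and the regularized defect are bounded by the energy at time `s`, the diffusion terms inside `U`
and in the layer `S` where the cutoff varies, and the defect at large velocities. -/
lemma exists_regularized_inequality {d n : ℕ} {m : ℝ} (hm : 0 < m) {U : Set (Space d)}
    (hU : IsOpen U) {f : Fin n → Space d → ℝ} (hf : ∀ k, IsCb2 U (f k)) {W : ℝ} (hW : 0 ≤ W) :
    ∃ A K B : ℝ, 0 ≤ A ∧ 0 ≤ K ∧ 0 ≤ B ∧ ∀ {z : ℝ → Fin n → ℝ} (_ : ContinuousOn z (Ici 0))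
      {u₀ : Space d → ℝ} {u : ℝ → Space d → ℝ} {ν : Measure (Space d × ℝ × ℝ)} {s t τ δ : ℝ}
      (_ : δ ∈ Ioc (0 : ℝ) 1) (_ : 0 ≤ s) (_ : s < t) (_ : 0 ≤ τ) (_ : τ ≤ W)
      (_ : ∀ r ∈ Icc s t, ∀ k, |z r k - z s k| ≤ τ)
      (_ : AEStronglyMeasurable (fun y : ℝ × Space d => u y.1 y.2)
        (volume.restrict (Ioi (0 : ℝ) ×ˢ U)))
      (_ : ν (U ×ˢ univ ×ˢ Ioc s t) ≠ ⊤)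
      (_ : AEStronglyMeasurable (state u₀ u s) (volume.restrict U))
      (_ : AEStronglyMeasurable (state u₀ u t) (volume.restrict U))
      (_ : ∫⁻ x in U, ‖state u₀ u s x‖ₑ ^ (δ + 1) ≠ ⊤)
      (_ : ∫⁻ x in U, ‖state u₀ u t x‖ₑ ^ (δ + 1) ≠ ⊤)
      (_ : KineticEquation m U f z u₀ u ν s t)
      {η R b : ℝ} (_ : 0 < η) (_ : 1 ≤ R) {S : Set (Space d)} (_ : MeasurableSet S) (_ : S ⊆ U)
      (_ : 0 ≤ b) {φ : Space d → ℝ} (_ : ContDiff ℝ ∞ φ) (_ : HasCompactSupport φ)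
      (_ : tsupport φ ⊆ U) (_ : ∀ x, φ x ∈ Icc (0 : ℝ) 1)
      (_ : ∀ x ∈ U, ‖iteratedFDeriv ℝ 1 φ x‖ + ‖iteratedFDeriv ℝ 2 φ x‖ ≤
        S.indicator (fun _ => b) x),
      (∀ x ∈ U, ∀ r ∈ Icc s t, |charExponent f z s r x| ≤ A) ∧
      AEMeasurable (fun y : Space d × ℝ × ℝ =>
        ENNReal.ofReal (φ y.1 * defectDensity δ η R y.2.1 (charExponent f z s y.2.2 y.1)))
        (ν.restrict (U ×ˢ univ ×ˢ Ioc s t)) ∧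
      AEMeasurable (fun y : Space d × ℝ =>
        ENNReal.ofReal (φ y.1 * (|chiBar (state u₀ u t y.1) y.2| *
          |expProfile δ η R y.2 (charExponent f z s t y.1)|))) (volume.restrict (U ×ˢ univ)) ∧
      ENNReal.ofReal (δ * Real.exp (-(2 * A))) * (∫⁻ y in U ×ˢ univ ×ˢ Ioc s t,
          ENNReal.ofReal (φ y.1 * defectDensity δ η R y.2.1 (charExponent f z s y.2.2 y.1)) ∂ν) +
        (∫⁻ y in U ×ˢ (univ : Set ℝ), ENNReal.ofReal (φ y.1 * (|chiBar (state u₀ u t y.1) y.2| *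
          |expProfile δ η R y.2 (charExponent f z s t y.1)|))) ≤
      ENNReal.ofReal K * (∫⁻ x in U, ‖state u₀ u s x‖ₑ ^ (δ + 1)) +
        (ENNReal.ofReal (B * τ) * (∫⁻ y in Ioc s t ×ˢ U, ‖u y.1 y.2‖ₑ ^ (m + δ)) +
          ENNReal.ofReal (B * b * η ^ (δ - 1)) * ∫⁻ y in Ioc s t ×ˢ S, ‖u y.1 y.2‖ₑ ^ (m + 1)) +
        ENNReal.ofReal K * ν (U ×ˢ univ ×ˢ Ioc s t ∩ {y | R * Real.exp (-A) ≤ |y.2.1|}) := by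
  obtain ⟨Λ, hΛ, hg⟩ := exists_bound_charExponent hU hf
  obtain ⟨K₁, hK₁, hH⟩ := exists_bound_expProfile (Λ * W)
  obtain ⟨B, hB, hLap⟩ := exists_bound_laplacian_transported hU hf hW
  obtain ⟨K₂, hK₂, hDef⟩ := exists_defect_bound (Λ * W)
  refine ⟨Λ * W, max K₁ K₂, B, by positivity, le_max_of_le_left hK₁, hB, ?_⟩
  intro z hz u₀ u ν s t τ δ hδ hs hst hτ0 hτW hτ hu hν hms hmt hfs hft hker η R b hη hR S hS hSU hb
    φ hφ hφc hφU hφ01 hφd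
  have hUm := hU.measurableSet
  have hgA : ∀ x ∈ U, ∀ r ∈ Icc s t, |charExponent f z s r x| ≤ Λ * W := by
    intro x hx r hr
    have := hg z s r τ (hτ r hr) x hx 0 (by norm_num)
    rw [norm_iteratedFDeriv_zero] at this
    exact this.trans (by gcongr)
  have hK : ∀ r ∈ Icc s t, ∀ x ∈ U, ∀ ξ, |expProfile δ η R ξ (charExponent f z s r x)| ≤
      K₁ * |ξ| ^ δ := by
    intro r hr x hx ξ
    have := (hH δ hδ η hη R hR ξ _ (hgA x hx r hr) 0 (by norm_num)).1
    rwa [norm_iteratedFDeriv_zero] at this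
  have hgc : ∀ r, ContinuousOn (charExponent f z s r) U := fun r =>
    (contDiffOn_charExponent hf z s r).continuousOn
  obtain ⟨hAt, hPt0, hPt, -⟩ := pairing_eq_lintegral hUm hmt (hgc t) hφ.continuous hφ01 hδ.1 hη hK₁
    (hK t (right_mem_Icc.2 hst.le)) hft
  obtain ⟨-, hPs0, hPs, hPs'⟩ := pairing_eq_lintegral hUm hms (hgc s) hφ.continuous hφ01 hδ.1 hη hK₁
    (hK s (left_mem_Icc.2 hst.le)) hfs
  have hE := hker (tensorTest φ δ η R) (contDiff_tensorTest hφ δ hη R)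
    (hasCompactSupport_tensorTest hφc δ η (by linarith))
    ((tsupport_tensorTest_subset φ δ η R).trans (prod_mono hφU (subset_univ _)))
  obtain ⟨hDm, J, hJ0, hJ, hJD⟩ := hDef hUm measurableSet_Ioc
    (g := fun r => charExponent f z s r) (continuousOn_charExponent hf hz hs)
    (fun x hx r hr => hgA x hx r (Ioc_subset_Icc_self hr)) hφ.continuous hφ01 hδ hη hR hν
  have hbη : 0 ≤ B * b * η ^ (δ - 1) := by positivity
  have hdiff := enorm_diffusion_le (L := fun y : Space d × ℝ × ℝ =>
      Laplacian.laplacian (fun x => transported f z (tensorTest φ δ η R) s y.2.2 x y.2.1) y.1)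
    hUm measurableSet_Ioc hS hSU (I := Ioc s t) (u := u)
    (hu.mono_measure (Measure.restrict_mono (prod_mono_left fun r hr => hs.trans_lt hr.1) le_rfl))
    hm hδ.1 (by positivity : 0 ≤ B * τ) hbη (fun y hy => by
      refine (hLap δ hδ η hη R hR φ hφ z s y.2.2 τ hτW (hτ _ (Ioc_subset_Icc_self hy.2.2)) hτ0 y.1
        hy.1 ?_ y.2.1).trans ?_
      · rw [abs_of_nonneg (hφ01 _).1]; exact (hφ01 _).2
      · calc _ ≤ B * (τ * |y.2.1| ^ δ) + B * (S.indicator (fun _ => b) y.1 *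
              (η ^ (δ - 1) * |y.2.1|)) := by
              gcongr
              exact hφd y.1 hy.1
          _ = _ := by
              by_cases h : y.1 ∈ S
              · rw [indicator_of_mem h, indicator_of_mem h]; ring
              · rw [indicator_of_notMem h, indicator_of_notMem h]; ring)
  refine ⟨hgA, hDm, hAt, ?_⟩
  simp only [kineticPairing, transported_tensorTest] at hE
  simp only [transported_tensorTest] at hdiff
  set Lr := ∫ y in U ×ˢ (univ : Set ℝ) ×ˢ Ioc s t,
    m * |y.2.1| ^ (m - 1) * chiBar (u y.2.2 y.1) y.2.1 *
      Laplacian.laplacian (fun x => φ x * expProfile δ η R y.2.1 (charExponent f z s y.2.2 x)) y.1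
    with hLr
  set Dr := ∫ y in U ×ˢ (univ : Set ℝ) ×ˢ Ioc s t,
    deriv (fun ξ => φ y.1 * expProfile δ η R ξ (charExponent f z s y.2.2 y.1)) y.2.1 ∂ν with hDr
  set Pt := ∫ y in U ×ˢ (univ : Set ℝ), chiBar (state u₀ u t y.1) y.2 *
    (φ y.1 * expProfile δ η R y.2 (charExponent f z s t y.1)) with hPtd
  set Ps := ∫ y in U ×ˢ (univ : Set ℝ), chiBar (state u₀ u s y.1) y.2 *
    (φ y.1 * expProfile δ η R y.2 (charExponent f z s s y.1)) with hPsd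
  set V := ν.real (U ×ˢ univ ×ˢ Ioc s t ∩ {y | R * Real.exp (-(Λ * W)) ≤ |y.2.1|}) with hV
  have hreal : δ * Real.exp (-(2 * (Λ * W))) * J + Pt ≤ Ps + |Lr| + K₂ * V := by
    linarith [le_abs_self Lr]
  have hδ0 := hδ.1
  rw [← hJ, ← hPt, ← ENNReal.ofReal_mul (by positivity), ← ENNReal.ofReal_add (by positivity) hPt0]
  refine (ENNReal.ofReal_le_ofReal hreal).trans ?_
  rw [ENNReal.ofReal_add (by positivity) (by positivity), ENNReal.ofReal_add hPs0 (abs_nonneg _),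
    ENNReal.ofReal_mul hK₂, hV, ofReal_measureReal (measure_ne_top_of_subset inter_subset_left hν)]
  gcongr
  · rw [hPs]
    refine hPs'.trans ?_
    gcongr
    exact le_max_left _ _
  · rw [← Real.norm_eq_abs, ofReal_norm]
    exact hdiff
  · exact le_max_right _ _

/-! ### Integration in time of spatial inequalities -/

/-- The `L²` norm of `u^{[(m+1)/2]}` is an `L^{m+1}` norm of `u`. -/
lemma enorm_signedPow_sq {m : ℝ} (hm : 0 < m) (r : ℝ) :
    ‖signedPow ((m + 1) / 2) r‖ₑ ^ 2 = ‖r‖ₑ ^ (m + 1) := by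
  rcases eq_or_ne r 0 with rfl | hr
  · rw [signedPow, mul_zero, enorm_zero, ENNReal.zero_rpow_of_pos (by linarith)]
    simp
  · have hr0 : 0 < |r| := abs_pos.2 hr
    rw [← ofReal_abs_rpow (by linarith), ← ofReal_norm, ← ENNReal.ofReal_pow (norm_nonneg _)]
    congr 1
    rw [signedPow, Real.norm_eq_abs, abs_mul, abs_of_nonneg (Real.rpow_nonneg hr0.le _)]
    nth_rewrite 2 [← Real.rpow_one |r|]
    rw [← Real.rpow_add hr0, ← Real.rpow_natCast, ← Real.rpow_mul hr0.le]
    congr 1; push_cast; ring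

lemma IsL2H10Gradient.aestronglyMeasurable_section {d : ℕ} {U : Set (Space d)}
    {w : ℝ → Space d → ℝ} {G : ℝ → Space d → Space d} (h : IsL2H10Gradient U w G) :
    ∀ᵐ t ∂(volume.restrict (Ioi (0 : ℝ))), IsH10Pair U (w t) (G t) ∧
      AEStronglyMeasurable (w t) (volume.restrict U) ∧
      AEStronglyMeasurable (G t) (volume.restrict U) := by
  have h1 := h.aestronglyMeasurable
  have h2 := h.aestronglyMeasurable_grad
  rw [Measure.volume_eq_prod, ← Measure.prod_restrict] at h1 h2
  filter_upwards [h.mem_H10, h1.prodMk_left, h2.prodMk_left] with t a b c using ⟨a, b, c⟩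

/-- A spatial inequality for functions of class `H¹₀` integrates in time. -/
lemma IsL2H10Gradient.lintegral_le {d : ℕ} {m : ℝ} (hm : 0 < m) {U A B : Set (Space d)}
    (hAU : A ⊆ U) (hBU : B ⊆ U) {I : Set ℝ} (hI : I ⊆ Ioi 0) {c : ENNReal}
    (hc : c ≠ ⊤)
    (hsp : ∀ (w : Space d → ℝ) (g : Space d → Space d),
      IsH10Pair U w g → AEStronglyMeasurable w (volume.restrict U) →
      AEStronglyMeasurable g (volume.restrict U) →
      ∫⁻ x in A, ‖w x‖ₑ ^ 2 ≤ c * ∫⁻ x in B, ‖g x‖ₑ ^ 2)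
    {u : ℝ → Space d → ℝ} {G : ℝ → Space d → Space d} (h : IsL2H10Gradient U (halfPow m u) G) :
    ∫⁻ y in I ×ˢ A, ‖u y.1 y.2‖ₑ ^ (m + 1) ≤ c * ∫⁻ y in I ×ˢ B, ‖G y.1 y.2‖ₑ ^ 2 := by
  have h1 : AEMeasurable (fun y : ℝ × Space d => ‖halfPow m u y.1 y.2‖ₑ ^ 2)
      (volume.restrict (I ×ˢ A)) :=
    (h.aestronglyMeasurable.mono_measure
      (Measure.restrict_mono (prod_mono hI hAU) le_rfl)).enorm.pow_const 2
  have h2 : AEMeasurable (fun y : ℝ × Space d => ‖G y.1 y.2‖ₑ ^ 2)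
      (volume.restrict (I ×ˢ B)) :=
    (h.aestronglyMeasurable_grad.mono_measure
      (Measure.restrict_mono (prod_mono hI hBU) le_rfl)).enorm.pow_const 2
  have h3 : ∀ y : ℝ × Space d, ‖u y.1 y.2‖ₑ ^ (m + 1) = ‖halfPow m u y.1 y.2‖ₑ ^ 2 := fun y =>
    (enorm_signedPow_sq hm _).symm
  simp_rw [h3]
  rw [Measure.volume_eq_prod] at h1 h2 ⊢
  rw [setLIntegral_prod _ h1, setLIntegral_prod _ h2, ← lintegral_const_mul' _ _ hc]
  refine lintegral_mono_ae ?_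
  have hae := ae_mono (Measure.restrict_mono hI le_rfl) h.aestronglyMeasurable_section
  filter_upwards [hae] with t ht using hsp _ _ ht.1 ht.2.1 ht.2.2

lemma IsL2H10Gradient.lintegral_gradient_lt_top {d : ℕ} {U : Set (Space d)}
    {w : ℝ → Space d → ℝ} {G : ℝ → Space d → Space d} (h : IsL2H10Gradient U w G) {s t : ℝ}
    (hs : 0 ≤ s) (hst : s < t) : ∫⁻ y in Ioc s t ×ˢ U, ‖G y.1 y.2‖ₑ ^ 2 < ⊤ := by
  have h2 : AEMeasurable (fun y : ℝ × Space d => ‖G y.1 y.2‖ₑ ^ 2)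
      (volume.restrict (Ioc s t ×ˢ U)) :=
    (h.aestronglyMeasurable_grad.mono_measure (Measure.restrict_mono
      (prod_mono_left fun r hr => hs.trans_lt hr.1) le_rfl)).enorm.pow_const 2
  rw [Measure.volume_eq_prod] at h2 ⊢
  rw [setLIntegral_prod _ h2]
  refine lt_of_le_of_lt ?_ (h.lintegral_lt_top t (hs.trans_lt hst))
  refine (lintegral_mono_set (Ioc_subset_Ioc_left hs)).trans (lintegral_mono fun r => ?_)
  rw [lintegral_enorm_sq_eq]
  exact le_add_self

/-- The integral over the boundary layer vanishes with its width. -/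
lemma tendsto_lintegral_layer {d : ℕ} {U : Set (Space d)} (hU : IsOpen U)
    (hb : Bornology.IsBounded U) (hne : Uᶜ.Nonempty) {s t : ℝ} {F : ℝ × Space d → ENNReal}
    (hF : ∫⁻ y in Ioc s t ×ˢ U, F y ≠ ⊤) :
    Tendsto (fun ε => ∫⁻ y in Ioc s t ×ˢ boundaryLayer U ε, F y) (𝓝[>] 0) (𝓝 0) := by
  have hm : ∀ ε, MeasurableSet (Ioc s t ×ˢ boundaryLayer U ε) := fun ε =>
    measurableSet_Ioc.prod (measurableSet_boundaryLayer hU ε)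
  have h0 : Tendsto (fun ε => volume (Ioc s t ×ˢ boundaryLayer U ε)) (𝓝[>] 0) (𝓝 0) := by
    have hinter : ⋂ ε > (0 : ℝ), Ioc s t ×ˢ boundaryLayer U ε = ∅ := by
      refine eq_empty_of_forall_notMem fun y hy => ?_
      simp only [mem_iInter, mem_prod] at hy
      have hyU := (hy 1 one_pos).2.1
      have hpos : 0 < Metric.infDist y.2 Uᶜ :=
        (hU.isClosed_compl.notMem_iff_infDist_pos hne).1 (fun h => h hyU)
      exact lt_irrefl _ (hy _ hpos).2.2
    have := tendsto_measure_biInter_gt (μ := (volume : Measure (ℝ × Space d)))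
      (s := fun ε => Ioc s t ×ˢ boundaryLayer U ε) (a := (0 : ℝ))
      (fun ε _ => (hm ε).nullMeasurableSet)
      (fun i j _ hij => prod_mono_right fun x hx => ⟨hx.1, hx.2.trans_le hij⟩)
      ⟨1, one_pos, by
        rw [Measure.volume_eq_prod, Measure.prod_prod]
        exact ENNReal.mul_ne_top (by simp)
          ((hb.subset (boundaryLayer_subset U 1)).measure_lt_top.ne)⟩
    rw [hinter, measure_empty] at this
    exact this
  have hsub : ∀ ε, Ioc s t ×ˢ boundaryLayer U ε ⊆ Ioc s t ×ˢ U := fun ε =>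
    prod_mono_right (boundaryLayer_subset U ε)
  have := tendsto_setLIntegral_zero (μ := volume.restrict (Ioc s t ×ˢ U)) hF
    (s := fun ε => Ioc s t ×ˢ boundaryLayer U ε) (l := 𝓝[>] 0) (by
      simp only [Function.comp_def, Measure.restrict_apply (hm _), inter_eq_left.2 (hsub _)]
      exact h0)
  simpa only [Measure.restrict_restrict (hm _), inter_eq_left.2 (hsub _)] using this

/-! ### The entropy estimate -/

/-- Fatou's lemma for a convergent sequence of integrands with a convergent upper bound. -/
lemma lintegral_le_of_tendsto_of_le {α : Type*} [MeasurableSpace α] {μ : Measure α}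
    {F : ℕ → α → ENNReal} {f : α → ENNReal} {r : ℕ → ENNReal} {l : ENNReal}
    (hF : ∀ N, AEMeasurable (F N) μ) (hlim : ∀ᵐ x ∂μ, Tendsto (fun N => F N x) atTop (𝓝 (f x)))
    (hle : ∀ N, ∫⁻ x, F N x ∂μ ≤ r N) (hr : Tendsto r atTop (𝓝 l)) : ∫⁻ x, f x ∂μ ≤ l := by
  calc ∫⁻ x, f x ∂μ = ∫⁻ x, liminf (fun N => F N x) atTop ∂μ :=
        lintegral_congr_ae (hlim.mono fun x hx => hx.liminf_eq.symm)
    _ ≤ liminf (fun N => ∫⁻ x, F N x ∂μ) atTop := lintegral_liminf_le' hF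
    _ ≤ liminf r atTop := liminf_le_liminf (Eventually.of_forall hle)
    _ = l := hr.liminf_eq

lemma eventually_lineBump_eq_one {R : ℕ → ℝ} (hR : Tendsto R atTop atTop) (ζ : ℝ) :
    ∀ᶠ N in atTop, lineBump (ζ / R N) = 1 := by
  filter_upwards [hR.eventually_ge_atTop |ζ|, hR.eventually_gt_atTop 0] with N h1 h2
  refine lineBump.one_of_mem_closedBall ?_
  rw [mem_closedBall_zero_iff, Real.norm_eq_abs, abs_div, abs_of_pos h2]
  exact (div_le_one h2).2 h1

lemma tendsto_abs_regPow {δ : ℝ} (hδ : 0 < δ) {η : ℕ → ℝ} (hη : Tendsto η atTop (𝓝 0)) (ζ : ℝ) :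
    Tendsto (fun N => |regPow δ (η N) ζ|) atTop (𝓝 (|ζ| ^ δ)) := by
  simp_rw [abs_regPow]
  rcases eq_or_ne ζ 0 with rfl | hζ
  · simp [Real.zero_rpow hδ.ne']
  have hζ0 : 0 < |ζ| := abs_pos.2 hζ
  have h1 : Tendsto (fun N => ζ ^ 2 + η N ^ 2) atTop (𝓝 (ζ ^ 2)) := by
    simpa using (hη.pow 2).const_add (ζ ^ 2)
  have h2 : |ζ| ^ δ = |ζ| * (ζ ^ 2) ^ ((δ - 1) / 2) := by
    rw [← sq_abs, ← Real.rpow_natCast, ← Real.rpow_mul hζ0.le]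
    nth_rewrite 2 [← Real.rpow_one |ζ|]
    rw [← Real.rpow_add hζ0]
    congr 1; push_cast; ring
  rw [h2]
  exact (h1.rpow_const (Or.inl (by positivity))).const_mul _

lemma tendsto_abs_expProfile {δ : ℝ} (hδ : 0 < δ) {η R : ℕ → ℝ} (hη : Tendsto η atTop (𝓝 0))
    (hR : Tendsto R atTop atTop) (ξ a : ℝ) :
    Tendsto (fun N => |expProfile δ (η N) (R N) ξ a|) atTop
      (𝓝 (|ξ * Real.exp (-a)| ^ δ * Real.exp (-a))) := by
  refine ((tendsto_abs_regPow hδ hη (ξ * Real.exp (-a))).mul_const (Real.exp (-a))).congr' ?_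
  filter_upwards [eventually_lineBump_eq_one hR (ξ * Real.exp (-a))] with N hN
  rw [expProfile, profile, hN, one_mul, abs_mul, Real.abs_exp]

lemma tendsto_ofReal_defectDensity (δ : ℝ) {η R : ℕ → ℝ} (hη0 : ∀ N, 0 < η N)
    (hη : Tendsto η atTop (𝓝 0)) (hR : Tendsto R atTop atTop) (ξ a : ℝ) :
    Tendsto (fun N => ENNReal.ofReal (defectDensity δ (η N) (R N) ξ a)) atTop
      (𝓝 (ENNReal.ofReal |ξ * Real.exp (-a)| ^ (δ - 1))) := by
  set ζ := ξ * Real.exp (-a) with hζ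
  have h1 : Tendsto (fun N => ENNReal.ofReal (ζ ^ 2 + η N ^ 2)) atTop
      (𝓝 (ENNReal.ofReal (ζ ^ 2))) := by
    refine ENNReal.tendsto_ofReal ?_
    simpa using (hη.pow 2).const_add (ζ ^ 2)
  have h2 := (ENNReal.continuous_rpow_const (y := (δ - 1) / 2)).continuousAt.tendsto.comp h1
  have h3 : ENNReal.ofReal |ζ| ^ (δ - 1) = ENNReal.ofReal (ζ ^ 2) ^ ((δ - 1) / 2) := by
    rw [← sq_abs, ENNReal.ofReal_pow (abs_nonneg _), ← ENNReal.rpow_natCast, ← ENNReal.rpow_mul]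
    congr 1; push_cast; ring
  rw [h3]
  refine h2.congr' ?_
  filter_upwards [eventually_lineBump_eq_one hR ζ] with N hN
  have := hη0 N
  rw [Function.comp, defectDensity, ← hζ, hN, one_mul, ENNReal.ofReal_rpow_of_pos (by positivity)]

/-- A measure that is finite on `E` puts no mass at infinite velocity. -/
lemma tendsto_tail_measure {d : ℕ} {ν : Measure (Space d × ℝ × ℝ)} {E : Set (Space d × ℝ × ℝ)}
    (hE : MeasurableSet E) (hν : ν E ≠ ⊤) {c : ℝ} (hc : 0 < c) :
    Tendsto (fun N : ℕ => ν (E ∩ {y | ((N : ℝ) + 1) * c ≤ |y.2.1|})) atTop (𝓝 0) := by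
  have hm : ∀ N : ℕ, MeasurableSet (E ∩ {y : Space d × ℝ × ℝ | ((N : ℝ) + 1) * c ≤ |y.2.1|}) :=
    fun N => hE.inter (measurableSet_le measurable_const (by fun_prop))
  have hinter : ⋂ N : ℕ, E ∩ {y : Space d × ℝ × ℝ | ((N : ℝ) + 1) * c ≤ |y.2.1|} = ∅ := by
    refine eq_empty_of_forall_notMem fun y hy => ?_
    obtain ⟨N, hN⟩ := exists_nat_gt (|y.2.1| / c)
    have h1 : ((N : ℝ) + 1) * c ≤ |y.2.1| := (mem_iInter.1 hy N).2
    rw [div_lt_iff₀ hc] at hN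
    nlinarith
  have := tendsto_measure_iInter_atTop (μ := ν) (fun N => (hm N).nullMeasurableSet)
    (fun i j hij => inter_subset_inter_right _ fun y (hy : ((j : ℝ) + 1) * c ≤ |y.2.1|) => by
      have : (i : ℝ) ≤ j := by exact_mod_cast hij
      change ((i : ℝ) + 1) * c ≤ |y.2.1|
      nlinarith)
    ⟨0, measure_ne_top_of_subset inter_subset_left hν⟩
  rw [hinter, measure_empty] at this
  exact this

lemma rpow_le_mul_rpow_of_le_mul {x y c : ENNReal} (hc1 : 1 ≤ c) (hc : c ≠ ⊤) (hx : x ≠ ⊤)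
    {δ : ℝ} (hδ : δ ∈ Ioc (0 : ℝ) 1) (hy : y ≤ c * x) : x ^ (δ - 1) ≤ c * y ^ (δ - 1) := by
  have hc0 : c ≠ 0 := (zero_lt_one.trans_le hc1).ne'
  calc x ^ (δ - 1) ≤ c ^ δ * x ^ (δ - 1) :=
        le_mul_of_one_le_left' (ENNReal.one_le_rpow hc1 hδ.1)
    _ = c * (c * x) ^ (δ - 1) := by
        rw [ENNReal.mul_rpow_of_ne_top hc hx, ← mul_assoc]
        congr 1
        nth_rewrite 2 [← ENNReal.rpow_one c]
        rw [← ENNReal.rpow_add _ _ hc0 hc]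
        congr 1; ring
    _ ≤ c * y ^ (δ - 1) := by
        gcongr 1
        rw [← neg_sub 1 δ, ENNReal.rpow_neg, ENNReal.rpow_neg]
        exact ENNReal.inv_le_inv.2 (ENNReal.rpow_le_rpow hy (by linarith [hδ.2]))

/-- The entropy estimate on a time interval: the `L^{1+δ}` norm at the final time and the singular
moment of the defect measure are controlled by the `L^{1+δ}` norm at the initial time, and by the
diffusion term times the oscillation of the driving signal. -/
lemma exists_entropy_estimate {d n : ℕ} {m : ℝ} (hm : 0 < m) {U : Set (Space d)}
    (hU : IsSmoothBoundedOpen U) (hne : Uᶜ.Nonempty) {f : Fin n → Space d → ℝ}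
    (hf : ∀ k, IsCb2 U (f k)) {W : ℝ} (hW : 0 ≤ W) {δ : ℝ} (hδ : δ ∈ Ioc (0 : ℝ) 1) :
    ∃ B : ℝ, 0 < B ∧ ∀ {z : ℝ → Fin n → ℝ} (_ : ContinuousOn z (Ici 0))
      {u₀ : Space d → ℝ} {u : ℝ → Space d → ℝ} {G : ℝ → Space d → Space d}
      {ν : Measure (Space d × ℝ × ℝ)} {s t τ : ℝ}
      (_ : 0 ≤ s) (_ : s < t) (_ : 0 ≤ τ) (_ : τ ≤ W)
      (_ : ∀ r ∈ Icc s t, ∀ k, |z r k - z s k| ≤ τ)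
      (_ : AEStronglyMeasurable (fun y : ℝ × Space d => u y.1 y.2)
        (volume.restrict (Ioi (0 : ℝ) ×ˢ U)))
      (_ : IsL2H10Gradient U (halfPow m u) G)
      (_ : ν (U ×ˢ univ ×ˢ Ioc s t) ≠ ⊤)
      (_ : AEStronglyMeasurable (state u₀ u s) (volume.restrict U))
      (_ : AEStronglyMeasurable (state u₀ u t) (volume.restrict U))
      (_ : ∫⁻ x in U, ‖state u₀ u s x‖ₑ ^ (δ + 1) ≠ ⊤)
      (_ : ∫⁻ x in U, ‖state u₀ u t x‖ₑ ^ (δ + 1) ≠ ⊤)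
      (_ : KineticEquation m U f z u₀ u ν s t),
      (∫⁻ x in U, ‖state u₀ u t x‖ₑ ^ (δ + 1)) +
          (∫⁻ y in U ×ˢ univ ×ˢ Ioc s t, ENNReal.ofReal |y.2.1| ^ (δ - 1) ∂ν) ≤
        ENNReal.ofReal B * ((∫⁻ x in U, ‖state u₀ u s x‖ₑ ^ (δ + 1)) +
          ENNReal.ofReal τ * ∫⁻ y in Ioc s t ×ˢ U, ‖u y.1 y.2‖ₑ ^ (m + δ)) := by
  obtain ⟨A, K, B, hA, hK, hB, hreg⟩ := exists_regularized_inequality hm hU.isOpen hf hW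
  obtain ⟨Cφ, hCφ, hcut⟩ := exists_cutoff hU.isBounded
  obtain ⟨CL, ε₀, hε₀, hlayer⟩ := hU.exists_layer_poincare hne
  obtain ⟨hδ0, hδ1⟩ := hδ
  set c₁ := (δ + 1) * Real.exp (2 * A) with hc₁
  set c₂ := Real.exp A * (δ * Real.exp (-(2 * A)))⁻¹ with hc₂
  have hc₁0 : 0 < c₁ := by positivity
  have hc₂0 : 0 < c₂ := by positivity
  refine ⟨(c₁ + c₂) * (K + B + 1), by positivity, ?_⟩
  intro z hz u₀ u G ν s t τ hs hst hτ0 hτW hτ hu hG hν hms hmt hfs hft hker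
  have hUo := hU.isOpen
  have hEm : MeasurableSet (U ×ˢ (univ : Set ℝ) ×ˢ Ioc s t) :=
    hUo.measurableSet.prod (MeasurableSet.univ.prod measurableSet_Ioc)
  set X := ∫⁻ x in U, ‖state u₀ u s x‖ₑ ^ (δ + 1) with hX
  set Y := ∫⁻ y in Ioc s t ×ˢ U, ‖u y.1 y.2‖ₑ ^ (m + δ) with hY
  let η : ℕ → ℝ := fun N => 1 / ((N : ℝ) + 1)
  let R : ℕ → ℝ := fun N => (N : ℝ) + 1
  have hη0 : ∀ N, 0 < η N := fun N => by positivity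
  have hηlim : Tendsto η atTop (𝓝 0) := tendsto_one_div_add_atTop_nhds_zero_nat
  have hR1 : ∀ N, 1 ≤ R N := fun N => le_add_of_nonneg_left (Nat.cast_nonneg N)
  have hRlim : Tendsto R atTop atTop :=
    tendsto_atTop_add_const_right _ _ tendsto_natCast_atTop_atTop
  -- The width of the cutoff layer is chosen after `η`. The factor `ε⁻²` from the second derivative
  -- of the cutoff cancels with the factor `ε²` in the layer inequality, so that the error is a
  -- multiple of the gradient energy in the layer, which vanishes with `ε` even after multiplication
  -- by `η^(δ-1)`.
  have hε : ∀ N : ℕ, ∃ ε, 0 < ε ∧ ε ≤ 1 ∧ ε ≤ η N ∧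
      ENNReal.ofReal (B * (2 * (Cφ / ε ^ 2)) * η N ^ (δ - 1)) *
        (∫⁻ y in Ioc s t ×ˢ boundaryLayer U ε, ‖u y.1 y.2‖ₑ ^ (m + 1)) ≤
        ENNReal.ofReal (η N) := by
    intro N
    have hlim0 := tendsto_lintegral_layer hUo hU.isBounded hne
      (hG.lintegral_gradient_lt_top hs hst).ne
    have h4 : Tendsto (fun ε : ℝ => 4 * ε) (𝓝[>] 0) (𝓝[>] 0) := by
      refine tendsto_nhdsWithin_iff.2 ⟨?_, ?_⟩
      · have : Tendsto (fun ε : ℝ => 4 * ε) (𝓝 0) (𝓝 (4 * 0)) :=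
          (continuous_const.mul continuous_id).tendsto 0
        rw [mul_zero] at this
        exact this.mono_left nhdsWithin_le_nhds
      · filter_upwards [self_mem_nhdsWithin] with ε (hε : 0 < ε)
        change 0 < 4 * ε
        positivity
    have hlim1 := ENNReal.Tendsto.const_mul
      (a := ENNReal.ofReal (B * (2 * Cφ) * η N ^ (δ - 1)) * CL) (hlim0.comp h4)
      (Or.inr (ENNReal.mul_ne_top ENNReal.ofReal_ne_top (ENNReal.natCast_ne_top CL)))
    rw [mul_zero] at hlim1
    have hpos : 0 < ENNReal.ofReal (η N) := ENNReal.ofReal_pos.2 (hη0 N)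
    have hmem : Ioo 0 (min ε₀ (min 1 (η N))) ∈ 𝓝[>] (0 : ℝ) :=
      Ioo_mem_nhdsGT (lt_min hε₀ (lt_min one_pos (hη0 N)))
    obtain ⟨ε, hεlt, hεm⟩ := ((hlim1.eventually (ge_mem_nhds hpos)).and hmem).exists
    have hε1 := hεm.2.trans_le (min_le_left _ _)
    have hε2 := hεm.2.trans_le ((min_le_right _ _).trans (min_le_left _ _))
    have hε3 := hεm.2.trans_le ((min_le_right _ _).trans (min_le_right _ _))
    have hε0 := hεm.1
    refine ⟨ε, hε0, hε2.le, hε3.le, le_trans ?_ hεlt⟩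
    have hl := hG.lintegral_le hm (boundaryLayer_subset U ε) (boundaryLayer_subset U (4 * ε))
      (I := Ioc s t) (fun r hr => hs.trans_lt hr.1)
      (ENNReal.mul_ne_top (ENNReal.natCast_ne_top CL) ENNReal.ofReal_ne_top)
      (hlayer ε ⟨hε0, hε1⟩)
    have hηδ : 0 < η N ^ (δ - 1) := Real.rpow_pos_of_pos (hη0 N) _
    calc _ ≤ ENNReal.ofReal (B * (2 * (Cφ / ε ^ 2)) * η N ^ (δ - 1)) *
          (CL * ENNReal.ofReal (ε ^ 2) *
            ∫⁻ y in Ioc s t ×ˢ boundaryLayer U (4 * ε), ‖G y.1 y.2‖ₑ ^ 2) := by gcongr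
      _ = (ENNReal.ofReal (B * (2 * (Cφ / ε ^ 2)) * η N ^ (δ - 1)) * ENNReal.ofReal (ε ^ 2)) * CL *
            ∫⁻ y in Ioc s t ×ˢ boundaryLayer U (4 * ε), ‖G y.1 y.2‖ₑ ^ 2 := by ring
      _ = _ := by
        rw [← ENNReal.ofReal_mul (by positivity)]
        congr 3
        field_simp
  choose ε hε0 hε1 hεη hεerr using hε
  choose φ hφs hφc hφU hφ01 hφ1 hφd0 hφd using fun N => hcut (ε N) ⟨hε0 N, hε1 N⟩
  have hind : ∀ N, ∀ x ∈ U, ‖iteratedFDeriv ℝ 1 (φ N) x‖ + ‖iteratedFDeriv ℝ 2 (φ N) x‖ ≤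
      (boundaryLayer U (ε N)).indicator (fun _ => 2 * (Cφ / ε N ^ 2)) x := by
    intro N x hx
    by_cases h : x ∈ boundaryLayer U (ε N)
    · rw [indicator_of_mem h]
      linarith [hφd N 1 (by norm_num) x, hφd N 2 le_rfl x]
    · have hle : ε N ≤ Metric.infDist x Uᶜ := not_lt.1 fun h' => h ⟨hx, h'⟩
      rw [indicator_of_notMem h, hφd0 N 1 one_ne_zero x hle, hφd0 N 2 two_ne_zero x hle]
      simp
  have hN := fun N => hreg hz ⟨hδ0, hδ1⟩ hs hst hτ0 hτW hτ hu hν hms hmt hfs hft hker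
    (hη0 N) (hR1 N)
    (measurableSet_boundaryLayer hUo (ε N)) (boundaryLayer_subset U (ε N))
    (b := 2 * (Cφ / ε N ^ 2)) (by positivity) (hφs N) (hφc N) (hφU N) (hφ01 N) (hind N)
  have hgA : ∀ x ∈ U, ∀ r ∈ Icc s t, |charExponent f z s r x| ≤ A := (hN 0).1
  set rhs := ENNReal.ofReal K * X + (ENNReal.ofReal (B * τ) * Y + 0) + ENNReal.ofReal K * 0
    with hrhs
  let r : ℕ → ENNReal := fun N => ENNReal.ofReal K * X +
    (ENNReal.ofReal (B * τ) * Y + ENNReal.ofReal (η N)) +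
    ENNReal.ofReal K * ν (U ×ˢ univ ×ˢ Ioc s t ∩ {y | R N * Real.exp (-A) ≤ |y.2.1|})
  have hr : Tendsto r atTop (𝓝 rhs) := by
    refine Tendsto.add (Tendsto.add tendsto_const_nhds (Tendsto.add tendsto_const_nhds ?_)) ?_
    · simpa using ENNReal.tendsto_ofReal hηlim
    · exact ENNReal.Tendsto.const_mul (tendsto_tail_measure hEm hν (Real.exp_pos _))
        (Or.inr ENNReal.ofReal_ne_top)
  have hle : ∀ N, _ ≤ r N := fun N => (hN N).2.2.2.trans (by
    simp only [r]
    gcongr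
    exact hεerr N)
  -- At an interior point the cutoff is eventually equal to one.
  have hφev : ∀ x ∈ U, ∀ᶠ N in atTop, φ N x = 1 := by
    intro x hx
    have hpos : 0 < Metric.infDist x Uᶜ :=
      (hUo.isClosed_compl.notMem_iff_infDist_pos hne).1 (fun h => h hx)
    filter_upwards [hηlim.eventually (ge_mem_nhds hpos)] with N hN
    exact hφ1 N x ((hεη N).trans hN)
  have hUuniv : MeasurableSet (U ×ˢ (univ : Set ℝ)) := hUo.measurableSet.prod MeasurableSet.univ
  have hmain1 : ∫⁻ y in U ×ˢ (univ : Set ℝ), ENNReal.ofReal (|chiBar (state u₀ u t y.1) y.2| *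
      (|y.2 * Real.exp (-charExponent f z s t y.1)| ^ δ * Real.exp (-charExponent f z s t y.1))) ≤
      rhs := by
    refine lintegral_le_of_tendsto_of_le (fun N => (hN N).2.2.1) ?_
      (fun N => le_trans le_add_self (hle N)) hr
    filter_upwards [ae_restrict_mem hUuniv] with y hy
    have h1 := ENNReal.tendsto_ofReal ((tendsto_abs_expProfile hδ0 hηlim hRlim y.2
      (charExponent f z s t y.1)).const_mul |chiBar (state u₀ u t y.1) y.2|)
    refine h1.congr' ?_
    filter_upwards [hφev y.1 hy.1] with N hN
    rw [hN, one_mul]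
  have hmain2 : ∫⁻ y in U ×ˢ (univ : Set ℝ) ×ˢ Ioc s t, ENNReal.ofReal (δ * Real.exp (-(2 * A))) *
      ENNReal.ofReal |y.2.1 * Real.exp (-charExponent f z s y.2.2 y.1)| ^ (δ - 1) ∂ν ≤ rhs := by
    refine lintegral_le_of_tendsto_of_le (fun N => (hN N).2.1.const_mul
      (ENNReal.ofReal (δ * Real.exp (-(2 * A))))) ?_
      (fun N => ?_) hr
    · filter_upwards [ae_restrict_mem hEm] with y hy
      refine ENNReal.Tendsto.const_mul ?_ (Or.inr ENNReal.ofReal_ne_top)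
      refine (tendsto_ofReal_defectDensity δ hη0 hηlim hRlim y.2.1
        (charExponent f z s y.2.2 y.1)).congr' ?_
      filter_upwards [hφev y.1 hy.1] with N hN
      rw [hN, one_mul]
    · rw [lintegral_const_mul' _ _ ENNReal.ofReal_ne_top]
      exact le_trans le_self_add (hle N)
  rw [lintegral_const_mul' _ _ ENNReal.ofReal_ne_top] at hmain2
  have hpart1 : ∫⁻ x in U, ‖state u₀ u t x‖ₑ ^ (δ + 1) ≤ ENNReal.ofReal c₁ * rhs := by
    have h1 := lintegral_moment_space hmt (a := δ) (by linarith)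
    have h2 : ∫⁻ y in U ×ˢ (univ : Set ℝ),
        ENNReal.ofReal (|y.2| ^ δ * |chiBar (state u₀ u t y.1) y.2|) ≤
        ENNReal.ofReal (Real.exp (2 * A)) * rhs := by
      refine le_trans ?_ (mul_le_mul_right hmain1 _)
      rw [← lintegral_const_mul' _ _ ENNReal.ofReal_ne_top]
      refine setLIntegral_mono' hUuniv fun y hy => ?_
      rw [← ENNReal.ofReal_mul (by positivity)]
      refine ENNReal.ofReal_le_ofReal ?_
      have ha := abs_le.1 (hgA y.1 hy.1 t (right_mem_Icc.2 hst.le))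
      set a := charExponent f z s t y.1 with had
      have hexp : Real.exp (-A) ≤ Real.exp (-a) := Real.exp_le_exp.2 (by linarith)
      have h3 : Real.exp (-A) * |y.2| ^ δ ≤ |y.2 * Real.exp (-a)| ^ δ := by
        rw [abs_mul, Real.abs_exp, Real.mul_rpow (abs_nonneg _) (Real.exp_nonneg _), mul_comm]
        gcongr
        calc Real.exp (-A) ≤ Real.exp (-A) ^ δ :=
              Real.self_le_rpow_of_le_one (Real.exp_nonneg _)
                (Real.exp_le_one_iff.2 (by linarith)) hδ1
          _ ≤ _ := Real.rpow_le_rpow (Real.exp_nonneg _) hexp hδ0.le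
      calc |y.2| ^ δ * |chiBar (state u₀ u t y.1) y.2| =
            Real.exp (2 * A) * (|chiBar (state u₀ u t y.1) y.2| *
              (Real.exp (-A) * |y.2| ^ δ * Real.exp (-A))) := by
            have : Real.exp (2 * A) * (Real.exp (-A) * Real.exp (-A)) = 1 := by
              rw [← Real.exp_add, ← Real.exp_add, Real.exp_eq_one_iff]; ring
            linear_combination (-(|chiBar (state u₀ u t y.1) y.2| * |y.2| ^ δ)) * this
        _ ≤ _ := by gcongr
    calc ∫⁻ x in U, ‖state u₀ u t x‖ₑ ^ (δ + 1) = ENNReal.ofReal (δ + 1) *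
          (ENNReal.ofReal (1 / (δ + 1)) * ∫⁻ x in U, ‖state u₀ u t x‖ₑ ^ (δ + 1)) := by
          rw [← mul_assoc, ← ENNReal.ofReal_mul (by positivity), mul_one_div_cancel (by positivity),
            ENNReal.ofReal_one, one_mul]
      _ ≤ ENNReal.ofReal (δ + 1) * (ENNReal.ofReal (Real.exp (2 * A)) * rhs) := by
          rw [← h1]; gcongr
      _ = _ := by rw [← mul_assoc, ← ENNReal.ofReal_mul (by positivity)]
  have hpart2 : ∫⁻ y in U ×ˢ univ ×ˢ Ioc s t, ENNReal.ofReal |y.2.1| ^ (δ - 1) ∂ν ≤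
      ENNReal.ofReal c₂ * rhs := by
    have hδe : 0 < δ * Real.exp (-(2 * A)) := by positivity
    calc ∫⁻ y in U ×ˢ univ ×ˢ Ioc s t, ENNReal.ofReal |y.2.1| ^ (δ - 1) ∂ν
        ≤ ∫⁻ y in U ×ˢ univ ×ˢ Ioc s t, ENNReal.ofReal (Real.exp A) *
          ENNReal.ofReal |y.2.1 * Real.exp (-charExponent f z s y.2.2 y.1)| ^ (δ - 1) ∂ν := by
          refine setLIntegral_mono' hEm fun y hy => ?_
          refine rpow_le_mul_rpow_of_le_mul (ENNReal.one_le_ofReal.2 (Real.one_le_exp hA))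
            ENNReal.ofReal_ne_top ENNReal.ofReal_ne_top ⟨hδ0, hδ1⟩ ?_
          rw [← ENNReal.ofReal_mul (Real.exp_nonneg _), abs_mul, Real.abs_exp, mul_comm]
          refine ENNReal.ofReal_le_ofReal ?_
          gcongr
          exact (neg_le_abs _).trans (hgA y.1 hy.1 y.2.2 (Ioc_subset_Icc_self hy.2.2))
      _ = ENNReal.ofReal c₂ * (ENNReal.ofReal (δ * Real.exp (-(2 * A))) *
          ∫⁻ y in U ×ˢ univ ×ˢ Ioc s t,
            ENNReal.ofReal |y.2.1 * Real.exp (-charExponent f z s y.2.2 y.1)| ^ (δ - 1) ∂ν) := by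
          rw [lintegral_const_mul' _ _ ENNReal.ofReal_ne_top, ← mul_assoc, hc₂,
            ← ENNReal.ofReal_mul (by positivity), inv_mul_cancel_right₀ hδe.ne']
      _ ≤ _ := by gcongr
  have hrhs_le : rhs ≤ ENNReal.ofReal (K + B + 1) * (X + ENNReal.ofReal τ * Y) := by
    rw [hrhs, add_zero, mul_zero, add_zero, ENNReal.ofReal_mul hB, mul_add, mul_assoc]
    gcongr <;> linarith
  calc _ ≤ ENNReal.ofReal c₁ * rhs + ENNReal.ofReal c₂ * rhs := add_le_add hpart1 hpart2
    _ = ENNReal.ofReal (c₁ + c₂) * rhs := by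
      rw [← add_mul, ← ENNReal.ofReal_add hc₁0.le hc₂0.le]
    _ ≤ ENNReal.ofReal (c₁ + c₂) * (ENNReal.ofReal (K + B + 1) * (X + ENNReal.ofReal τ * Y)) := by
      gcongr
    _ = _ := by rw [← mul_assoc, ← ENNReal.ofReal_mul (by positivity)]

/-! ### Exceptional times and the defect measures -/

lemma IsLinftyLocL2.ae_memLp {d : ℕ} {U : Set (Space d)} {u : ℝ → Space d → ℝ}
    (h : IsLinftyLocL2 U u) :
    ∀ᵐ t ∂(volume.restrict (Ioi (0 : ℝ))), MemLp (u t) 2 (volume.restrict U) := by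
  have h1 := h.1
  rw [Measure.volume_eq_prod, ← Measure.prod_restrict] at h1
  have h2 : ∀ᵐ t ∂(volume.restrict (Ioi (0 : ℝ))), ∀ k : ℕ, t ∈ Icc (0 : ℝ) (k + 1) →
      eLpNorm (u t) 2 (volume.restrict U) < ⊤ := by
    refine ae_restrict_of_ae (ae_all_iff.2 fun k => ?_)
    rw [← ae_restrict_iff' measurableSet_Icc]
    have hk := h.2 (k + 1) (by positivity)
    filter_upwards [ENNReal.ae_le_essSup (μ := volume.restrict (Icc (0 : ℝ) (k + 1)))
      (fun t => eLpNorm (u t) 2 (volume.restrict U))] with t ht using ht.trans_lt hk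
  filter_upwards [h1.prodMk_left, h2, ae_restrict_mem measurableSet_Ioi] with t a b c
  obtain ⟨k, hk⟩ := exists_nat_ge t
  exact ⟨a, b k ⟨le_of_lt c, by linarith⟩⟩

lemma lintegral_enorm_rpow_ne_top {d : ℕ} {U : Set (Space d)} (hb : Bornology.IsBounded U)
    {w : Space d → ℝ} (hw : MemLp w 2 (volume.restrict U)) {δ : ℝ} (hδ : δ ∈ Ioc (0 : ℝ) 1) :
    ∫⁻ x in U, ‖w x‖ₑ ^ (δ + 1) ≠ ⊤ := by
  have : IsFiniteMeasure (volume.restrict U) := ⟨by simpa using hb.measure_lt_top⟩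
  have h0 : (0 : ℝ) < δ + 1 := by linarith [hδ.1]
  have h1 : MemLp w (ENNReal.ofReal (δ + 1)) (volume.restrict U) := by
    refine hw.mono_exponent ?_
    rw [← ENNReal.ofReal_ofNat 2]
    exact ENNReal.ofReal_le_ofReal (by linarith [hδ.2])
  have h2 := (eLpNorm_lt_top_iff_lintegral_rpow_enorm_lt_top
    (ENNReal.ofReal_pos.2 h0).ne' ENNReal.ofReal_ne_top).1 h1.2
  rw [ENNReal.toReal_ofReal h0.le] at h2
  exact h2.ne

/-- The mass of the parabolic defect measure on a time slab. -/
lemma parabolicDefect_slab {d : ℕ} {m : ℝ} {U : Set (Space d)} (hU : MeasurableSet U)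
    {u : ℝ → Space d → ℝ}
    (hu : AEStronglyMeasurable (fun y : ℝ × Space d => u y.1 y.2)
      (volume.restrict (Ioi (0 : ℝ) ×ˢ U))) {s t : ℝ} (hs : 0 ≤ s) :
    parabolicDefect m U u (U ×ˢ univ ×ˢ Ioc s t) = ENNReal.ofReal (4 * m / (m + 1) ^ 2) *
      ∫⁻ y in Ioc s t ×ˢ U, ‖spatialGradient U (halfPow m u) y.1 y.2‖ₑ ^ 2 := by
  have hm : MeasurableSet (U ×ˢ (univ : Set ℝ) ×ˢ Ioc s t) :=
    hU.prod (MeasurableSet.univ.prod measurableSet_Ioc)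
  have hsub : Ioc s t ×ˢ U ⊆ Ioi (0 : ℝ) ×ˢ U := prod_mono_left fun r hr => hs.trans_lt hr.1
  have hae : AEMeasurable (fun y : ℝ × Space d => (y.2, u y.1 y.2, y.1))
      (volume.restrict (Ioi (0 : ℝ) ×ˢ U)) :=
    measurable_snd.aemeasurable.prodMk (hu.aemeasurable.prodMk measurable_fst.aemeasurable)
  have hpre : (fun y : ℝ × Space d => (y.2, u y.1 y.2, y.1)) ⁻¹'
      (U ×ˢ (univ : Set ℝ) ×ˢ Ioc s t) = Ioc s t ×ˢ U := by
    ext y; simp [and_comm]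
  rw [parabolicDefect, Measure.map_apply_of_aemeasurable
    (hae.mono_ac (withDensity_absolutelyContinuous _ _)) hm, hpre,
    withDensity_apply _ (measurableSet_Ioc.prod hU),
    Measure.restrict_restrict (measurableSet_Ioc.prod hU), inter_eq_left.2 hsub,
    lintegral_const_mul' _ _ ENNReal.ofReal_ne_top]

lemma isL2H10Gradient_spatialGradient {d : ℕ} {U : Set (Space d)} {w : ℝ → Space d → ℝ}
    (h : ∃ G, IsL2H10Gradient U w G) : IsL2H10Gradient U w (spatialGradient U w) :=
  Classical.epsilon_spec h

lemma defect_slab_ne_top {d n : ℕ} {m : ℝ} {U : Set (Space d)} (hU : MeasurableSet U)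
    {f : Fin n → Space d → ℝ} {z : ℝ → Fin n → ℝ} {u₀ : Space d → ℝ} {u : ℝ → Space d → ℝ}
    {p : Measure (Space d × ℝ × ℝ)} (hu : IsPathwiseKineticSolution m U f z u₀ u)
    (hp : IsEntropyDefect m U f z u₀ u p) {s t : ℝ} (hs : 0 ≤ s) (hst : s < t) :
    (p + parabolicDefect m U u) (U ×ˢ univ ×ˢ Ioc s t) ≠ ⊤ := by
  rw [Measure.add_apply, parabolicDefect_slab hU hu.linftyLocL2.1 hs]
  refine ENNReal.add_ne_top.2 ⟨?_, ENNReal.mul_ne_top ENNReal.ofReal_ne_top ?_⟩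
  · refine measure_ne_top_of_subset ?_ (hp.finite (t + 1) (by linarith)).ne
    exact prod_mono_right (prod_mono_right fun r hr => ⟨hs.trans_lt hr.1, by linarith [hr.2]⟩)
  · exact ((isL2H10Gradient_spatialGradient hu.halfPow_mem).lintegral_gradient_lt_top hs hst).ne

/-- Outside of a null set of positive times the state is square integrable and the kinetic equation
holds. -/
lemma IsEntropyDefect.exists_good_times {d n : ℕ} {m : ℝ} {U : Set (Space d)}
    {f : Fin n → Space d → ℝ} {z : ℝ → Fin n → ℝ} {u₀ : Space d → ℝ} {u : ℝ → Space d → ℝ}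
    {p : Measure (Space d × ℝ × ℝ)} (hu₀ : MemLp u₀ 2 (volume.restrict U))
    (hu : IsLinftyLocL2 U u) (hp : IsEntropyDefect m U f z u₀ u p) :
    ∃ N : Set ℝ, N ⊆ Ioi 0 ∧ volume N = 0 ∧
      (∀ t, 0 ≤ t → t ∉ N → MemLp (state u₀ u t) 2 (volume.restrict U)) ∧
      ∀ s t, 0 ≤ s → s < t → s ∉ N → t ∉ N →
        KineticEquation m U f z u₀ u (p + parabolicDefect m U u) s t := by
  obtain ⟨N, hN0, hN, hker⟩ := hp.kinetic_equation
  have hae := hu.ae_memLp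
  rw [ae_restrict_iff' measurableSet_Ioi, ae_iff] at hae
  refine ⟨N ∪ {t | ¬(t ∈ Ioi (0 : ℝ) → MemLp (u t) 2 (volume.restrict U))}, ?_,
    measure_union_null hN hae, ?_, ?_⟩
  · refine union_subset hN0 fun t ht => ?_
    by_contra h
    exact ht fun h' => absurd h' h
  · intro t ht htN
    rcases ht.eq_or_lt with rfl | h0
    · simpa [state] using hu₀
    · rw [state, if_neg h0.ne']
      by_contra h
      exact htN (Or.inr fun h' => h (h' h0))
  · intro s t hs hst hsN htN
    exact hker s t hs hst (fun h => hsN (Or.inl h)) (fun h => htN (Or.inl h))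

/-- The parabolic defect measure controls the diffusion term, by the Poincaré inequality. -/
lemma exists_parabolicDefect_lower_bound {d : ℕ} (hd : 1 ≤ d) {m : ℝ} (hm : 0 < m)
    {U : Set (Space d)} (hU : IsOpen U) (hb : Bornology.IsBounded U) :
    ∃ c : ℝ, 0 < c ∧ ∀ {u : ℝ → Space d → ℝ} (_ : IsLinftyLocL2 U u)
      (_ : ∃ G, IsL2H10Gradient U (halfPow m u) G) {s t : ℝ} (_ : 0 ≤ s),
      ∫⁻ y in Ioc s t ×ˢ U, ‖u y.1 y.2‖ₑ ^ (m + 1) ≤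
        ENNReal.ofReal c * parabolicDefect m U u (U ×ˢ univ ×ˢ Ioc s t) := by
  obtain ⟨C, hC⟩ := exists_poincare hd hU hb
  have hκ : 0 < 4 * m / (m + 1) ^ 2 := by positivity
  refine ⟨(C + 1) * (4 * m / (m + 1) ^ 2)⁻¹, by positivity, fun {u} hu hG {s t} hs => ?_⟩
  have h := (isL2H10Gradient_spatialGradient hG).lintegral_le hm (Subset.refl U) (Subset.refl U)
    (I := Ioc s t) (fun r hr => hs.trans_lt hr.1) (ENNReal.coe_ne_top) hC
  refine h.trans ?_
  rw [parabolicDefect_slab hU.measurableSet hu.1 hs, ← mul_assoc,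
    ← ENNReal.ofReal_mul (by positivity), inv_mul_cancel_right₀ hκ.ne']
  gcongr
  rw [← ENNReal.ofReal_coe_nnreal]
  exact ENNReal.ofReal_le_ofReal (by linarith)

/-! ### The energy estimate -/

/-- If the driving signal oscillates little on `[s, t]`, then the source term in the entropy
estimate for `δ = 1` is absorbed by the parabolic defect. -/
lemma exists_short_time_energy_estimate {d n : ℕ} (hd : 1 ≤ d) {m : ℝ} (hm : 0 < m)
    {U : Set (Space d)} (hU : IsSmoothBoundedOpen U) (hne : Uᶜ.Nonempty)
    {f : Fin n → Space d → ℝ} (hf : ∀ k, IsCb2 U (f k)) :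
    ∃ τ C : ℝ, 0 < τ ∧ 1 ≤ C ∧ ∀ {z : ℝ → Fin n → ℝ} (_ : ContinuousOn z (Ici 0))
      {u₀ : Space d → ℝ} {u : ℝ → Space d → ℝ} {p : Measure (Space d × ℝ × ℝ)} {s t : ℝ}
      (_ : IsPathwiseKineticSolution m U f z u₀ u) (_ : IsEntropyDefect m U f z u₀ u p)
      (_ : 0 ≤ s) (_ : s < t) (_ : ∀ r ∈ Icc s t, ∀ k, |z r k - z s k| ≤ τ)
      (_ : MemLp (state u₀ u s) 2 (volume.restrict U))
      (_ : MemLp (state u₀ u t) 2 (volume.restrict U))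
      (_ : KineticEquation m U f z u₀ u (p + parabolicDefect m U u) s t),
      (∫⁻ x in U, ‖state u₀ u t x‖ₑ ^ (2 : ℝ)) +
          (∫⁻ y in Ioc s t ×ˢ U, ‖u y.1 y.2‖ₑ ^ (m + 1)) ≤
        ENNReal.ofReal C * ∫⁻ x in U, ‖state u₀ u s x‖ₑ ^ (2 : ℝ) := by
  have h01 : (1 : ℝ) ∈ Ioc (0 : ℝ) 1 := ⟨one_pos, le_rfl⟩
  obtain ⟨B, hB, hest⟩ := exists_entropy_estimate hm hU hne hf zero_le_one h01
  obtain ⟨c, hc, hlow⟩ := exists_parabolicDefect_lower_bound hd hm hU.isOpen hU.isBounded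
  refine ⟨min 1 (1 / (2 * B * c)), max 1 ((1 + 2 * c) * B), lt_min one_pos (by positivity),
    le_max_left _ _, ?_⟩
  intro z hz u₀ u p s t hu hp hs hst hosc hms hmt hker
  set τ := min 1 (1 / (2 * B * c)) with hτ
  have hτ0 : 0 ≤ τ := le_min zero_le_one (by positivity)
  have hν := defect_slab_ne_top hU.isOpen.measurableSet hu hp hs hst
  have h := hest hz hs hst hτ0 (min_le_left _ _) hosc hu.linftyLocL2.1
    (isL2H10Gradient_spatialGradient hu.halfPow_mem) hν hms.1 hmt.1
    (lintegral_enorm_rpow_ne_top hU.isBounded hms h01)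
    (lintegral_enorm_rpow_ne_top hU.isBounded hmt h01) hker
  have hY := hlow hu.linftyLocL2 hu.halfPow_mem (t := t) hs
  rw [one_add_one_eq_two, sub_self] at h
  simp only [ENNReal.rpow_zero, setLIntegral_one] at h
  set V := (p + parabolicDefect m U u) (U ×ˢ univ ×ˢ Ioc s t) with hV
  set Y := ∫⁻ y in Ioc s t ×ˢ U, ‖u y.1 y.2‖ₑ ^ (m + 1) with hYdef
  set X₁ := ∫⁻ x in U, ‖state u₀ u t x‖ₑ ^ (2 : ℝ)
  set X₀ := ∫⁻ x in U, ‖state u₀ u s x‖ₑ ^ (2 : ℝ)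
  have hYV : Y ≤ ENNReal.ofReal c * V := by
    refine hY.trans ?_
    gcongr
    rw [hV, Measure.add_apply]
    exact le_add_self
  have hhalf : V = ENNReal.ofReal (1 / 2) * V + ENNReal.ofReal (1 / 2) * V := by
    rw [← add_mul, ← ENNReal.ofReal_add (by norm_num) (by norm_num)]
    norm_num
  have habs : ENNReal.ofReal B * (ENNReal.ofReal τ * Y) ≤ ENNReal.ofReal (1 / 2) * V := by
    calc ENNReal.ofReal B * (ENNReal.ofReal τ * Y) ≤
          ENNReal.ofReal B * (ENNReal.ofReal (1 / (2 * B * c)) * (ENNReal.ofReal c * V)) := by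
          gcongr
          exact min_le_right _ _
      _ = _ := by
          rw [← mul_assoc, ← mul_assoc, ← ENNReal.ofReal_mul hB.le,
            ← ENNReal.ofReal_mul (by positivity)]
          congr 2
          field_simp
  have hkey : X₁ + ENNReal.ofReal (1 / 2) * V ≤ ENNReal.ofReal B * X₀ := by
    have hVt : ENNReal.ofReal (1 / 2) * V ≠ ⊤ := ENNReal.mul_ne_top ENNReal.ofReal_ne_top hν
    refine ENNReal.le_of_add_le_add_right hVt ?_
    rw [add_assoc, ← hhalf]
    refine h.trans ?_
    rw [mul_add]
    gcongr
  calc X₁ + Y ≤ X₁ + ENNReal.ofReal c * V := by gcongr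
    _ ≤ ENNReal.ofReal (1 + 2 * c) * X₁ + ENNReal.ofReal (1 + 2 * c) *
        (ENNReal.ofReal (1 / 2) * V) := by
        refine add_le_add ?_ ?_
        · exact le_mul_of_one_le_left' (ENNReal.one_le_ofReal.2 (by linarith))
        · rw [← mul_assoc, ← ENNReal.ofReal_mul (by positivity)]
          gcongr
          linarith
    _ ≤ ENNReal.ofReal (1 + 2 * c) * (ENNReal.ofReal B * X₀) := by
        rw [← mul_add]; gcongr
    _ ≤ _ := by
        rw [← mul_assoc, ← ENNReal.ofReal_mul (by positivity)]
        gcongr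
        exact le_max_right _ _

lemma exists_uniform_oscillation {n : ℕ} {z : ℝ → Fin n → ℝ} (hz : ContinuousOn z (Ici 0)) (T : ℝ)
    {τ : ℝ} (hτ : 0 < τ) :
    ∃ h : ℝ, 0 < h ∧ h ≤ 1 ∧ ∀ s ∈ Icc 0 T, ∀ r ∈ Icc 0 T, |r - s| ≤ h →
      ∀ k, |z r k - z s k| ≤ τ := by
  have huc := isCompact_Icc.uniformContinuousOn_of_continuous
    (hz.mono (Icc_subset_Ici_self : Icc 0 T ⊆ Ici 0))
  obtain ⟨h, hh, H⟩ := Metric.uniformContinuousOn_iff.1 huc τ hτ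
  refine ⟨min 1 (h / 2), lt_min one_pos (by positivity), min_le_left _ _, ?_⟩
  intro s hs r hr hrs k
  have := H r hr s hs (by
    rw [Real.dist_eq]
    linarith [min_le_right 1 (h / 2)])
  rw [← Real.dist_eq]
  exact (dist_le_pi_dist _ _ k).trans this.le

/-- The global bound on the diffusion term, by iteration of the short time estimate. -/
lemma exists_energy_estimate {d n : ℕ} (hd : 1 ≤ d) {m : ℝ} (hm : 0 < m)
    {U : Set (Space d)} (hU : IsSmoothBoundedOpen U) (hne : Uᶜ.Nonempty)
    {f : Fin n → Space d → ℝ} (hf : ∀ k, IsCb2 U (f k)) {z : ℝ → Fin n → ℝ}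
    (hz : ContinuousOn z (Ici 0)) {T : ℝ} (hT : 0 < T) :
    ∃ C : ℝ, 0 < C ∧ ∀ {u₀ : Space d → ℝ} {u : ℝ → Space d → ℝ} {p : Measure (Space d × ℝ × ℝ)}
      (_ : MemLp u₀ 2 (volume.restrict U))
      (_ : IsPathwiseKineticSolution m U f z u₀ u) (_ : IsEntropyDefect m U f z u₀ u p),
      ∫⁻ y in Ioc 0 T ×ˢ U, ‖u y.1 y.2‖ₑ ^ (m + 1) ≤
        ENNReal.ofReal C * ∫⁻ x in U, ‖u₀ x‖ₑ ^ (2 : ℝ) := by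
  obtain ⟨τ, C, hτ, hC, hstep⟩ := exists_short_time_energy_estimate hd hm hU hne hf
  obtain ⟨h, hh, hh1, hosc⟩ := exists_uniform_oscillation hz (2 * T + 1) hτ
  obtain ⟨J, hJ⟩ : ∃ J : ℕ, T ≤ J * (h / 2) ∧ J * h ≤ 2 * T + 1 := by
    refine ⟨⌈T / (h / 2)⌉₊, ?_, ?_⟩
    · rw [← div_le_iff₀ (by positivity)]
      exact Nat.le_ceil _
    · have h1 := (Nat.ceil_lt_add_one (show 0 ≤ T / (h / 2) by positivity)).le
      calc (⌈T / (h / 2)⌉₊ : ℝ) * h ≤ (T / (h / 2) + 1) * h := by gcongr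
        _ = 2 * T + h := by field_simp
        _ ≤ _ := by linarith
  refine ⟨C ^ J, by positivity, ?_⟩
  intro u₀ u p hu₀ hu hp
  obtain ⟨N, hN0, hN, hmem, hker⟩ := hp.exists_good_times hu₀ hu.linftyLocL2
  have hiter : ∀ j : ℕ, j ≤ J → ∃ s, s ∉ N ∧ j * (h / 2) ≤ s ∧ s ≤ j * h ∧
      (∫⁻ x in U, ‖state u₀ u s x‖ₑ ^ (2 : ℝ)) +
          (∫⁻ y in Ioc 0 s ×ˢ U, ‖u y.1 y.2‖ₑ ^ (m + 1)) ≤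
        ENNReal.ofReal (C ^ j) * ∫⁻ x in U, ‖u₀ x‖ₑ ^ (2 : ℝ) := by
    intro j
    induction j with
    | zero =>
      refine fun _ => ⟨0, fun h0 => lt_irrefl (0 : ℝ) (hN0 h0), by simp, by simp, ?_⟩
      simp [state]
    | succ j ih =>
      intro hj
      obtain ⟨s, hsN, hs1, hs2, hs⟩ := ih (by omega)
      have hs0 : 0 ≤ s := le_trans (by positivity) hs1
      obtain ⟨t, ht, htN⟩ : ∃ t ∈ Icc (s + h / 2) (s + h), t ∉ N := by
        by_contra! hcon
        have hle := measure_mono (μ := volume) (show Icc (s + h / 2) (s + h) ⊆ N from hcon)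
        rw [hN, Real.volume_Icc, nonpos_iff_eq_zero, ENNReal.ofReal_eq_zero] at hle
        linarith
      have hst : s < t := by linarith [ht.1]
      have hjh : ((j + 1 : ℕ) : ℝ) * h ≤ 2 * T + 1 := by
        refine le_trans ?_ hJ.2
        gcongr
      have htT : t ≤ 2 * T + 1 := by
        push_cast at hjh
        linarith [ht.2]
      refine ⟨t, htN, by push_cast; linarith [ht.1], by push_cast; linarith [ht.2], ?_⟩
      have hE := hstep hz hu hp hs0 hst (fun r hr k => hosc s ⟨hs0, hst.le.trans htT⟩ r
        ⟨hs0.trans hr.1, hr.2.trans htT⟩ (by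
          rw [abs_of_nonneg (by linarith [hr.1])]
          linarith [hr.2, ht.2]) k) (hmem s hs0 hsN) (hmem t (hs0.trans hst.le) htN)
        (hker s t hs0 hst hsN htN)
      have hunion : Ioc 0 t ×ˢ U = (Ioc 0 s ×ˢ U) ∪ (Ioc s t ×ˢ U) := by
        rw [← union_prod, Ioc_union_Ioc_eq_Ioc hs0 hst.le]
      have hC1 : 1 ≤ ENNReal.ofReal C := ENNReal.one_le_ofReal.2 hC
      set X₁ := ∫⁻ x in U, ‖state u₀ u t x‖ₑ ^ (2 : ℝ)
      set X₀ := ∫⁻ x in U, ‖state u₀ u s x‖ₑ ^ (2 : ℝ)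
      set Y₀ := ∫⁻ y in Ioc 0 s ×ˢ U, ‖u y.1 y.2‖ₑ ^ (m + 1)
      set Y₁ := ∫⁻ y in Ioc s t ×ˢ U, ‖u y.1 y.2‖ₑ ^ (m + 1)
      calc X₁ + ∫⁻ y in Ioc 0 t ×ˢ U, ‖u y.1 y.2‖ₑ ^ (m + 1) ≤ X₁ + (Y₀ + Y₁) := by
            rw [hunion]
            gcongr
            exact lintegral_union_le _ _ _
        _ = (X₁ + Y₁) + Y₀ := by ring
        _ ≤ ENNReal.ofReal C * X₀ + ENNReal.ofReal C * Y₀ := by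
            gcongr
            exact le_mul_of_one_le_left' hC1
        _ ≤ ENNReal.ofReal C * (ENNReal.ofReal (C ^ j) * ∫⁻ x in U, ‖u₀ x‖ₑ ^ (2 : ℝ)) := by
            rw [← mul_add]
            gcongr
        _ = _ := by
            rw [← mul_assoc, ← ENNReal.ofReal_mul (by linarith), pow_succ']
  obtain ⟨s, -, hs1, -, hs⟩ := hiter J le_rfl
  refine le_trans ?_ (le_trans le_add_self hs)
  exact lintegral_mono_set (prod_mono_left (Ioc_subset_Ioc_right (hJ.1.trans hs1)))

/-! ### The estimate for the whole solution -/

lemma eLpNorm_rpow_eq_lintegral {α : Type*} [MeasurableSpace α] {μ : Measure α} (w : α → ℝ) {a : ℝ}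
    (ha : 0 < a) : eLpNorm w (ENNReal.ofReal a) μ ^ a = ∫⁻ x, ‖w x‖ₑ ^ a ∂μ := by
  rw [eLpNorm_eq_lintegral_rpow_enorm_toReal (ENNReal.ofReal_pos.2 ha).ne' ENNReal.ofReal_ne_top,
    ENNReal.toReal_ofReal ha.le, ← ENNReal.rpow_mul, one_div_mul_cancel ha.ne', ENNReal.rpow_one]

/-- The comparison of `L^p` norms on a space of finite measure, in terms of moments. -/
lemma lintegral_rpow_le_rpow_mul_measure_univ {α : Type*} [MeasurableSpace α] {μ : Measure α}
    {w : α → ℝ} (hw : AEStronglyMeasurable w μ) {a b : ℝ} (ha : 0 < a) (hab : a ≤ b) :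
    ∫⁻ x, ‖w x‖ₑ ^ a ∂μ ≤ (∫⁻ x, ‖w x‖ₑ ^ b ∂μ) ^ (a / b) * μ univ ^ (1 - a / b) := by
  have h := ENNReal.rpow_le_rpow (eLpNorm'_le_eLpNorm'_mul_rpow_measure_univ ha hab hw) ha.le
  rw [eLpNorm'_eq_lintegral_enorm, eLpNorm'_eq_lintegral_enorm,
    ENNReal.mul_rpow_of_nonneg _ _ ha.le,
    ← ENNReal.rpow_mul, ← ENNReal.rpow_mul, ← ENNReal.rpow_mul, one_div_mul_cancel ha.ne',
    ENNReal.rpow_one] at h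
  have e1 : 1 / b * a = a / b := by ring
  have e2 : (1 / a - 1 / b) * a = 1 - a / b := by
    rw [sub_mul, one_div_mul_cancel ha.ne', e1]
  rwa [e1, e2] at h

lemma exists_oscillation_bound {n : ℕ} {z : ℝ → Fin n → ℝ} (hz : ContinuousOn z (Ici 0)) (T : ℝ) :
    ∃ W : ℝ, 0 ≤ W ∧ ∀ r ∈ Icc 0 T, ∀ k, |z r k - z 0 k| ≤ W := by
  obtain ⟨W, hW⟩ := isCompact_Icc.exists_bound_of_continuousOn
    ((hz.mono (Icc_subset_Ici_self : Icc 0 T ⊆ Ici 0)).sub (continuousOn_const (c := z 0)))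
  refine ⟨max W 0, le_max_right _ _, fun r hr k => ?_⟩
  exact (norm_le_pi_norm (z r - z 0) k).trans ((hW r hr).trans (le_max_left _ _))

lemma nonempty_compl_of_isBounded {d : ℕ} (hd : 1 ≤ d) {U : Set (Space d)}
    (hb : Bornology.IsBounded U) : Uᶜ.Nonempty := by
  have : Nonempty (Fin d) := ⟨⟨0, hd⟩⟩
  rw [nonempty_compl]
  rintro rfl
  exact NormedSpace.unbounded_univ ℝ (Space d) hb

end PathwiseKinetic

theorem proposition3p4 {d n : ℕ} (hd : 1 ≤ d) (m : ℝ) (hm : 0 < m)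
    (U : Set (Space d)) (hU : IsSmoothBoundedOpen U)
    (f : Fin n → Space d → ℝ) (hf : ∀ k, IsCb2 U (f k))
    (z : ℝ → Fin n → ℝ) (hz : ContinuousOn z (Ici 0))
    (δ : ℝ) (hδ : δ ∈ Ioc (0 : ℝ) 1) (T : ℝ) (hT : 0 < T) :
    ∃ C : ℝ, 0 < C ∧
      ∀ (u₀ : Space d → ℝ) (u : ℝ → Space d → ℝ) (p : Measure (Space d × ℝ × ℝ)),
        MemLp u₀ 2 (volume.restrict U) →
        IsPathwiseKineticSolution m U f z u₀ u →
        IsEntropyDefect m U f z u₀ u p →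
        essSup (fun t => eLpNorm (u t) (ENNReal.ofReal (1 + δ)) (volume.restrict U))
              (volume.restrict (Icc 0 T)) ^ (1 + δ) +
            ∫⁻ y in U ×ˢ (univ : Set ℝ) ×ˢ Ioc 0 T,
              ENNReal.ofReal |y.2.1| ^ (δ - 1) ∂(p + parabolicDefect m U u) ≤
          ENNReal.ofReal C *
            (eLpNorm u₀ (ENNReal.ofReal (1 + δ)) (volume.restrict U) ^ (1 + δ) +
              eLpNorm u₀ 2 (volume.restrict U) ^ (2 * ((m + δ) / (m + 1)))) := by
  have hne := nonempty_compl_of_isBounded hd hU.isBounded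
  have hδ0 : 0 < 1 + δ := by linarith [hδ.1]
  have hT1 : 0 < T + 1 := by linarith
  -- Estimates up to the time `T + 1` leave room for an unexceptional time after `T`.
  obtain ⟨W, hW, hosc⟩ := exists_oscillation_bound hz (T + 1)
  obtain ⟨E, hE, henergy⟩ := exists_energy_estimate hd hm hU hne hf hz hT1
  obtain ⟨B, hB, hest⟩ := exists_entropy_estimate hm hU hne hf hW hδ
  set θ := (m + δ) / (m + 1) with hθ
  have hθ0 : 0 ≤ θ := div_nonneg (by linarith [hδ.1]) (by linarith)
  have hθ1 : θ ≤ 1 := (div_le_one (by linarith)).2 (by linarith [hδ.2])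
  set K : ENNReal := ENNReal.ofReal E ^ θ * volume (Ioc 0 (T + 1) ×ˢ U) ^ (1 - θ) with hK
  have hKt : K ≠ ⊤ := by
    refine ENNReal.mul_ne_top (ENNReal.rpow_ne_top_of_nonneg hθ0 ENNReal.ofReal_ne_top)
      (ENNReal.rpow_ne_top_of_nonneg (by linarith) ?_)
    rw [Measure.volume_eq_prod, Measure.prod_prod]
    exact ENNReal.mul_ne_top (by simp) hU.isBounded.measure_lt_top.ne
  refine ⟨2 * (B * (1 + W * K.toReal)), by positivity, ?_⟩
  intro u₀ u p hu₀ hu hp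
  obtain ⟨N, hN0, hN, hmem, hker⟩ := hp.exists_good_times hu₀ hu.linftyLocL2
  have h0N : (0 : ℝ) ∉ N := fun h => lt_irrefl (0 : ℝ) (hN0 h)
  set ν := p + parabolicDefect m U u with hν
  set X := eLpNorm u₀ (ENNReal.ofReal (1 + δ)) (volume.restrict U) ^ (1 + δ) with hX
  set Z := eLpNorm u₀ 2 (volume.restrict U) ^ (2 * θ) with hZ
  -- Hölder's inequality and the energy estimate.
  have hY : ∫⁻ y in Ioc 0 (T + 1) ×ˢ U, ‖u y.1 y.2‖ₑ ^ (m + δ) ≤ K * Z := by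
    have h1 := lintegral_rpow_le_rpow_mul_measure_univ (hu.linftyLocL2.1.mono_measure
      (Measure.restrict_mono (prod_mono_left (Ioc_subset_Ioi_self : Ioc 0 (T + 1) ⊆ Ioi 0)) le_rfl))
      (a := m + δ) (b := m + 1) (by linarith [hδ.1]) (by linarith [hδ.2])
    have h2 := henergy hu₀ hu hp
    have h3 : (∫⁻ x in U, ‖u₀ x‖ₑ ^ (2 : ℝ)) ^ θ = Z := by
      rw [← eLpNorm_rpow_eq_lintegral u₀ two_pos, ← ENNReal.rpow_mul, hZ, ENNReal.ofReal_ofNat]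
    refine h1.trans ?_
    rw [Measure.restrict_apply_univ, hK, ← h3, mul_right_comm,
      ← ENNReal.mul_rpow_of_nonneg _ _ hθ0]
    gcongr
  set R := ENNReal.ofReal (B * (1 + W * K.toReal)) * (X + Z) with hR
  have hgood : ∀ t, 0 < t → t ≤ T + 1 → t ∉ N →
      eLpNorm (u t) (ENNReal.ofReal (1 + δ)) (volume.restrict U) ^ (1 + δ) +
        (∫⁻ y in U ×ˢ (univ : Set ℝ) ×ˢ Ioc 0 t, ENNReal.ofReal |y.2.1| ^ (δ - 1) ∂ν) ≤ R := by
    intro t ht0 htT htN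
    have hm0 := hmem 0 le_rfl h0N
    have hmt := hmem t ht0.le htN
    have h := hest hz le_rfl ht0 hW le_rfl
      (fun r hr k => hosc r ⟨hr.1, hr.2.trans htT⟩ k) hu.linftyLocL2.1
      (isL2H10Gradient_spatialGradient hu.halfPow_mem)
      (defect_slab_ne_top hU.isOpen.measurableSet hu hp le_rfl ht0) hm0.1 hmt.1
      (lintegral_enorm_rpow_ne_top hU.isBounded hm0 hδ)
      (lintegral_enorm_rpow_ne_top hU.isBounded hmt hδ) (hker 0 t le_rfl ht0 h0N htN)
    have hs0 : state u₀ u 0 = u₀ := if_pos rfl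
    have hst : state u₀ u t = u t := if_neg ht0.ne'
    rw [hs0, hst, add_comm δ 1, ← eLpNorm_rpow_eq_lintegral _ hδ0,
      ← eLpNorm_rpow_eq_lintegral _ hδ0] at h
    refine h.trans ?_
    have hYt : ∫⁻ y in Ioc 0 t ×ˢ U, ‖u y.1 y.2‖ₑ ^ (m + δ) ≤ K * Z :=
      (lintegral_mono_set (prod_mono_left (Ioc_subset_Ioc_right htT))).trans hY
    rw [hR, ENNReal.ofReal_mul hB.le, mul_assoc,
      ENNReal.ofReal_add zero_le_one (mul_nonneg hW ENNReal.toReal_nonneg), ENNReal.ofReal_one,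
      ENNReal.ofReal_mul hW, ENNReal.ofReal_toReal hKt]
    gcongr
    calc X + ENNReal.ofReal W * ∫⁻ y in Ioc 0 t ×ˢ U, ‖u y.1 y.2‖ₑ ^ (m + δ)
        ≤ X + ENNReal.ofReal W * (K * Z) := by gcongr
      _ ≤ 1 * X + 1 * Z + ENNReal.ofReal W * K * X + ENNReal.ofReal W * K * Z := by
        rw [one_mul, ← mul_assoc]
        gcongr
        exact le_self_add.trans le_self_add
      _ = _ := by ring
  have hsup : essSup (fun t => eLpNorm (u t) (ENNReal.ofReal (1 + δ)) (volume.restrict U))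
      (volume.restrict (Icc 0 T)) ^ (1 + δ) ≤ R := by
    rw [← ENNReal.le_rpow_inv_iff hδ0]
    refine essSup_le_of_ae_le _ ?_
    have hN' : ∀ᵐ t ∂(volume : Measure ℝ), t ∉ N := measure_eq_zero_iff_ae_notMem.1 hN
    have h0 : ∀ᵐ t ∂(volume : Measure ℝ), t ≠ 0 := Measure.ae_ne volume 0
    filter_upwards [ae_restrict_of_ae hN', ae_restrict_of_ae h0, ae_restrict_mem measurableSet_Icc]
      with t htN ht0 ht
    rw [ENNReal.le_rpow_inv_iff hδ0]
    exact le_self_add.trans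
      (hgood t (lt_of_le_of_ne ht.1 ht0.symm) (by linarith [ht.2]) htN)
  have hint : ∫⁻ y in U ×ˢ (univ : Set ℝ) ×ˢ Ioc 0 T, ENNReal.ofReal |y.2.1| ^ (δ - 1) ∂ν ≤ R := by
    obtain ⟨t, ht, htN⟩ : ∃ t ∈ Icc T (T + 1), t ∉ N := by
      by_contra! hcon
      have hle := measure_mono (μ := volume) (show Icc T (T + 1) ⊆ N from hcon)
      rw [hN, Real.volume_Icc, nonpos_iff_eq_zero, ENNReal.ofReal_eq_zero] at hle
      linarith
    refine (lintegral_mono_set ?_).trans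
      (le_add_self.trans (hgood t (hT.trans_le ht.1) ht.2 htN))
    exact prod_mono_right (prod_mono_right (Ioc_subset_Ioc_right ht.1))
  calc _ ≤ R + R := add_le_add hsup hint
    _ = _ := by
      rw [ENNReal.ofReal_mul two_pos.le, mul_assoc, ENNReal.ofReal_ofNat, two_mul]
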